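/- Fix $\mu>-1/2$. For $x>0$ and $\alpha\in\mathbb R$ let $K_\alpha(x)=\int_0^\infty e^{-x\cosh u}\cosh(\alpha u)\,du$ be the Macdonald function. Let $\nu_{e,\mu}$ and $\nu_{o,\mu}$ be the measures on $\mathbb C$ with densities $$\frac{2^{1/2-\mu}}{\pi\,\Gamma(\mu+\frac12)}K_{\mu-\frac12}(|z|^2)|z|^{2\mu+1}\quad\text{and}\quad \frac{2^{1/2-\mu}}{\pi\,\Gamma(\mu+\frac12)}K_{\mu+\frac12}(|z|^2)|z|^{2\mu+1}$$ with respect to Lebesgue measure $dx\,dy$. Let $\mathcal B^r_{e,\mu}$ be the space of even entire functions in $L^r(\nu_{e,\mu})$, and for $a\in\mathbb R$ let $\mathcal B^r_{e,\mu,a}$ be the space of even entire functions in $L^r(e^{-a|z|^2}d\nu_{e,\mu})$ with the norm of that $L^r$ space. Put $\gamma_\mu(0)=1$ and, for $k\ge1$, $\gamma_\mu(k)=(k+2\mu\chi(k))\gamma_\mu(k-1)$ with $\chi(k)=1$ for $k$ odd and $\chi(k)=0$ for $k$ even. Let $\exp_\mu(z)=\sum_{k\ge0}z^k/\gamma_\mu(k)$,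 let $\exp_{\mu,e}$ be its even part, and let $K_ef(w)=\int_{\mathbb C}\exp_{\mu,e}(\bar z w)f(z)\,d\nu_{e,\mu}(z)$. For $f\in L^2(\nu)$, $\nu$ a finite measure, the entropy is $S_{L^2(\nu)}(f)=\int|f|^2\log|f|^2\,d\nu-\|f\|^2\log\|f\|^2\in(-\infty,\infty]$, where $0\log0=0$ and $\|\cdot\|$ is the norm of $L^2(\nu)$. For $f\in\mathcal B^2_{e,\mu}$ the energy is $E_{e,\mu}(f)=\int|z|^2|f(z)|^2\,d\nu_{e,\mu}(z)\in[0,\infty]$. Products of extended real numbers use $0\cdot\infty=0$. **Theorem.** Let $1<p\le\infty$, $1\le q<\infty$, let $p'$ be the exponent conjugate to $p$, and let $a>p'q/4-1$. Then $K_e$ is defined by absolutely convergent integrals on $L^p(\nu_{e,\mu})$ and maps it boundedly into $\mathcal B^q_{e,\mu,a}$; its operator norm $A_e$ satisfies $0<A_e<\infty$. The inequality $$(p^{-1}-q^{-1})\,S_{L^2(\nu_{e,\mu})}(f)\le(\log A_e)\,\|f\|^2_{L^2(\nu_{e,\mu})}+\frac aq\,E_{e,\mu}(f)\qquad(*)$$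 holds if (1) $f\in\mathcal B^{2+\varepsilon}_{e,\mu}$ for some $\varepsilon>0$, or if (2) $f\in\mathcal B^2_{e,\mu}$, $p\le2$, $q\le2$ and $S_{L^2(\nu_{e,\mu})}(f)<\infty$. Moreover: * Case 1: $p^{-1}>q^{-1}$. Then $p'q/4-1>0$, so $a>0$ and both $p^{-1}-q^{-1}$ and $a/q$ are positive. The inequality $(*)$ holds for all $f\in\mathcal B^2_{e,\mu}$ and gives the direct log-Sobolev inequality $S_{L^2(\nu_{e,\mu})}(f)\le C_1E_{e,\mu}(f)+C_2\|f\|^2$ for all $f\in\mathcal B^2_{e,\mu}$, with $C_1=\frac{a/q}{p^{-1}-q^{-1}}>0$ and $C_2=\frac{\max(\log A_e,0)}{p^{-1}-q^{-1}}\ge0$. * Case 2: $p^{-1}\le q^{-1}$ and $p'q/4-1\ge0$. Then $a>0$, $a/q>0$ and $p^{-1}-q^{-1}\le0$. For all $f\in\mathcal B^2_{e,\mu}$ one has $S_{L^2(\nu_{e,\mu})}(f)\ge0$, so that the left side of $(*)$ is $\le0$ and its energy term is $\ge0$; in particular $(*)$ holds trivially for all such $f$ if $A_e\ge1$. * Case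 3: $p'q/4-1<0$. Then $p^{-1}<q^{-1}$. If moreover $a<0$, then $a/q<0$, $(*)$ holds for all $f\in\mathcal B^2_{e,\mu}$ and gives the reverse log-Sobolev inequality $E_{e,\mu}(f)\le D_1S_{L^2(\nu_{e,\mu})}(f)+D_2\|f\|^2$ for all $f\in\mathcal B^2_{e,\mu}$, with $D_1=\frac{p^{-1}-q^{-1}}{a/q}>0$ and $D_2=\frac{\max(\log A_e,0)}{-a/q}\ge0$; moreover $A_e\ge1$. All of this also holds with $e$ replaced by $o$ and "even" by "odd" throughout, with two exceptions: in Case 2 the assertions about $f$ are made only if $\mu\le0$, and in Case 3 the assertion $A_o\ge1$ is not made. -/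

import Mathlib

open scoped ENNReal

noncomputable section

namespace SegalBargmann

open MeasureTheory

/-- The Macdonald function `K_α(x)` for `x > 0` and real order `α`, by its integral representation
`K_α(x) = ∫₀^∞ exp(-x cosh u) cosh(α u) du`. -/
def macdonald (α x : ℝ) : ℝ :=
  ∫ u in Set.Ioi (0 : ℝ), Real.exp (-x * Real.cosh u) * Real.cosh (α * u)

/-- The label `e` (even) or `o` (odd). -/
inductive Parity where
  | even : Parity
  | odd : Parity

/-- `1` for even and `-1` for odd. -/
def Parity.sign : Parity → ℝ
  | .even => 1
  | .odd => -1

/-- The density of `ν_{e,μ}`, respectively `ν_{o,μ}`, with respect to Lebesgue measure on `ℂ`: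
`2^{1/2-μ} / (π Γ(μ+1/2)) * K_{μ∓1/2}(|z|²) * |z|^{2μ+1}`
(the order is `μ - 1/2` in the even case and `μ + 1/2` in the odd case). -/
def density (s : Parity) (μ : ℝ) (z : ℂ) : ℝ :=
  (2 : ℝ) ^ (1 / 2 - μ) / (Real.pi * Real.Gamma (μ + 1 / 2)) *
    macdonald (μ - s.sign * (1 / 2)) (‖z‖ ^ 2) * ‖z‖ ^ (2 * μ + 1)

/-- The measure `ν_{e,μ}`, respectively `ν_{o,μ}`. -/
def nu (s : Parity) (μ : ℝ) : Measure ℂ :=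
  volume.withDensity fun z => ENNReal.ofReal (density s μ z)

/-- The weighted measure `e^{-a|z|²} dν_{e,μ}(z)`, respectively `e^{-a|z|²} dν_{o,μ}(z)`. -/
def nuWeighted (s : Parity) (μ a : ℝ) : Measure ℂ :=
  (nu s μ).withDensity fun z => ENNReal.ofReal (Real.exp (-a * ‖z‖ ^ 2))

/-- The even (respectively odd) entire functions that are in `L^p` of the measure `m`. -/
def holomorphicLp (s : Parity) (m : Measure ℂ) (p : ℝ≥0∞) : Set (ℂ → ℂ) :=
  {f | Differentiable ℂ f ∧ (∀ z, f (-z) = (s.sign : ℂ) * f z) ∧ MemLp f p m}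

/-- The space `B^p_{e,μ}`, respectively `B^p_{o,μ}`. -/
def space (s : Parity) (μ : ℝ) (p : ℝ≥0∞) : Set (ℂ → ℂ) :=
  holomorphicLp s (nu s μ) p

/-- The weighted space `B^q_{e,μ,a}`, respectively `B^q_{o,μ,a}`. -/
def spaceWeighted (s : Parity) (μ : ℝ) (q : ℝ≥0∞) (a : ℝ) : Set (ℂ → ℂ) :=
  holomorphicLp s (nuWeighted s μ a) q

/-- The `μ`-deformed factorial: `γ_μ(0) = 1` and `γ_μ(k) = (k + 2 μ χ_o(k)) γ_μ(k-1)`, with `χ_o`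
the characteristic function of the odd integers. -/
def gammaMu (μ : ℝ) : ℕ → ℝ
  | 0 => 1
  | k + 1 => (((k + 1 : ℕ) : ℝ) + 2 * μ * (if Odd (k + 1) then 1 else 0)) * gammaMu μ k

/-- The `μ`-deformed exponential function. -/
def expMu (μ : ℝ) (z : ℂ) : ℂ :=
  ∑' k : ℕ, z ^ k / ((gammaMu μ k : ℝ) : ℂ)

/-- The kernel `K_e(z,w)`, respectively `K_o(z,w)`: the even, respectively odd, part of `exp_μ`
at the point `z^* w`. -/
def kernel (s : Parity) (μ : ℝ) (z w : ℂ) : ℂ :=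
  (expMu μ (star z * w) + (s.sign : ℂ) * expMu μ (-(star z * w))) / 2

/-- The integral kernel transform `K_e f`, respectively `K_o f`. -/
def transform (s : Parity) (μ : ℝ) (f : ℂ → ℂ) (w : ℂ) : ℂ :=
  ∫ z, kernel s μ z w * f z ∂(nu s μ)

/-- The operator norm `A_e(p,q,a,μ)`, respectively `A_o(p,q,a,μ)`, of the transform from
`L^p(ν_{e,μ})` to `B^q_{e,μ,a}` (`o` in place of `e` in the odd case). -/
def transformNorm (s : Parity) (μ : ℝ) (p q : ℝ≥0∞) (a : ℝ) : ℝ≥0∞ :=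
  sInf {C : ℝ≥0∞ | ∀ f : ℂ → ℂ, MemLp f p (nu s μ) →
    eLpNorm (transform s μ f) q (nuWeighted s μ a) ≤ C * eLpNorm f p (nu s μ)}

/-- The integral of a real function as an extended real number: integral of the positive part
minus integral of the negative part (used where the second one is finite). -/
def extendedIntegral {Ω : Type*} [MeasurableSpace Ω] (ν : Measure Ω) (g : Ω → ℝ) : EReal :=
  ((∫⁻ x, ENNReal.ofReal (g x) ∂ν : ℝ≥0∞) : EReal) -
    ((∫⁻ x, ENNReal.ofReal (-(g x)) ∂ν : ℝ≥0∞) : EReal)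

/-- The square of the `L²` norm. -/
def normSq {Ω : Type*} [MeasurableSpace Ω] (ν : Measure Ω) (f : Ω → ℂ) : ℝ :=
  (eLpNorm f 2 ν).toReal ^ 2

/-- The Shannon entropy `S_{L²(ν)}(f) = ∫ |f|² log |f|² dν - ‖f‖² log ‖f‖²` of `f ∈ L²(ν)`, for a
finite measure `ν`; the value `+∞` may occur. -/
def entropy {Ω : Type*} [MeasurableSpace Ω] (ν : Measure Ω) (f : Ω → ℂ) : EReal :=
  extendedIntegral ν (fun x => ‖f x‖ ^ 2 * Real.log (‖f x‖ ^ 2)) -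
    ((normSq ν f * Real.log (normSq ν f) : ℝ) : EReal)

/-- The `μ`-deformed energy `∫ |z|² |f(z)|² dν_{e,μ}(z)` (with `ν_{o,μ}` in the odd case). -/
def energy (s : Parity) (μ : ℝ) (f : ℂ → ℂ) : ℝ≥0∞ :=
  ∫⁻ z, ENNReal.ofReal (‖z‖ ^ 2 * ‖f z‖ ^ 2) ∂(nu s μ)

/-- The coefficient `p⁻¹ - q⁻¹` of the entropy (with `∞⁻¹ = 0`). -/
def entropyCoeff (p q : ℝ≥0∞) : ℝ :=
  (p⁻¹).toReal - (q⁻¹).toReal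

/-- The energy-entropy inequality for `f`:
`(p⁻¹ - q⁻¹) S(f) ≤ (log A) ‖f‖² + (a/q) E(f)`. -/
def EnergyEntropyIneq (s : Parity) (μ : ℝ) (p q : ℝ≥0∞) (a : ℝ) (f : ℂ → ℂ) : Prop :=
  ((entropyCoeff p q : ℝ) : EReal) * entropy (nu s μ) f ≤
    ((Real.log (transformNorm s μ p q a).toReal * normSq (nu s μ) f : ℝ) : EReal) +
      ((a / q.toReal : ℝ) : EReal) * (energy s μ f : EReal)

/-- A direct log-Sobolev inequality in `X`, with the constants `C₁ > 0` and `C₂ ≥ 0`, for the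
quadratic form `Q`. -/
def IsDirectLogSobolev {Ω : Type*} [MeasurableSpace Ω] (ν : Measure Ω) (X : Set (Ω → ℂ))
    (Q : (Ω → ℂ) → ℝ≥0∞) (C₁ C₂ : ℝ) : Prop :=
  0 < C₁ ∧ 0 ≤ C₂ ∧ ∀ f ∈ X,
    entropy ν f ≤ (C₁ : EReal) * (Q f : EReal) + ((C₂ * normSq ν f : ℝ) : EReal)

/-- A reverse log-Sobolev inequality in `X`, with the constants `D₁ > 0` and `D₂ ≥ 0`, for the
quadratic form `Q`. -/
def IsReverseLogSobolev {Ω : Type*} [MeasurableSpace Ω] (ν : Measure Ω) (X : Set (Ω → ℂ))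
    (Q : (Ω → ℂ) → ℝ≥0∞) (D₁ D₂ : ℝ) : Prop :=
  0 < D₁ ∧ 0 ≤ D₂ ∧ ∀ f ∈ X,
    (Q f : EReal) ≤ (D₁ : EReal) * entropy ν f + ((D₂ * normSq ν f : ℝ) : EReal)

end SegalBargmann

end

open MeasureTheory SegalBargmann

namespace SegalBargmann

open Set Filter Topology

/-! ### Hyperbolic integrals -/

/-! Write `P = 1/p`, `Q = 1/q`, `κ = a/q`, `N = ‖f‖²`, and `T` for the transform. The inequality is
the first variation of an interpolation estimate at a point of equality. Suppose `T f = f` and `f`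
grows more slowly than every Gaussian. Let `F(ζ)` be the double integral of `K(z,w) · f(z)
|f(z)|^{2ζ(P-1/2)} · conj f(w) |f(w)|^{2ζ(1/2-Q)} e^{-ζκ|w|²}`. On `Re ζ = 0` the multipliers have
modulus one, so contractivity of `T` on `L²` gives `|F| ≤ N`, with `F(0) = N`. On `Re ζ = 1` the
moduli are `|f|^{2P}` and `|f|^{2(1-Q)} e^{-κ|w|²}`, so the `L^p`-`L^q` bound and Hölder give `|F| ≤
A N^{1+P-Q}`. By the three lines theorem `|F(t)| ≤ N^{1-t} (A N^{1+P-Q})^t`. Both sides equal `N` at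
`t = 0`, so their derivatives there compare, and `F'(0) = (P-Q) ∫ |f|² log |f|² - κ E(f)` turns this
into the claim (`re_integral_mul_le_of_three_lines`, `energyEntropy_of_fixed`).

Two facts about `T` feed this. The Mellin transform of the Macdonald function gives `∫ |z|^{2k} dν =
γ_μ(k)` for `k` of the right parity (`integral_norm_pow_nu_eq_gammaMu`). With rotation invariance
the normalized monomials are then orthonormal, `T` fixes polynomials of the right parity, and
Bessel's inequality yields contractivity. Secondly, `|K(z,w)| ≤ C e^{l|z||w|}` for every `l > 1`,
while `e^{c|z|²}` is `ν`-integrable for `c < 1`; Young's and Hölder's inequalities give boundedness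
when `a > p'q/4 - 1` (`exists_transform_bound`).

For general `f` in the `L²` space, the Taylor polynomials of a dilate `f(r·)`, `r < 1`, are fixed by
`T` and share a square-integrable Gaussian bound, so the inequality reaches the dilates
(`realEnergyEntropyIneq_dilate`). Then `r → 1`. If `κ < 0` and the entropy is finite, Fatou's lemma
makes the energy finite; if `P > Q` and the energy is finite, it makes the entropy finite. Remaining
infinite values are harmless. The signs in the three cases come from `4P(1-P) ≤ 1`, and
nonnegativity of the entropy is Jensen's inequality for a measure of mass at most one
(`entropy_nonneg`, `nu_odd_univ_le`). -/

lemma cosh_mul_le_exp (α : ℝ) {u : ℝ} (hu : 0 ≤ u) : Real.cosh (α * u) ≤ Real.exp (|α| * u) := by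
  rw [← Real.cosh_abs, abs_mul, abs_of_nonneg hu, Real.cosh_eq]
  have : Real.exp (-(|α| * u)) ≤ Real.exp (|α| * u) := by
    apply Real.exp_le_exp.2
    have := mul_nonneg (abs_nonneg α) hu
    linarith
  linarith

lemma abs_sinh_le_cosh (x : ℝ) : |Real.sinh x| ≤ Real.cosh x := by
  rw [← Real.cosh_abs x, Real.abs_sinh]
  exact (Real.sinh_lt_cosh _).le

lemma half_exp_le_cosh (u : ℝ) : Real.exp u / 2 ≤ Real.cosh u := by
  rw [Real.cosh_eq]
  have := Real.exp_pos (-u)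
  linarith

lemma cosh_rpow_neg_le {β : ℝ} (hβ : 0 ≤ β) (u : ℝ) :
    Real.cosh u ^ (-β) ≤ 2 ^ β * Real.exp (-(β * u)) := by
  have h1 : Real.cosh u ^ (-β) ≤ (Real.exp u / 2) ^ (-β) :=
    Real.rpow_le_rpow_of_nonpos (by positivity) (half_exp_le_cosh u) (by linarith)
  refine h1.trans (le_of_eq ?_)
  rw [Real.div_rpow (Real.exp_pos _).le (by norm_num), ← Real.exp_mul, Real.rpow_neg (by norm_num),
    div_inv_eq_mul, mul_comm]
  congr 2
  ring

lemma cosh_mul_cosh_rpow_le {α β : ℝ} (hβ : 0 ≤ β) {u : ℝ} (hu : 0 ≤ u) :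
    Real.cosh (α * u) * Real.cosh u ^ (-β) ≤ 2 ^ β * Real.exp (-(β - |α|) * u) := by
  calc _ ≤ Real.exp (|α| * u) * (2 ^ β * Real.exp (-(β * u))) := by
        gcongr
        · exact cosh_mul_le_exp α hu
        · exact cosh_rpow_neg_le hβ u
    _ = 2 ^ β * (Real.exp (|α| * u) * Real.exp (-(β * u))) := by ring
    _ = _ := by rw [← Real.exp_add]; congr 2; ring

/-- `∫₀^∞ cosh (α u) / cosh (u) ^ β du`. -/
noncomputable def coshIntegral (α β : ℝ) : ℝ :=
  ∫ u in Ioi (0 : ℝ), Real.cosh (α * u) * Real.cosh u ^ (-β)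

lemma continuous_cosh_rpow (β : ℝ) : Continuous fun u : ℝ => Real.cosh u ^ β :=
  Real.continuous_cosh.rpow_const fun u => Or.inl (Real.cosh_pos u).ne'

lemma integrableOn_coshIntegral {α β : ℝ} (h : |α| < β) :
    IntegrableOn (fun u => Real.cosh (α * u) * Real.cosh u ^ (-β)) (Ioi 0) := by
  have hβ : 0 ≤ β := (abs_nonneg α).trans h.le
  have h0 : IntegrableOn (fun u : ℝ => 2 ^ β * Real.exp (-(β - |α|) * u)) (Ioi 0) :=
    (exp_neg_integrableOn_Ioi 0 (by linarith)).const_mul _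
  refine h0.mono' ?_ ?_
  · have := continuous_cosh_rpow (-β)
    have h2 : Continuous fun u : ℝ => Real.cosh (α * u) := by fun_prop
    exact (h2.mul this).aestronglyMeasurable
  · refine (ae_restrict_iff' measurableSet_Ioi).2 (Eventually.of_forall fun u hu => ?_)
    rw [Real.norm_of_nonneg (by have := Real.cosh_pos u; have := Real.cosh_pos (α * u); positivity)]
    exact cosh_mul_cosh_rpow_le hβ (le_of_lt hu)

lemma tendsto_const_mul_exp_neg_mul {c b : ℝ} (hb : 0 < b) :
    Tendsto (fun u : ℝ => c * Real.exp (-b * u)) atTop (𝓝 0) := by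
  have h : Tendsto (fun u : ℝ => -b * u) atTop atBot := tendsto_id.const_mul_atTop_of_neg (by linarith)
  simpa using (Real.tendsto_exp_atBot.comp h).const_mul c

/-- Integrate the derivative of the Wronskian of `cosh (α u)` and `cosh(u)^(-β)`: it vanishes at `0`
and at infinity. This recursion mirrors the two-step recursion of `gammaMu`. -/
lemma coshIntegral_add_two {α β : ℝ} (h : |α| < β) :
    β * (β + 1) * coshIntegral α (β + 2) = (β ^ 2 - α ^ 2) * coshIntegral α β := by
  have hβ : 0 < β := (abs_nonneg α).trans_lt h
  set g : ℝ → ℝ := fun u => α * Real.sinh (α * u) * Real.cosh u ^ (-β) +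
    β * Real.cosh (α * u) * Real.sinh u * Real.cosh u ^ (-β - 1) with hg
  have hd : ∀ u ∈ Ici (0 : ℝ), HasDerivAt g
      (β * (β + 1) * (Real.cosh (α * u) * Real.cosh u ^ (-(β + 2))) -
        (β ^ 2 - α ^ 2) * (Real.cosh (α * u) * Real.cosh u ^ (-β))) u := by
    intro u _
    have hc := Real.cosh_pos u
    have e1 : HasDerivAt (fun u : ℝ => α * u) α u := by simpa using (hasDerivAt_id u).const_mul α
    have e2 := (Real.hasDerivAt_sinh (α * u)).comp u e1
    have e3 := (Real.hasDerivAt_cosh (α * u)).comp u e1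
    have e4 := (Real.hasDerivAt_cosh u).rpow_const (p := -β) (Or.inl hc.ne')
    have e5 := (Real.hasDerivAt_cosh u).rpow_const (p := -β - 1) (Or.inl hc.ne')
    have := ((e2.const_mul α).mul e4).add (((e3.const_mul β).mul (Real.hasDerivAt_sinh u)).mul e5)
    convert! this using 1
    simp only [Function.comp, Pi.mul_apply]
    have r1 : Real.cosh u ^ (-β) = Real.cosh u ^ (-(β + 2)) * Real.cosh u ^ 2 := by
      rw [← Real.rpow_natCast, ← Real.rpow_add hc]; congr 1; push_cast; ring
    have r2 : Real.cosh u ^ (-β - 1) = Real.cosh u ^ (-(β + 2)) * Real.cosh u := by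
      nth_rewrite 3 [← Real.rpow_one (Real.cosh u)]
      rw [← Real.rpow_add hc]; congr 1; ring
    have r3 : Real.cosh u ^ (-β - 1 - 1) = Real.cosh u ^ (-(β + 2)) := by congr 1; ring
    rw [r3, r1, r2]
    have := Real.cosh_sq u
    have hs : Real.sinh u ^ 2 = Real.cosh u ^ 2 - 1 := by linarith
    linear_combination (Real.cosh (α * u) * Real.cosh u ^ (-(β + 2))) * (β * (β + 1)) * hs
  have hlim : Tendsto g atTop (𝓝 0) := by
    refine squeeze_zero_norm' ?_
      (tendsto_const_mul_exp_neg_mul (c := (|α| + β) * 2 ^ β) (b := β - |α|) (by linarith))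
    filter_upwards [eventually_ge_atTop 0] with u hu
    have hc := Real.cosh_pos u
    have hca := Real.cosh_pos (α * u)
    have k1 := abs_sinh_le_cosh (α * u)
    have k2 := abs_sinh_le_cosh u
    have r2 : Real.cosh u ^ (-β) = Real.cosh u ^ (-β - 1) * Real.cosh u := by
      nth_rewrite 3 [← Real.rpow_one (Real.cosh u)]
      rw [← Real.rpow_add hc]; congr 1; ring
    have hp : 0 < Real.cosh u ^ (-β - 1) := by positivity
    have hp' : 0 < Real.cosh u ^ (-β) := by positivity
    rw [hg, Real.norm_eq_abs]
    calc _ ≤ |α * Real.sinh (α * u) * Real.cosh u ^ (-β)| +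
          |β * Real.cosh (α * u) * Real.sinh u * Real.cosh u ^ (-β - 1)| := abs_add_le _ _
      _ ≤ |α| * Real.cosh (α * u) * Real.cosh u ^ (-β) +
          β * Real.cosh (α * u) * Real.cosh u * Real.cosh u ^ (-β - 1) := by
        rw [abs_mul, abs_mul, abs_mul, abs_mul, abs_mul, abs_of_pos hp, abs_of_pos hp',
          abs_of_pos hca, abs_of_pos hβ]
        gcongr
      _ = (|α| + β) * (Real.cosh (α * u) * Real.cosh u ^ (-β)) := by
        rw [r2]; ring
      _ ≤ (|α| + β) * (2 ^ β * Real.exp (-(β - |α|) * u)) := by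
        exact mul_le_mul_of_nonneg_left (cosh_mul_cosh_rpow_le hβ.le hu) (by positivity)
      _ = _ := by ring
  have i1 := (integrableOn_coshIntegral (α := α) (β := β + 2) (by linarith)).const_mul (β * (β + 1))
  have i2 := (integrableOn_coshIntegral h).const_mul (β ^ 2 - α ^ 2)
  have key := integral_Ioi_of_hasDerivAt_of_tendsto' hd (i1.sub i2) hlim
  rw [integral_sub i1 i2, integral_const_mul, integral_const_mul] at key
  have g0 : g 0 = 0 := by simp [hg]
  rw [g0, sub_zero] at key
  exact sub_eq_zero.1 key

lemma tendsto_sinh_mul_cosh_rpow {γ : ℝ} (hγ : 0 < γ) :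
    Tendsto (fun u : ℝ => Real.sinh (γ * u) * Real.cosh u ^ (-γ)) atTop (𝓝 (2 ^ (γ - 1))) := by
  have h1 : ∀ u : ℝ, Real.sinh (γ * u) * Real.cosh u ^ (-γ) =
      2 ^ (γ - 1) * ((1 - Real.exp (-(2 * γ) * u)) * (1 + Real.exp (-2 * u)) ^ (-γ)) := by
    intro u
    have e1 : Real.cosh u = Real.exp u * (1 + Real.exp (-2 * u)) / 2 := by
      rw [Real.cosh_eq, mul_add, ← Real.exp_add]; ring_nf
    have e2 : Real.sinh (γ * u) = Real.exp (γ * u) * (1 - Real.exp (-(2 * γ) * u)) / 2 := by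
      rw [Real.sinh_eq, mul_sub, ← Real.exp_add]; ring_nf
    have hp : 0 < 1 + Real.exp (-2 * u) := by positivity
    rw [e1, e2, Real.div_rpow (by positivity) (by norm_num), Real.mul_rpow (Real.exp_pos _).le hp.le,
      ← Real.exp_mul, Real.rpow_sub (by norm_num), Real.rpow_neg (by norm_num : (0:ℝ) ≤ 2),
      Real.rpow_one]
    have : Real.exp (u * -γ) = (Real.exp (γ * u))⁻¹ := by
      rw [← Real.exp_neg]; congr 1; ring
    rw [this]
    field_simp
  have hz1 := tendsto_const_mul_exp_neg_mul (c := 1) (b := 2 * γ) (by linarith)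
  have hz2 := tendsto_const_mul_exp_neg_mul (c := 1) (b := 2) (by norm_num)
  simp only [one_mul] at hz1 hz2
  have h2 : Tendsto (fun u : ℝ => (1 + Real.exp (-2 * u)) ^ (-γ)) atTop (𝓝 ((1 + 0) ^ (-γ))) :=
    (hz2.const_add 1).rpow_const (Or.inl (by norm_num))
  have h3 := ((hz1.const_sub 1).mul h2).const_mul ((2:ℝ) ^ (γ - 1))
  simp only [add_zero, sub_zero, Real.one_rpow, mul_one] at h3
  exact h3.congr fun u => (h1 u).symm

/-- For `β = α + 2` the integrand has the explicit primitive `sinh((α+1)u) cosh(u)^(-(α+1)) /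
(α+1)`. Both base cases of the moment recursion have this form. -/
lemma coshIntegral_self_add_two {α : ℝ} (hα : -1 < α) :
    coshIntegral α (α + 2) = 2 ^ α / (α + 1) := by
  have hp : 0 < α + 1 := by linarith
  have hd : ∀ u ∈ Ici (0 : ℝ), HasDerivAt
      (fun u => Real.sinh ((α + 1) * u) * Real.cosh u ^ (-(α + 1)))
      ((α + 1) * (Real.cosh (α * u) * Real.cosh u ^ (-(α + 2)))) u := by
    intro u _
    have hc := Real.cosh_pos u
    have e1 : HasDerivAt (fun u : ℝ => (α + 1) * u) (α + 1) u := by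
      simpa using (hasDerivAt_id u).const_mul (α + 1)
    have e2 := (Real.hasDerivAt_sinh ((α + 1) * u)).comp u e1
    have e4 := (Real.hasDerivAt_cosh u).rpow_const (p := -(α + 1)) (Or.inl hc.ne')
    convert! e2.mul e4 using 1
    have r1 : Real.cosh u ^ (-(α + 1)) = Real.cosh u ^ (-(α + 2)) * Real.cosh u := by
      nth_rewrite 3 [← Real.rpow_one (Real.cosh u)]
      rw [← Real.rpow_add hc]; congr 1; ring
    have r3 : Real.cosh u ^ (-(α + 1) - 1) = Real.cosh u ^ (-(α + 2)) := by congr 1; ring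
    have r4 : Real.cosh (α * u) = Real.cosh ((α + 1) * u) * Real.cosh u -
        Real.sinh ((α + 1) * u) * Real.sinh u := by
      rw [← Real.cosh_sub]; congr 1; ring
    simp only [Function.comp]
    rw [r3, r1, r4]
    ring
  have hab : |α| < α + 2 := by rw [abs_lt]; constructor <;> linarith
  have key := integral_Ioi_of_hasDerivAt_of_tendsto' hd
    ((integrableOn_coshIntegral hab).const_mul (α + 1)) (tendsto_sinh_mul_cosh_rpow hp)
  rw [integral_const_mul] at key
  simp only [mul_zero, Real.sinh_zero, zero_mul, sub_zero, add_sub_cancel_right] at key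
  rw [eq_div_iff hp.ne', mul_comm]
  exact key

/-! ### The Macdonald function -/

lemma integrableOn_macdonald (α : ℝ) {x : ℝ} (hx : 0 < x) :
    IntegrableOn (fun u => Real.exp (-x * Real.cosh u) * Real.cosh (α * u)) (Ioi 0) := by
  -- Any power `n > |α|` works: `exp(-x cosh u)` is dominated by a multiple of `cosh(u)^(-n)`.
  set n : ℕ := ⌈|α|⌉₊ + 1 with hn
  have hn' : |α| < n := (Nat.le_ceil _).trans_lt (by push_cast [hn]; linarith)
  have h0 := (integrableOn_coshIntegral hn').const_mul (n.factorial / x ^ n)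
  refine h0.mono' (by fun_prop) ?_
  refine (ae_restrict_iff' measurableSet_Ioi).2 (Eventually.of_forall fun u _ => ?_)
  have hc := Real.cosh_pos u
  have hca := Real.cosh_pos (α * u)
  rw [Real.norm_of_nonneg (by positivity)]
  have h1 := Real.pow_div_factorial_le_exp (x * Real.cosh u) (by positivity) n
  have h2 : Real.exp (-x * Real.cosh u) ≤ n.factorial / x ^ n * Real.cosh u ^ (-(n : ℝ)) := by
    rw [neg_mul, Real.exp_neg, Real.rpow_neg hc.le, Real.rpow_natCast]
    calc _ ≤ ((x * Real.cosh u) ^ n / n.factorial)⁻¹ := inv_anti₀ (by positivity) h1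
      _ = _ := by rw [mul_pow]; field_simp
  calc _ ≤ (n.factorial / x ^ n * Real.cosh u ^ (-(n : ℝ))) * Real.cosh (α * u) := by gcongr
    _ = _ := by ring

lemma macdonald_pos (α : ℝ) {x : ℝ} (hx : 0 < x) : 0 < macdonald α x := by
  rw [macdonald, setIntegral_pos_iff_support_of_nonneg_ae]
  · have : Function.support (fun u => Real.exp (-x * Real.cosh u) * Real.cosh (α * u)) = univ := by
      ext u
      simpa using (Real.cosh_pos (α * u)).ne'
    rw [this]
    simp
  · exact Eventually.of_forall fun u => by have := Real.cosh_pos (α * u); positivity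
  · exact integrableOn_macdonald α hx

lemma macdonald_nonneg (α x : ℝ) : 0 ≤ macdonald α x :=
  integral_nonneg fun u => by have := Real.cosh_pos (α * u); positivity

/-- Since `cosh u ≥ 1`, a factor `e^c` is absorbed by lowering `x` to `x - c`. This replaces the
asymptotics at infinity: it shows that `e^{ct}` is admissible against the density for every `c < 1`.
-/
lemma exp_mul_macdonald_le (α : ℝ) {c x : ℝ} (hx : 0 < x) (hc0 : 0 ≤ c) (hcx : c < x) :
    Real.exp c * macdonald α x ≤ macdonald α (x - c) := by
  rw [macdonald, ← integral_const_mul]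
  refine setIntegral_mono ((integrableOn_macdonald α hx).const_mul _)
    (integrableOn_macdonald α (sub_pos.2 hcx)) fun u => ?_
  have := Real.cosh_pos (α * u)
  simp only [← mul_assoc, ← Real.exp_add]
  gcongr
  have := Real.one_le_cosh u
  nlinarith

lemma macdonald_antitoneOn (α : ℝ) : AntitoneOn (macdonald α) (Ioi 0) := by
  intro x hx y hy hxy
  refine setIntegral_mono (integrableOn_macdonald α hy) (integrableOn_macdonald α hx) fun u => ?_
  have := Real.cosh_pos (α * u)
  have := Real.cosh_pos u
  have : -y * Real.cosh u ≤ -x * Real.cosh u := by nlinarith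
  simp only
  gcongr

lemma continuousOn_macdonald (α : ℝ) : ContinuousOn (macdonald α) (Ioi 0) := by
  intro x hx
  refine ContinuousAt.continuousWithinAt ?_
  have hx : 0 < x := hx
  refine continuousAt_of_dominated
    (bound := fun u => Real.exp (-(x / 2) * Real.cosh u) * Real.cosh (α * u)) ?_ ?_
    (integrableOn_macdonald α (half_pos hx)) ?_
  · exact Eventually.of_forall fun y => by fun_prop
  · filter_upwards [lt_mem_nhds (half_lt_self hx)] with y hy
    refine Eventually.of_forall fun u => ?_
    have := Real.cosh_pos (α * u)
    have := Real.cosh_pos u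
    rw [Real.norm_of_nonneg (by positivity)]
    have : -y * Real.cosh u ≤ -(x / 2) * Real.cosh u := by nlinarith
    gcongr
  · exact Eventually.of_forall fun u => by fun_prop

lemma measurable_macdonald (α : ℝ) : Measurable (macdonald α) := by
  have : StronglyMeasurable (fun y : ℝ × ℝ => Real.exp (-y.1 * Real.cosh y.2) * Real.cosh (α * y.2)) := by
    apply Continuous.stronglyMeasurable
    fun_prop
  exact (StronglyMeasurable.integral_prod_right' (ν := volume.restrict (Ioi 0)) this).measurable

/-- Fubini: for fixed `u` the `t`-integral is a Gamma integral with rate `cosh u`, and what remains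
is `coshIntegral`. -/
lemma macdonald_mellin {α β : ℝ} (h : |α| < β) :
    IntegrableOn (fun t => macdonald α t * t ^ (β - 1)) (Ioi 0) ∧
    ∫ t in Ioi (0 : ℝ), macdonald α t * t ^ (β - 1) = Real.Gamma β * coshIntegral α β := by
  have hβ : 0 < β := (abs_nonneg α).trans_lt h
  set G : ℝ → ℝ → ℝ := fun t u => Real.exp (-t * Real.cosh u) * Real.cosh (α * u) * t ^ (β - 1) with hG
  have hGu : ∀ u, ∫ t in Ioi (0:ℝ), G t u =
      Real.Gamma β * (Real.cosh (α * u) * Real.cosh u ^ (-β)) := by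
    intro u
    have hc := Real.cosh_pos u
    have := Real.integral_rpow_mul_exp_neg_mul_Ioi hβ hc
    calc _ = ∫ t in Ioi (0:ℝ), Real.cosh (α * u) * (t ^ (β - 1) * Real.exp (-(Real.cosh u * t))) := by
          congr 1; ext t; simp only [hG]
          rw [show -t * Real.cosh u = -(Real.cosh u * t) by ring]; ring
      _ = _ := by
          rw [integral_const_mul, this, one_div, Real.inv_rpow hc.le, ← Real.rpow_neg hc.le]; ring
  have hGi : ∀ u, IntegrableOn (fun t => G t u) (Ioi 0) := by
    intro u
    -- A Bochner integral with a nonzero value can only come from an integrable function.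
    by_contra hcon
    have h1 := hGu u
    rw [integral_undef hcon] at h1
    have := Real.cosh_pos u
    have := Real.cosh_pos (α * u)
    have := Real.Gamma_pos_of_pos hβ
    have : 0 < Real.Gamma β * (Real.cosh (α * u) * Real.cosh u ^ (-β)) := by positivity
    linarith
  have hmeas : AEStronglyMeasurable (Function.uncurry G)
      ((volume.restrict (Ioi 0)).prod (volume.restrict (Ioi (0:ℝ)))) := by
    apply Measurable.aestronglyMeasurable
    simp only [hG, Function.uncurry_def]
    fun_prop
  have hprod : Integrable (Function.uncurry G)
      ((volume.restrict (Ioi 0)).prod (volume.restrict (Ioi (0:ℝ)))) := by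
    rw [integrable_prod_iff' hmeas]
    refine ⟨Eventually.of_forall hGi, ?_⟩
    have h0 := (integrableOn_coshIntegral h).const_mul (Real.Gamma β)
    refine h0.congr (Eventually.of_forall fun u => ?_)
    simp only
    rw [← hGu u]
    refine setIntegral_congr_fun measurableSet_Ioi fun t ht => ?_
    have ht : 0 < t := ht
    have := Real.cosh_pos (α * u)
    simp only [Function.uncurry, hG]
    rw [Real.norm_of_nonneg (by positivity)]
  have hK : ∀ t, ∫ u in Ioi (0:ℝ), G t u = macdonald α t * t ^ (β - 1) := by
    intro t
    simp only [hG]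
    rw [integral_mul_const, macdonald]
  constructor
  · have := hprod.integral_prod_left
    simp only [Function.uncurry, hK] at this
    exact this
  · have := integral_integral_swap hprod
    simp only [hK, hGu] at this
    rw [this, integral_const_mul, coshIntegral]

/-! ### Radial integrals on the plane -/

lemma integrable_comp_norm_sq_iff {g : ℝ → ℝ} :
    Integrable (fun z : ℂ => g (‖z‖ ^ 2)) ↔ IntegrableOn g (Ioi 0) := by
  have h1 := integrable_fun_norm_addHaar (volume : Measure ℂ) (f := fun y => g (y ^ 2))
  rw [h1, Complex.finrank_real_complex,
    ← integrableOn_Ioi_comp_rpow_iff g (p := 2) (by norm_num)]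
  have : IntegrableOn (fun y : ℝ => (|2| * y ^ ((2 : ℝ) - 1)) • g (y ^ (2 : ℝ))) (Ioi 0) ↔
      IntegrableOn (fun y : ℝ => (2 : ℝ) * (y ^ (2 - 1) • g (y ^ 2))) (Ioi 0) := by
    refine integrableOn_congr_fun (fun y hy => ?_) measurableSet_Ioi
    simp only [smul_eq_mul]
    norm_num
    ring
  rw [this]
  simp only [IntegrableOn]
  rw [integrable_const_mul_iff (by norm_num)]

lemma integral_comp_norm_sq (g : ℝ → ℝ) :
    ∫ z : ℂ, g (‖z‖ ^ 2) = Real.pi * ∫ t in Ioi (0 : ℝ), g t := by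
  have h1 := integral_fun_norm_addHaar (volume : Measure ℂ) (fun y => g (y ^ 2))
  rw [h1, Complex.finrank_real_complex,
    ← integral_comp_rpow_Ioi_of_pos (g := g) (p := 2) (by norm_num)]
  have : ∫ y in Ioi (0 : ℝ), ((2 : ℝ) * y ^ ((2 : ℝ) - 1)) • g (y ^ (2 : ℝ)) =
      ∫ y in Ioi (0 : ℝ), (2 : ℝ) * (y ^ (2 - 1) • g (y ^ 2)) := by
    refine setIntegral_congr_fun measurableSet_Ioi (fun y hy => ?_)
    simp only [smul_eq_mul]
    norm_num
    ring
  rw [this, integral_const_mul]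
  simp [Measure.real, Complex.volume_ball]
  ring

/-! ### The measures -/

lemma Parity.sign_sq (s : Parity) : s.sign * s.sign = 1 := by
  cases s <;> simp [Parity.sign]

lemma abs_order_lt (s : Parity) {μ : ℝ} (hμ : -(1 / 2) < μ) :
    |μ - s.sign * (1 / 2)| < μ + 3 / 2 := by
  cases s <;> simp only [Parity.sign] <;> rw [abs_lt] <;> constructor <;> linarith

/-- The normalization constant of the densities. -/
noncomputable def densityConst (μ : ℝ) : ℝ := (2 : ℝ) ^ (1 / 2 - μ) / (Real.pi * Real.Gamma (μ + 1 / 2))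

lemma densityConst_pos {μ : ℝ} (hμ : -(1 / 2) < μ) : 0 < densityConst μ := by
  have := Real.Gamma_pos_of_pos (show 0 < μ + 1 / 2 by linarith)
  have := Real.pi_pos
  rw [densityConst]
  positivity

lemma density_eq (s : Parity) (μ : ℝ) (z : ℂ) :
    density s μ z = densityConst μ *
      (macdonald (μ - s.sign * (1 / 2)) (‖z‖ ^ 2) * (‖z‖ ^ 2) ^ (μ + 3 / 2 - 1)) := by
  rw [density, densityConst, mul_assoc]
  congr 2
  rw [← Real.rpow_natCast, ← Real.rpow_mul (norm_nonneg z)]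
  congr 1
  push_cast
  ring

lemma density_nonneg (s : Parity) {μ : ℝ} (hμ : -(1 / 2) < μ) (z : ℂ) : 0 ≤ density s μ z := by
  have := densityConst_pos hμ
  have := macdonald_nonneg (μ - s.sign * (1 / 2)) (‖z‖ ^ 2)
  rw [density_eq]
  positivity

lemma density_pos (s : Parity) {μ : ℝ} (hμ : -(1 / 2) < μ) {z : ℂ} (hz : z ≠ 0) :
    0 < density s μ z := by
  have hz : 0 < ‖z‖ := norm_pos_iff.2 hz
  have := densityConst_pos hμ
  have := macdonald_pos (μ - s.sign * (1 / 2)) (pow_pos hz 2)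
  rw [density_eq]
  positivity

lemma measurable_density (s : Parity) (μ : ℝ) : Measurable (density s μ) := by
  have := measurable_macdonald (μ - s.sign * (1 / 2))
  unfold density
  fun_prop

lemma integrable_nu_iff {E : Type*} [NormedAddCommGroup E] [NormedSpace ℝ E] (s : Parity) {μ : ℝ}
    (hμ : -(1 / 2) < μ) {f : ℂ → E} :
    Integrable f (nu s μ) ↔ Integrable (fun z => density s μ z • f z) := by
  rw [nu, integrable_withDensity_iff_integrable_smul' (measurable_density s μ).ennreal_ofReal
    (Eventually.of_forall fun _ => ENNReal.ofReal_lt_top)]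
  simp only [ENNReal.toReal_ofReal (density_nonneg s hμ _)]

lemma integral_nu {E : Type*} [NormedAddCommGroup E] [NormedSpace ℝ E] (s : Parity) {μ : ℝ}
    (hμ : -(1 / 2) < μ) (f : ℂ → E) :
    ∫ z, f z ∂(nu s μ) = ∫ z, density s μ z • f z := by
  rw [nu, integral_withDensity_eq_integral_toReal_smul (measurable_density s μ).ennreal_ofReal
    (Eventually.of_forall fun _ => ENNReal.ofReal_lt_top)]
  simp only [ENNReal.toReal_ofReal (density_nonneg s hμ _)]

lemma integrableOn_exp_mul_macdonald {α β c : ℝ} (h : |α| < β) (hc : c < 1) :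
    IntegrableOn (fun t => Real.exp (c * t) * (macdonald α t * t ^ (β - 1))) (Ioi 0) := by
  wlog hc0 : 0 ≤ c with H
  · refine (H h zero_lt_one le_rfl).mono' ?_ ?_
    · have := measurable_macdonald α
      fun_prop
    · refine (ae_restrict_iff' measurableSet_Ioi).2 (Eventually.of_forall fun t ht => ?_)
      have ht : 0 < t := ht
      have := macdonald_nonneg α t
      rw [Real.norm_of_nonneg (by positivity)]
      have : c * t ≤ 0 * t := by nlinarith
      gcongr
  have h1 : IntegrableOn (fun t => macdonald α ((1 - c) * t) * ((1 - c) * t) ^ (β - 1)) (Ioi 0) := by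
    have := (integrableOn_Ioi_comp_mul_left_iff (fun t => macdonald α t * t ^ (β - 1)) 0
      (sub_pos.2 hc)).2 (by simpa using (macdonald_mellin h).1)
    simpa using this
  refine (h1.const_mul ((1 - c) ^ (-(β - 1)))).mono' ?_ ?_
  · have := measurable_macdonald α
    fun_prop
  · refine (ae_restrict_iff' measurableSet_Ioi).2 (Eventually.of_forall fun t ht => ?_)
    have ht : 0 < t := ht
    have hc' : 0 < 1 - c := sub_pos.2 hc
    have := macdonald_nonneg α t
    rw [Real.norm_of_nonneg (by positivity), Real.mul_rpow hc'.le ht.le, Real.rpow_neg hc'.le]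
    have h2 := exp_mul_macdonald_le α (c := c * t) ht (by positivity) (by nlinarith)
    have h3 : t - c * t = (1 - c) * t := by ring
    rw [h3] at h2
    have h4 : 0 < (1 - c) ^ (β - 1) := by positivity
    calc _ = (Real.exp (c * t) * macdonald α t) * t ^ (β - 1) := by ring
      _ ≤ macdonald α ((1 - c) * t) * t ^ (β - 1) := by gcongr
      _ = _ := by field_simp

lemma integrable_exp_nu (s : Parity) {μ c : ℝ} (hμ : -(1 / 2) < μ) (hc : c < 1) :
    Integrable (fun z : ℂ => Real.exp (c * ‖z‖ ^ 2)) (nu s μ) := by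
  rw [integrable_nu_iff s hμ]
  have h := (integrableOn_exp_mul_macdonald (abs_order_lt s hμ) hc).const_mul (densityConst μ)
  have h2 := integrable_comp_norm_sq_iff.2 h
  refine h2.congr (Eventually.of_forall fun z => ?_)
  simp only [smul_eq_mul, density_eq]
  ring

instance isFiniteMeasure_nu (s : Parity) (μ : ℝ) [hμ : Fact (-(1 / 2) < μ)] :
    IsFiniteMeasure (nu s μ) := by
  have := integrable_exp_nu s hμ.out (zero_lt_one)
  simp only [zero_mul, Real.exp_zero] at this
  rwa [integrable_const_iff_isFiniteMeasure one_ne_zero] at this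

lemma integral_norm_pow_nu (s : Parity) {μ : ℝ} (hμ : -(1 / 2) < μ) (k : ℕ) :
    ∫ z : ℂ, ‖z‖ ^ (2 * k) ∂(nu s μ) = densityConst μ * Real.pi * (Real.Gamma (μ + 3 / 2 + k) *
      coshIntegral (μ - s.sign * (1 / 2)) (μ + 3 / 2 + k)) := by
  have hα := abs_order_lt s hμ
  have hk : (0 : ℝ) ≤ k := k.cast_nonneg
  rw [← (macdonald_mellin (α := μ - s.sign * (1 / 2)) (β := μ + 3 / 2 + k) (by linarith)).2,
    integral_nu s hμ, mul_assoc, ← integral_comp_norm_sq, ← integral_const_mul]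
  refine integral_congr_ae ?_
  have : ∀ᵐ z : ℂ, z ≠ 0 := by simp [ae_iff]
  filter_upwards [this] with z hz
  have hz : 0 < ‖z‖ := norm_pos_iff.2 hz
  rw [density_eq, smul_eq_mul, pow_mul, show μ + 3 / 2 + k - 1 = μ + 3 / 2 - 1 + k by ring,
    Real.rpow_add (by positivity), Real.rpow_natCast]
  ring

lemma gammaMu_pos {μ : ℝ} (hμ : -(1 / 2) < μ) (k : ℕ) : 0 < gammaMu μ k := by
  induction k with
  | zero => simp [gammaMu]
  | succ k ih =>
    rw [gammaMu]
    refine mul_pos ?_ ih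
    have : (0 : ℝ) ≤ k := k.cast_nonneg
    split_ifs <;> push_cast <;> linarith

/-- With `β = μ + 3/2 + k` and order `α = μ ∓ 1/2`, the recursion for `coshIntegral` multiplies the
moment by `(β - α)(β + α)` when `k` grows by two. This product is `(k+2)(k+1+2μ)` in the even and
`(k+1)(k+2+2μ)` in the odd case, the two-step factor of `gammaMu`. The base cases `k = 0` and `k =
1` both have `β = α + 2`. -/
lemma integral_norm_pow_nu_eq_gammaMu (s : Parity) {μ : ℝ} (hμ : -(1 / 2) < μ) (k : ℕ)
    (hk : (-1) ^ k = s.sign) : ∫ z : ℂ, ‖z‖ ^ (2 * k) ∂(nu s μ) = gammaMu μ k := by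
  have hstep : ∀ k : ℕ, (-1) ^ k = s.sign →
      ∫ z : ℂ, ‖z‖ ^ (2 * k) ∂(nu s μ) = gammaMu μ k →
      ∫ z : ℂ, ‖z‖ ^ (2 * (k + 2)) ∂(nu s μ) = gammaMu μ (k + 2) := by
    intro k hk h
    have hk0 : (0 : ℝ) ≤ k := k.cast_nonneg
    have hα := abs_order_lt s hμ
    rw [integral_norm_pow_nu s hμ] at h ⊢
    have hJ := coshIntegral_add_two (α := μ - s.sign * (1 / 2)) (β := μ + 3 / 2 + k) (by linarith)
    have e : μ + 3 / 2 + ((k + 2 : ℕ) : ℝ) = μ + 3 / 2 + k + 2 := by push_cast; ring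
    have hG : Real.Gamma (μ + 3 / 2 + k + 2) =
        (μ + 3 / 2 + k) * (μ + 3 / 2 + k + 1) * Real.Gamma (μ + 3 / 2 + k) := by
      rw [show μ + 3 / 2 + k + 2 = μ + 3 / 2 + k + 1 + 1 by ring, Real.Gamma_add_one (by linarith),
        Real.Gamma_add_one (by linarith)]
      ring
    have hg : gammaMu μ (k + 2) =
        ((μ + 3 / 2 + k) ^ 2 - (μ - s.sign * (1 / 2)) ^ 2) * gammaMu μ k := by
      rw [gammaMu, gammaMu]
      cases s
      · have : Even k := by
          by_contra hodd
          rw [Nat.not_even_iff_odd] at hodd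
          rw [hodd.neg_one_pow, Parity.sign] at hk
          norm_num at hk
        have o1 : Odd (k + 1) := this.add_one
        have o2 : ¬ Odd (k + 1 + 1) := by simpa using o1.add_one
        rw [if_pos o1, if_neg o2, Parity.sign]
        push_cast
        ring
      · have : Odd k := by
          by_contra hev
          rw [Nat.not_odd_iff_even] at hev
          rw [hev.neg_one_pow, Parity.sign] at hk
          norm_num at hk
        have o1 : ¬ Odd (k + 1) := by simpa using this.add_one
        have o2 : Odd (k + 1 + 1) := (this.add_one).add_one
        rw [if_pos o2, if_neg o1, Parity.sign]
        push_cast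
        ring
    rw [hg, ← h, e, hG]
    linear_combination (densityConst μ * Real.pi * Real.Gamma (μ + 3 / 2 + k)) * hJ
  have hpi := Real.pi_pos
  have hGp := Real.Gamma_pos_of_pos (show 0 < μ + 1 / 2 by linarith)
  have h2 : (0 : ℝ) < 2 := by norm_num
  cases s with
  | even =>
    have h0 : ∀ j : ℕ, ∫ z : ℂ, ‖z‖ ^ (2 * (2 * j)) ∂(nu .even μ) = gammaMu μ (2 * j) := by
      intro j
      induction j with
      | zero =>
        rw [integral_norm_pow_nu _ hμ]
        have := coshIntegral_self_add_two (α := μ - 1 / 2) (by linarith)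
        rw [show μ - Parity.even.sign * (1 / 2) = μ - 1 / 2 by simp [Parity.sign],
          show μ + 3 / 2 + ((2 * 0 : ℕ) : ℝ) = μ - 1 / 2 + 2 by push_cast; ring, this,
          show μ - 1 / 2 + 2 = μ + 1 / 2 + 1 by ring, Real.Gamma_add_one (by linarith),
          show μ - 1 / 2 + 1 = μ + 1 / 2 by ring, densityConst,
          show (1 / 2 - μ) = -(μ - 1 / 2) by ring, Real.rpow_neg h2.le]
        have : μ * 2 + 1 ≠ 0 := by linarith
        generalize Real.Gamma (μ + 1 / 2) = G at hGp
        simp only [gammaMu]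
        have : μ + 1 / 2 ≠ 0 := by linarith
        field_simp
      | succ j ih =>
        exact hstep (2 * j) (by simp [Parity.sign]) ih
    have : Even k := by
      by_contra hodd
      rw [Nat.not_even_iff_odd] at hodd
      rw [hodd.neg_one_pow, Parity.sign] at hk
      norm_num at hk
    obtain ⟨j, rfl⟩ := this.two_dvd
    exact h0 j
  | odd =>
    have h0 : ∀ j : ℕ, ∫ z : ℂ, ‖z‖ ^ (2 * (2 * j + 1)) ∂(nu .odd μ) = gammaMu μ (2 * j + 1) := by
      intro j
      induction j with
      | zero =>
        rw [integral_norm_pow_nu _ hμ]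
        have := coshIntegral_self_add_two (α := μ + 1 / 2) (by linarith)
        rw [show μ - Parity.odd.sign * (1 / 2) = μ + 1 / 2 by simp [Parity.sign],
          show μ + 3 / 2 + ((2 * 0 + 1 : ℕ) : ℝ) = μ + 1 / 2 + 2 by push_cast; ring, this,
          show μ + 1 / 2 + 2 = μ + 1 / 2 + 1 + 1 by ring, Real.Gamma_add_one (by linarith),
          Real.Gamma_add_one (by linarith), densityConst,
          show (1 / 2 - μ) = -(μ + 1 / 2) + 1 by ring, Real.rpow_add h2, Real.rpow_neg h2.le,
          Real.rpow_one]
        have : μ * 2 + 1 + 2 ≠ 0 := by linarith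
        have : μ + 1 / 2 + 1 ≠ 0 := by linarith
        generalize Real.Gamma (μ + 1 / 2) = G at hGp
        simp only [gammaMu]
        norm_num
        field_simp
        ring
      | succ j ih =>
        exact hstep (2 * j + 1) (by simp [Parity.sign, pow_succ]) ih
    have : Odd k := by
      by_contra hev
      rw [Nat.not_odd_iff_even] at hev
      rw [hev.neg_one_pow, Parity.sign] at hk
      norm_num at hk
    obtain ⟨j, rfl⟩ := this
    exact h0 j

/-! ### Total masses -/

/-- Concavity of `t ↦ t^x`, applied to the mean of `e^v` and `e^{-v}`. -/
lemma cosh_mul_le_cosh_rpow {x : ℝ} (hx0 : 0 ≤ x) (hx1 : x ≤ 1) (v : ℝ) :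
    Real.cosh (x * v) ≤ Real.cosh v ^ x := by
  have h := (Real.concaveOn_rpow hx0 hx1).2 (Real.exp_pos v).le (Real.exp_pos (-v)).le
    (show (0 : ℝ) ≤ 1 / 2 by norm_num) (show (0 : ℝ) ≤ 1 / 2 by norm_num) (by norm_num)
  simp only [smul_eq_mul, ← Real.exp_mul] at h
  rw [Real.cosh_eq, Real.cosh_eq]
  calc _ = 1 / 2 * Real.exp (v * x) + 1 / 2 * Real.exp (-v * x) := by ring_nf
    _ ≤ _ := h
    _ = _ := by congr 1; ring

lemma coshIntegral_zero_one_le : coshIntegral 0 1 ≤ 2 := by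
  have h1 : coshIntegral 0 1 ≤ ∫ u in Ioi (0 : ℝ), 2 * Real.exp (-1 * u) := by
    refine setIntegral_mono_on (integrableOn_coshIntegral (by simp))
      ((exp_neg_integrableOn_Ioi 0 one_pos).const_mul 2) measurableSet_Ioi fun u hu => ?_
    have := cosh_mul_cosh_rpow_le (α := 0) zero_le_one (le_of_lt hu)
    simpa using this
  rw [integral_const_mul] at h1
  simpa [integral_exp_Iic] using h1

/-- Interpolates linearly between `α = 1/2`, where the integral is `√2`, and `α = 0`, where it is at
most `2`. Pointwise, with `X = cosh(u/2) cosh(u)^(-1/2)`, the integrand is at most `X^{2α} / cosh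
u`, and Bernoulli's inequality makes `X^{2α}` at most affine in `X`. -/
lemma coshIntegral_self_add_one_le {α : ℝ} (h0 : 0 < α) (h1 : α ≤ 1 / 2) :
    coshIntegral α (α + 1) ≤ 2 * α * √2 + (1 - 2 * α) * 2 := by
  have e : coshIntegral (1 / 2) (3 / 2) = √2 := by
    have h := coshIntegral_self_add_two (α := -(1 / 2)) (by norm_num)
    have h' : coshIntegral (1 / 2) (3 / 2) = coshIntegral (-(1 / 2)) (-(1 / 2) + 2) := by
      unfold coshIntegral
      congr 1
      ext u
      rw [neg_mul, Real.cosh_neg]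
      norm_num
    rw [h', h, Real.rpow_neg (by norm_num), ← Real.sqrt_eq_rpow]
    norm_num
    field_simp
    norm_num
  have i1 : IntegrableOn (fun u => Real.cosh (1 / 2 * u) * Real.cosh u ^ (-(3 / 2) : ℝ)) (Ioi 0) :=
    integrableOn_coshIntegral (by rw [abs_of_pos] <;> norm_num)
  have i2 : IntegrableOn (fun u => Real.cosh (0 * u) * Real.cosh u ^ (-1 : ℝ)) (Ioi 0) :=
    integrableOn_coshIntegral (by simp)
  have key : coshIntegral α (α + 1) ≤ 2 * α * coshIntegral (1 / 2) (3 / 2) +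
      (1 - 2 * α) * coshIntegral 0 1 := by
    simp only [coshIntegral]
    rw [← integral_const_mul, ← integral_const_mul,
      ← integral_add (i1.const_mul _) (i2.const_mul _)]
    refine setIntegral_mono_on (integrableOn_coshIntegral ?_)
      ((i1.const_mul _).add (i2.const_mul _)) measurableSet_Ioi fun u _ => ?_
    · rw [abs_of_pos h0]; linarith
    have hc := Real.cosh_pos u
    have hc2 := Real.cosh_pos (1 / 2 * u)
    have s1 : Real.cosh (α * u) ≤ Real.cosh (1 / 2 * u) ^ (2 * α) := by
      have := cosh_mul_le_cosh_rpow (x := 2 * α) (by linarith) (by linarith) (1 / 2 * u)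
      rwa [show 2 * α * (1 / 2 * u) = α * u by ring] at this
    have s2 : (Real.cosh (1 / 2 * u) * Real.cosh u ^ (-(1 / 2) : ℝ)) ^ (2 * α) ≤
        2 * α * (Real.cosh (1 / 2 * u) * Real.cosh u ^ (-(1 / 2) : ℝ)) + (1 - 2 * α) := by
      have := rpow_one_add_le_one_add_mul_self
        (s := Real.cosh (1 / 2 * u) * Real.cosh u ^ (-(1 / 2) : ℝ) - 1) (p := 2 * α)
        (by have : 0 < Real.cosh (1 / 2 * u) * Real.cosh u ^ (-(1 / 2) : ℝ) := by positivity
            linarith) (by linarith) (by linarith)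
      rw [add_sub_cancel] at this
      linarith
    have s3 : Real.cosh u ^ (-(3 / 2) : ℝ) = Real.cosh u ^ (-(1 / 2) : ℝ) * Real.cosh u ^ (-1 : ℝ) := by
      rw [← Real.rpow_add hc]; norm_num
    have s4 : Real.cosh u ^ (-(α + 1)) =
        (Real.cosh u ^ (-(1 / 2) : ℝ)) ^ (2 * α) * Real.cosh u ^ (-1 : ℝ) := by
      rw [← Real.rpow_mul hc.le, ← Real.rpow_add hc]; congr 1; ring
    simp only [zero_mul, Real.cosh_zero, one_mul]
    rw [s3, s4]
    calc _ ≤ Real.cosh (1 / 2 * u) ^ (2 * α) *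
          ((Real.cosh u ^ (-(1 / 2) : ℝ)) ^ (2 * α) * Real.cosh u ^ (-1 : ℝ)) := by gcongr
      _ = (Real.cosh (1 / 2 * u) * Real.cosh u ^ (-(1 / 2) : ℝ)) ^ (2 * α) *
          Real.cosh u ^ (-1 : ℝ) := by
        rw [Real.mul_rpow hc2.le (by positivity)]; ring
      _ ≤ (2 * α * (Real.cosh (1 / 2 * u) * Real.cosh u ^ (-(1 / 2) : ℝ)) + (1 - 2 * α)) *
          Real.cosh u ^ (-1 : ℝ) := by gcongr
      _ = _ := by ring
  rw [e] at key
  have := coshIntegral_zero_one_le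
  have : (1 - 2 * α) * coshIntegral 0 1 ≤ (1 - 2 * α) * 2 := by
    apply mul_le_mul_of_nonneg_left this; linarith
  linarith

lemma nu_even_univ {μ : ℝ} (hμ : -(1 / 2) < μ) : (nu .even μ).real univ = 1 := by
  have := integral_norm_pow_nu_eq_gammaMu .even hμ 0 (by simp [Parity.sign])
  simpa [gammaMu] using this

/-- Put `μ = -y/2`, `0 ≤ y < 1`. The mass is `2^{y/2} · (√2/2)(1-y) J`; the bound on `J` makes the
second factor at most `(1-y)(1+(√2-1)y) ≤ 1 - 0.35 y`. As `(log 2)/2 < 0.35`, this is at most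
`2^{-y/2}`. -/
lemma nu_odd_univ_le {μ : ℝ} (hμ : -(1 / 2) < μ) (h0 : μ ≤ 0) : (nu .odd μ).real univ ≤ 1 := by
  have h := integral_norm_pow_nu .odd hμ 0
  have hG := Real.Gamma_pos_of_pos (show 0 < μ + 1 / 2 by linarith)
  have hJ := coshIntegral_self_add_one_le (α := μ + 1 / 2) (by linarith) (by linarith)
  obtain ⟨y, rfl⟩ : ∃ y, μ = -(y / 2) := ⟨-(2 * μ), by ring⟩
  have hpi := Real.pi_pos
  simp only [mul_zero, pow_zero, integral_const, smul_eq_mul, mul_one, Nat.cast_zero, add_zero] at h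
  rw [h, show -(y / 2) - Parity.odd.sign * (1 / 2) = -(y / 2) + 1 / 2 by simp [Parity.sign],
    show -(y / 2) + 3 / 2 = -(y / 2) + 1 / 2 + 1 by ring, Real.Gamma_add_one (by linarith),
    densityConst]
  set J := coshIntegral (-(y / 2) + 1 / 2) (-(y / 2) + 1 / 2 + 1)
  generalize Real.Gamma (-(y / 2) + 1 / 2) = G at hG
  have e1 : (2 : ℝ) ^ (1 / 2 - -(y / 2)) = √2 * 2 ^ (y / 2) := by
    rw [Real.sqrt_eq_rpow, ← Real.rpow_add (by norm_num)]; congr 1; ring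
  have e2 : (2 : ℝ) ^ (y / 2) * 2 ^ (-(y / 2)) = 1 := by
    rw [← Real.rpow_add (by norm_num)]; simp
  have e3 : 1 - 0.35 * y ≤ (2 : ℝ) ^ (-(y / 2)) := by
    rw [Real.rpow_def_of_pos (by norm_num)]
    have := Real.add_one_le_exp (Real.log 2 * -(y / 2))
    have := Real.log_two_lt_d9
    nlinarith
  have hs2 : √2 ^ 2 = 2 := Real.sq_sqrt (by norm_num)
  have hs : 1.414 ≤ √2 := Real.le_sqrt_of_sq_le (by norm_num)
  have hs' : √2 ≤ 1.415 := Real.sqrt_le_iff.2 ⟨by norm_num, by norm_num⟩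
  have hy0 : 0 ≤ y := by linarith
  have hy1 : y < 1 := by linarith
  have hcalc : √2 * 2 ^ (y / 2) / (Real.pi * G) * Real.pi * ((-(y / 2) + 1 / 2) * G * J) =
      2 ^ (y / 2) * (√2 / 2 * (1 - y) * J) := by
    field_simp
    ring
  rw [e1, hcalc]
  have hP : (0 : ℝ) < 2 ^ (y / 2) := by positivity
  have hJ2 : √2 / 2 * (1 - y) * J ≤ 1 - 0.35 * y := by
    have : √2 / 2 * (1 - y) * J ≤ √2 / 2 * (1 - y) *
        (2 * (-(y / 2) + 1 / 2) * √2 + (1 - 2 * (-(y / 2) + 1 / 2)) * 2) := by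
      apply mul_le_mul_of_nonneg_left hJ
      have : 0 < 1 - y := by linarith
      positivity
    nlinarith [mul_nonneg hy0 hy0]
  calc _ ≤ 2 ^ (y / 2) * (2 : ℝ) ^ (-(y / 2)) := by gcongr; linarith
    _ = 1 := e2

/-! ### Rotation invariance -/

lemma density_congr (s : Parity) (μ : ℝ) {z w : ℂ} (h : ‖z‖ = ‖w‖) :
    density s μ z = density s μ w := by
  rw [density, density, h]

lemma measurePreserving_mul_circle (s : Parity) (μ : ℝ) (u : Circle) :
    MeasurePreserving (fun z : ℂ => (u : ℂ) * z) (nu s μ) (nu s μ) := by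
  have h0 : MeasurePreserving (rotation u) volume volume := (rotation u).measurePreserving
  have hm : Measurable (fun z : ℂ => (u : ℂ) * z) := by fun_prop
  refine ⟨hm, ?_⟩
  ext A hA
  rw [Measure.map_apply hm hA, nu, withDensity_apply _ hA, withDensity_apply _ (hm hA),
    ← lintegral_indicator hA, ← lintegral_indicator (hm hA),
    ← h0.lintegral_comp ((measurable_density s μ).ennreal_ofReal.indicator hA)]
  refine lintegral_congr fun z => ?_
  by_cases h : (u : ℂ) * z ∈ A
  · rw [indicator_of_mem (show z ∈ (fun z : ℂ => (u : ℂ) * z) ⁻¹' A from h), rotation_apply,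
      indicator_of_mem h, density_congr s μ (z := (u : ℂ) * z) (w := z) (by simp [Circle.norm_coe])]
  · rw [indicator_of_notMem (show z ∉ (fun z : ℂ => (u : ℂ) * z) ⁻¹' A from h), rotation_apply,
      indicator_of_notMem h]

lemma integral_nu_mul_circle (s : Parity) (μ : ℝ) (u : Circle) (f : ℂ → ℂ) :
    ∫ z, f (u * z) ∂(nu s μ) = ∫ z, f z ∂(nu s μ) := by
  have hu : (u : ℂ) ≠ 0 := u.coe_ne_zero
  have he : MeasurableEmbedding (fun z : ℂ => (u : ℂ) * z) := measurableEmbedding_mulLeft₀ hu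
  exact (measurePreserving_mul_circle s μ u).integral_comp he f

/-- Rotation by one radian multiplies the integral by `e^{i(k-j)}`. This factor is not `1`, since a
nonzero integer is not a multiple of `2π`. -/
lemma integral_monomial_nu_of_ne (s : Parity) (μ : ℝ) {j k : ℕ} (h : j ≠ k) :
    ∫ z : ℂ, star z ^ j * z ^ k ∂(nu s μ) = 0 := by
  set u : Circle := Circle.exp 1 with hu
  have h1 := integral_nu_mul_circle s μ u (fun z : ℂ => star z ^ j * z ^ k)
  have h2 : ∀ z : ℂ, star ((u : ℂ) * z) ^ j * ((u : ℂ) * z) ^ k =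
      (((u : ℂ) ^ k) * (star (u : ℂ)) ^ j) * (star z ^ j * z ^ k) := by
    intro z
    rw [star_mul]
    ring
  simp only [h2] at h1
  rw [integral_const_mul] at h1
  by_contra hne
  have h3 : (u : ℂ) ^ k * (star (u : ℂ)) ^ j = 1 := by
    field_simp at h1
    exact h1
  have h4 : star (u : ℂ) * u = 1 := by
    have := Complex.conj_mul' (u : ℂ)
    simpa [Circle.norm_coe] using this
  have h5 : (u : ℂ) ^ k = (u : ℂ) ^ j := by
    calc (u : ℂ) ^ k = (u : ℂ) ^ k * (star (u : ℂ) * u) ^ j := by rw [h4]; simp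
      _ = ((u : ℂ) ^ k * (star (u : ℂ)) ^ j) * (u : ℂ) ^ j := by rw [mul_pow]; ring
      _ = _ := by rw [h3, one_mul]
  simp only [hu, Circle.coe_exp, ← Complex.exp_nat_mul] at h5
  rw [Complex.exp_eq_exp_iff_exists_int] at h5
  obtain ⟨n, hn⟩ := h5
  have h6 := congrArg Complex.im hn
  simp at h6
  have h7 : n ≠ 0 := by
    rintro rfl
    simp at h6
    exact h h6.symm
  have h8 : Irrational (((k : ℤ) - j : ℤ) : ℝ) := by
    have : (((k : ℤ) - j : ℤ) : ℝ) = ((2 * n : ℤ) : ℝ) * Real.pi := by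
      push_cast; linarith
    rw [this]
    exact irrational_pi.intCast_mul (by omega)
  exact h8.ne_int _ rfl

/-! ### The kernel -/

/-- Successive quotients of `k!/γ_μ(k)` are at most `(k+1)/k`, because `2μ > -1`. They are below `l`
from `K` on, and the sum of the initial terms serves as constant. -/
lemma exists_inv_gammaMu_le {μ : ℝ} (hμ : -(1 / 2) < μ) {l : ℝ} (hl : 1 < l) :
    ∃ C, 0 < C ∧ ∀ k, (gammaMu μ k)⁻¹ ≤ C * (l ^ k / k.factorial) := by
  set r : ℕ → ℝ := fun k => k.factorial * (gammaMu μ k)⁻¹ with hr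
  have hrpos : ∀ k, 0 < r k := fun k => by
    have := gammaMu_pos hμ k
    have := k.factorial_pos
    simp only [hr]
    positivity
  set K : ℕ := ⌈l / (l - 1)⌉₊ with hK
  have hstep : ∀ k, K ≤ k → r (k + 1) ≤ l * r k := by
    intro k hk
    have h1 : l / (l - 1) ≤ k := (Nat.le_ceil _).trans (by exact_mod_cast hk)
    rw [div_le_iff₀ (by linarith)] at h1
    have hg := gammaMu_pos hμ k
    have hk0 : (0 : ℝ) ≤ k := k.cast_nonneg
    simp only [hr, gammaMu, Nat.factorial_succ]
    set d : ℝ := ((k + 1 : ℕ) : ℝ) + 2 * μ * (if Odd (k + 1) then 1 else 0) with hd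
    have hd1 : (k : ℝ) ≤ d := by
      rw [hd]; split_ifs <;> push_cast <;> linarith
    have hd2 : ((k + 1 : ℕ) : ℝ) ≤ l * d := by
      push_cast
      nlinarith
    have hd0 : 0 < d := by
      rw [hd]; split_ifs <;> push_cast <;> linarith
    rw [mul_inv]
    have hf : (0 : ℝ) < k.factorial := by exact_mod_cast k.factorial_pos
    push_cast at hd2 ⊢
    have : ((k : ℝ) + 1) * d⁻¹ ≤ l := by rwa [← div_eq_mul_inv, div_le_iff₀ hd0]
    calc _ = (((k : ℝ) + 1) * d⁻¹) * (k.factorial * (gammaMu μ k)⁻¹) := by ring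
      _ ≤ _ := by gcongr
  refine ⟨∑ i ∈ Finset.range (K + 1), r i, Finset.sum_pos (fun i _ => hrpos i) (by simp), ?_⟩
  set C := ∑ i ∈ Finset.range (K + 1), r i with hC
  have hCpos : 0 < C := Finset.sum_pos (fun i _ => hrpos i) (by simp)
  have hall : ∀ k, r k ≤ C * l ^ k := by
    intro k
    induction k with
    | zero =>
      rw [pow_zero, mul_one]
      exact Finset.single_le_sum (f := r) (fun i _ => (hrpos i).le) (by simp)
    | succ k ih =>
      by_cases hk : K ≤ k
      · calc _ ≤ l * r k := hstep k hk
          _ ≤ l * (C * l ^ k) := by gcongr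
          _ = _ := by ring
      · have h1 : r (k + 1) ≤ C :=
          Finset.single_le_sum (f := r) (fun i _ => (hrpos i).le) (by simp; omega)
        have h2 : 1 ≤ l ^ (k + 1) := one_le_pow₀ hl.le
        nlinarith
  intro k
  have hf : (0 : ℝ) < k.factorial := by exact_mod_cast k.factorial_pos
  have := hall k
  simp only [hr] at this
  rw [← mul_div_assoc, le_div_iff₀ hf]
  linarith

lemma summable_pow_div_gammaMu {μ : ℝ} (hμ : -(1 / 2) < μ) {x : ℝ} (hx : 0 ≤ x) :
    Summable fun k => x ^ k * (gammaMu μ k)⁻¹ := by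
  obtain ⟨C, hC, h⟩ := exists_inv_gammaMu_le hμ one_lt_two
  have h0 := ((Real.summable_pow_div_factorial (x * 2)).mul_left C)
  refine Summable.of_nonneg_of_le (fun k => ?_) (fun k => ?_) h0
  · have := gammaMu_pos hμ k; positivity
  · calc _ ≤ x ^ k * (C * (2 ^ k / k.factorial)) := by gcongr; exact h k
      _ = _ := by rw [mul_pow]; ring

/-- The coefficients of the kernel as a power series in `z^* w`. -/
noncomputable def kernelCoeff (s : Parity) (μ : ℝ) (k : ℕ) : ℝ :=
  if (-1) ^ k = s.sign then (gammaMu μ k)⁻¹ else 0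

lemma kernelCoeff_nonneg (s : Parity) {μ : ℝ} (hμ : -(1 / 2) < μ) (k : ℕ) :
    0 ≤ kernelCoeff s μ k := by
  have := gammaMu_pos hμ k
  rw [kernelCoeff]
  split_ifs <;> positivity

lemma kernelCoeff_le (s : Parity) {μ : ℝ} (hμ : -(1 / 2) < μ) (k : ℕ) :
    kernelCoeff s μ k ≤ (gammaMu μ k)⁻¹ := by
  have := gammaMu_pos hμ k
  rw [kernelCoeff]
  split_ifs
  · rfl
  · positivity

lemma neg_one_pow_eq_sign_or (s : Parity) (k : ℕ) :
    (-1 : ℝ) ^ k = s.sign ∨ (-1 : ℝ) ^ k = -s.sign := by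
  rcases neg_one_pow_eq_or ℝ k with h | h <;> cases s <;> simp [h, Parity.sign]

lemma kernelCoeff_eq (s : Parity) (μ : ℝ) (k : ℕ) :
    kernelCoeff s μ k = (1 + s.sign * (-1) ^ k) / 2 * (gammaMu μ k)⁻¹ := by
  rw [kernelCoeff]
  rcases neg_one_pow_eq_sign_or s k with h | h
  · rw [if_pos h, h, s.sign_sq]; ring
  · have hne : ¬ ((-1 : ℝ) ^ k = s.sign) := by
      rw [h]; cases s <;> norm_num [Parity.sign]
    rw [if_neg hne, h, mul_neg, s.sign_sq]; ring

lemma summable_kernelCoeff (s : Parity) {μ : ℝ} (hμ : -(1 / 2) < μ) {x : ℝ} (hx : 0 ≤ x) :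
    Summable fun k => kernelCoeff s μ k * x ^ k := by
  refine Summable.of_nonneg_of_le (fun k => ?_) (fun k => ?_) (summable_pow_div_gammaMu hμ hx)
  · have := kernelCoeff_nonneg s hμ k; positivity
  · rw [mul_comm]
    gcongr
    exact kernelCoeff_le s hμ k

lemma hasSum_expMu {μ : ℝ} (hμ : -(1 / 2) < μ) (z : ℂ) :
    HasSum (fun k : ℕ => z ^ k / ((gammaMu μ k : ℝ) : ℂ)) (expMu μ z) := by
  refine Summable.hasSum (Summable.of_norm ?_)
  refine (summable_pow_div_gammaMu hμ (norm_nonneg z)).congr fun k => ?_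
  rw [norm_div, norm_pow, Complex.norm_real, Real.norm_of_nonneg (gammaMu_pos hμ k).le,
    div_eq_mul_inv]

lemma hasSum_kernel (s : Parity) {μ : ℝ} (hμ : -(1 / 2) < μ) (z w : ℂ) :
    HasSum (fun k : ℕ => (kernelCoeff s μ k : ℂ) * (star z * w) ^ k) (kernel s μ z w) := by
  have h := ((hasSum_expMu hμ (star z * w)).add
    ((hasSum_expMu hμ (-(star z * w))).mul_left (s.sign : ℂ))).div_const 2
  refine h.congr_fun fun k => ?_
  rw [kernelCoeff_eq, neg_pow]
  push_cast
  ring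

lemma exists_kernelCoeff_sum_le (s : Parity) {μ : ℝ} (hμ : -(1 / 2) < μ) {l : ℝ} (hl : 1 < l) :
    ∃ C, 0 < C ∧ ∀ x, 0 ≤ x → ∑' k, kernelCoeff s μ k * x ^ k ≤ C * Real.exp (l * x) := by
  obtain ⟨C, hC, h⟩ := exists_inv_gammaMu_le hμ hl
  refine ⟨C, hC, fun x hx => ?_⟩
  have h0 : HasSum (fun k : ℕ => C * ((l * x) ^ k / k.factorial)) (C * Real.exp (l * x)) := by
    rw [Real.exp_eq_exp_ℝ]
    exact (NormedSpace.expSeries_div_hasSum_exp (l * x)).mul_left C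
  rw [← h0.tsum_eq]
  refine Summable.tsum_le_tsum (fun k => ?_) (summable_kernelCoeff s hμ hx) h0.summable
  calc _ ≤ (C * (l ^ k / k.factorial)) * x ^ k := by
        gcongr
        exact (kernelCoeff_le s hμ k).trans (h k)
    _ = _ := by rw [mul_pow]; ring

lemma norm_kernelCoeff_mul_pow (s : Parity) {μ : ℝ} (hμ : -(1 / 2) < μ) (z w : ℂ) (k : ℕ) :
    ‖(kernelCoeff s μ k : ℂ) * (star z * w) ^ k‖ = kernelCoeff s μ k * (‖z‖ * ‖w‖) ^ k := by
  rw [norm_mul, norm_pow, norm_mul, norm_star, Complex.norm_real,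
    Real.norm_of_nonneg (kernelCoeff_nonneg s hμ k)]

lemma norm_kernel_le (s : Parity) {μ : ℝ} (hμ : -(1 / 2) < μ) (z w : ℂ) :
    ‖kernel s μ z w‖ ≤ ∑' k, kernelCoeff s μ k * (‖z‖ * ‖w‖) ^ k := by
  rw [← (hasSum_kernel s hμ z w).tsum_eq]
  have h : Summable fun k => kernelCoeff s μ k * (‖z‖ * ‖w‖) ^ k :=
    summable_kernelCoeff s hμ (by positivity)
  simp only [← norm_kernelCoeff_mul_pow s hμ] at h ⊢
  exact norm_tsum_le_tsum_norm h

/-- Young's inequality `l|z||w| ≤ b|z|² + l²|w|²/(4b)` separates the variables. The parameter `b`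
stays free, to be balanced against the integrability available in `z` and in `w`. -/
lemma exists_kernelCoeff_sum_le_gaussian (s : Parity) {μ : ℝ} (hμ : -(1 / 2) < μ) {l b : ℝ}
    (hl : 1 < l) (hb : 0 < b) :
    ∃ C, 0 < C ∧ ∀ z w : ℂ, ∑' k, kernelCoeff s μ k * (‖z‖ * ‖w‖) ^ k ≤
      C * (Real.exp (b * ‖z‖ ^ 2) * Real.exp (l ^ 2 / (4 * b) * ‖w‖ ^ 2)) := by
  obtain ⟨C, hC, h⟩ := exists_kernelCoeff_sum_le s hμ hl
  refine ⟨C, hC, fun z w => (h _ (by positivity)).trans ?_⟩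
  rw [← Real.exp_add]
  gcongr
  have := sq_nonneg (2 * b * ‖z‖ - l * ‖w‖)
  have e : b * ‖z‖ ^ 2 + l ^ 2 / (4 * b) * ‖w‖ ^ 2 - l * (‖z‖ * ‖w‖) =
      (2 * b * ‖z‖ - l * ‖w‖) ^ 2 / (4 * b) := by field_simp; ring
  have : 0 ≤ (2 * b * ‖z‖ - l * ‖w‖) ^ 2 / (4 * b) := by positivity
  linarith

lemma differentiable_tsum_pow {a : ℕ → ℂ} (h : ∀ R : ℝ, 0 ≤ R → Summable fun k => ‖a k‖ * R ^ k) :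
    Differentiable ℂ fun z => ∑' k, a k * z ^ k := by
  intro z
  have h1 := Complex.differentiableOn_tsum_of_summable_norm (F := fun k (z : ℂ) => a k * z ^ k)
    (U := Metric.ball 0 (‖z‖ + 1)) (h (‖z‖ + 1) (by positivity)) (fun k => by fun_prop)
    Metric.isOpen_ball fun k w hw => by
      rw [norm_mul, norm_pow]
      gcongr
      simpa using (mem_ball_zero_iff.1 hw).le
  exact (h1 z (by simp)).differentiableAt (Metric.isOpen_ball.mem_nhds (by simp))

lemma continuous_kernel (s : Parity) {μ : ℝ} (hμ : -(1 / 2) < μ) :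
    Continuous fun x : ℂ × ℂ => kernel s μ x.1 x.2 := by
  have h : Differentiable ℂ (expMu μ) := by
    have := differentiable_tsum_pow (a := fun k => ((gammaMu μ k : ℝ) : ℂ)⁻¹) fun R hR => by
      refine (summable_pow_div_gammaMu hμ hR).congr fun k => ?_
      rw [norm_inv, Complex.norm_real, Real.norm_of_nonneg (gammaMu_pos hμ k).le, mul_comm]
    convert! this using 2 with z
    rw [expMu]
    simp only [div_eq_mul_inv, mul_comm]
  have hc := h.continuous
  unfold kernel
  fun_prop

/-! ### The transform -/

section transform

variable {s : Parity} {μ : ℝ} {f : ℂ → ℂ} {b : ℝ}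

/-- Everything is dominated by the power series of absolute values, which one integrable Gaussian
multiple of `‖f‖` controls. The summability is what permits integrating the kernel series term by
term. -/
lemma integrable_kernelCoeff_sum_mul (hμ : -(1 / 2) < μ) (hb : 0 < b)
    (hf : AEStronglyMeasurable f (nu s μ))
    (hfb : Integrable (fun z => Real.exp (b * ‖z‖ ^ 2) * ‖f z‖) (nu s μ)) (w : ℂ) :
    Integrable (fun z => kernel s μ z w * f z) (nu s μ) ∧
    (∀ k, Integrable (fun z => (kernelCoeff s μ k : ℂ) * (star z * w) ^ k * f z) (nu s μ)) ∧
    Summable fun k => ∫ z, ‖(kernelCoeff s μ k : ℂ) * (star z * w) ^ k * f z‖ ∂(nu s μ) := by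
  obtain ⟨C, hC, h⟩ := exists_kernelCoeff_sum_le_gaussian s hμ one_lt_two hb
  set g : ℂ → ℝ := fun z => C * Real.exp (2 ^ 2 / (4 * b) * ‖w‖ ^ 2) *
    (Real.exp (b * ‖z‖ ^ 2) * ‖f z‖) with hg
  have hgi : Integrable g (nu s μ) := hfb.const_mul _
  have hsum : ∀ z : ℂ, Summable fun k => kernelCoeff s μ k * (‖z‖ * ‖w‖) ^ k := fun z =>
    summable_kernelCoeff s hμ (by positivity)
  have hle : ∀ z, (∑' k, kernelCoeff s μ k * (‖z‖ * ‖w‖) ^ k) * ‖f z‖ ≤ g z := fun z => by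
    calc _ ≤ (C * (Real.exp (b * ‖z‖ ^ 2) * Real.exp (2 ^ 2 / (4 * b) * ‖w‖ ^ 2))) * ‖f z‖ := by
          gcongr; exact h z w
      _ = _ := by rw [hg]; ring
  have hn : ∀ k z, ‖(kernelCoeff s μ k : ℂ) * (star z * w) ^ k * f z‖ =
      kernelCoeff s μ k * (‖z‖ * ‖w‖) ^ k * ‖f z‖ := fun k z => by
    rw [norm_mul, norm_kernelCoeff_mul_pow s hμ]
  have hnn : ∀ k (z : ℂ), 0 ≤ kernelCoeff s μ k * (‖z‖ * ‖w‖) ^ k := fun k z => by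
    have := kernelCoeff_nonneg s hμ k; positivity
  have hi : ∀ k, Integrable (fun z => (kernelCoeff s μ k : ℂ) * (star z * w) ^ k * f z)
      (nu s μ) := fun k => by
    refine hgi.mono' ?_ (Eventually.of_forall fun z => ?_)
    · have : Continuous fun z : ℂ => (kernelCoeff s μ k : ℂ) * (star z * w) ^ k := by fun_prop
      exact this.aestronglyMeasurable.mul hf
    · rw [hn]
      refine le_trans ?_ (hle z)
      gcongr
      exact (hsum z).le_tsum k fun j _ => hnn j z
  refine ⟨?_, hi, ?_⟩
  · refine hgi.mono' ?_ (Eventually.of_forall fun z => ?_)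
    · have : Continuous fun z : ℂ => kernel s μ z w :=
        Continuous.comp (g := fun x : ℂ × ℂ => kernel s μ x.1 x.2) (f := fun z : ℂ => (z, w))
          (continuous_kernel s hμ) (by fun_prop)
      exact this.aestronglyMeasurable.mul hf
    · rw [norm_mul]
      refine le_trans ?_ (hle z)
      gcongr
      exact norm_kernel_le s hμ z w
  · refine summable_of_sum_le (c := ∫ z, g z ∂(nu s μ)) (fun k => integral_nonneg fun z => norm_nonneg _) fun u => ?_
    simp only [hn]
    have hi' : ∀ k ∈ u, Integrable (fun z => kernelCoeff s μ k * (‖z‖ * ‖w‖) ^ k * ‖f z‖) (nu s μ) :=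
      fun k _ => (hi k).norm.congr (Eventually.of_forall (hn k))
    rw [← integral_finsetSum u hi']
    refine integral_mono (integrable_finsetSum u hi') hgi fun z => ?_
    simp only
    rw [← Finset.sum_mul]
    refine le_trans ?_ (hle z)
    gcongr
    exact (hsum z).sum_le_tsum u fun j _ => hnn j z

lemma hasSum_transform (hμ : -(1 / 2) < μ) (hb : 0 < b)
    (hf : AEStronglyMeasurable f (nu s μ))
    (hfb : Integrable (fun z => Real.exp (b * ‖z‖ ^ 2) * ‖f z‖) (nu s μ)) (w : ℂ) :
    HasSum (fun k => (kernelCoeff s μ k * ∫ z, star z ^ k * f z ∂(nu s μ)) * w ^ k)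
      (transform s μ f w) := by
  obtain ⟨-, hi, hs⟩ := integrable_kernelCoeff_sum_mul hμ hb hf hfb w
  have h := hasSum_integral_of_summable_integral_norm hi hs
  have e1 : ∀ z, ∑' k, (kernelCoeff s μ k : ℂ) * (star z * w) ^ k * f z = kernel s μ z w * f z :=
    fun z => ((hasSum_kernel s hμ z w).mul_right (f z)).tsum_eq
  simp only [e1] at h
  refine h.congr_fun fun k => ?_
  rw [mul_assoc, mul_comm (∫ z, star z ^ k * f z ∂(nu s μ)), ← integral_const_mul,
    ← integral_const_mul]
  congr 1
  ext z
  rw [mul_pow]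
  ring

lemma differentiable_transform (hμ : -(1 / 2) < μ) (hb : 0 < b)
    (hf : AEStronglyMeasurable f (nu s μ))
    (hfb : Integrable (fun z => Real.exp (b * ‖z‖ ^ 2) * ‖f z‖) (nu s μ)) :
    Differentiable ℂ (transform s μ f) := by
  have h := differentiable_tsum_pow
    (a := fun k => kernelCoeff s μ k * ∫ z, star z ^ k * f z ∂(nu s μ)) fun R hR => by
    obtain ⟨-, hi, hs⟩ := integrable_kernelCoeff_sum_mul hμ hb hf hfb (R : ℂ)
    refine hs.of_nonneg_of_le (fun k => by positivity) fun k => ?_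
    refine le_trans (le_of_eq ?_) (norm_integral_le_integral_norm _)
    have e : ∀ z, (kernelCoeff s μ k : ℂ) * (star z * (R : ℂ)) ^ k * f z =
        (kernelCoeff s μ k * (R : ℂ) ^ k) * (star z ^ k * f z) := fun z => by rw [mul_pow]; ring
    simp only [e]
    rw [integral_const_mul, norm_mul, norm_mul, norm_mul, norm_pow, Complex.norm_real R,
      Real.norm_of_nonneg hR]
    ring
  convert! h using 2 with w
  exact (hasSum_transform hμ hb hf hfb w).tsum_eq.symm

lemma transform_neg (f : ℂ → ℂ) (w : ℂ) :
    transform s μ f (-w) = (s.sign : ℂ) * transform s μ f w := by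
  rw [transform, transform, ← integral_const_mul]
  congr 1
  ext z
  have h : (s.sign : ℂ) * (s.sign : ℂ) = 1 := by exact_mod_cast s.sign_sq
  rw [kernel, kernel, mul_neg, neg_neg]
  linear_combination (-(expMu μ (-(star z * w)) * f z / 2)) * h

lemma norm_transform_le (hμ : -(1 / 2) < μ) {l : ℝ} (hl : 1 < l) (hb : 0 < b) :
    ∃ C, 0 < C ∧ ∀ f : ℂ → ℂ, Integrable (fun z => Real.exp (b * ‖z‖ ^ 2) * ‖f z‖) (nu s μ) →
      ∀ w, ‖transform s μ f w‖ ≤ C * (∫ z, Real.exp (b * ‖z‖ ^ 2) * ‖f z‖ ∂(nu s μ)) *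
        Real.exp (l ^ 2 / (4 * b) * ‖w‖ ^ 2) := by
  obtain ⟨C, hC, h⟩ := exists_kernelCoeff_sum_le_gaussian s hμ hl hb
  refine ⟨C, hC, fun f hf w => ?_⟩
  rw [mul_right_comm, ← integral_const_mul]
  refine norm_integral_le_of_norm_le (hf.const_mul _) (Eventually.of_forall fun z => ?_)
  rw [norm_mul]
  calc _ ≤ (C * (Real.exp (b * ‖z‖ ^ 2) * Real.exp (l ^ 2 / (4 * b) * ‖w‖ ^ 2))) * ‖f z‖ := by
        gcongr
        exact (norm_kernel_le s hμ z w).trans (h z w)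
    _ = _ := by ring

end transform

/-! ### Boundedness of the transform from `L^p` to the weighted `L^q` -/

lemma memLp_exp_nu (s : Parity) {μ b : ℝ} (hμ : -(1 / 2) < μ) {r : ℝ≥0∞} (hr0 : r ≠ 0)
    (hr : r ≠ ∞) (hb : b * r.toReal < 1) :
    MemLp (fun z : ℂ => Real.exp (b * ‖z‖ ^ 2)) r (nu s μ) := by
  have hc : Continuous fun z : ℂ => Real.exp (b * ‖z‖ ^ 2) := by fun_prop
  rw [← integrable_norm_rpow_iff hc.aestronglyMeasurable hr0 hr]
  refine (integrable_exp_nu s hμ hb).congr (Eventually.of_forall fun z => ?_)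
  simp only
  rw [Real.norm_of_nonneg (Real.exp_pos _).le, ← Real.exp_mul]
  ring_nf

lemma integral_exp_mul_norm_le (s : Parity) {μ b : ℝ} (hμ : -(1 / 2) < μ) {p r : ℝ≥0∞}
    [ENNReal.HolderConjugate r p] (hr : r ≠ ∞) (hb : b * r.toReal < 1) {f : ℂ → ℂ}
    (hf : MemLp f p (nu s μ)) :
    Integrable (fun z => Real.exp (b * ‖z‖ ^ 2) * ‖f z‖) (nu s μ) ∧
    ENNReal.ofReal (∫ z, Real.exp (b * ‖z‖ ^ 2) * ‖f z‖ ∂(nu s μ)) ≤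
      eLpNorm (fun z : ℂ => Real.exp (b * ‖z‖ ^ 2)) r (nu s μ) * eLpNorm f p (nu s μ) := by
  have hr0 : r ≠ 0 := ENNReal.HolderConjugate.ne_zero r p
  have he := memLp_exp_nu s hμ hr0 hr hb
  have hi : Integrable (fun z => Real.exp (b * ‖z‖ ^ 2) * ‖f z‖) (nu s μ) :=
    memLp_one_iff_integrable.1 (MemLp.mul' hf.norm he)
  refine ⟨hi, ?_⟩
  have h := eLpNorm_smul_le_mul_eLpNorm (p := r) (q := p) (r := 1) hf.norm.1 he.1
  rw [eLpNorm_norm] at h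
  refine le_trans (le_of_eq ?_) h
  rw [eLpNorm_one_eq_lintegral_enorm, ofReal_integral_eq_lintegral_ofReal hi
    (Eventually.of_forall fun z => by positivity)]
  refine lintegral_congr fun z => ?_
  rw [← Real.enorm_of_nonneg (by positivity)]
  rfl

lemma integrable_nuWeighted_iff (s : Parity) (μ a : ℝ) {f : ℂ → ℝ} :
    Integrable f (nuWeighted s μ a) ↔
      Integrable (fun z => Real.exp (-a * ‖z‖ ^ 2) * f z) (nu s μ) := by
  rw [nuWeighted, integrable_withDensity_iff_integrable_smul' (by fun_prop)
    (Eventually.of_forall fun _ => ENNReal.ofReal_lt_top)]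
  simp only [ENNReal.toReal_ofReal (Real.exp_pos _).le, smul_eq_mul]

lemma memLp_exp_nuWeighted (s : Parity) {μ b a : ℝ} (hμ : -(1 / 2) < μ) {r : ℝ≥0∞} (hr0 : r ≠ 0)
    (hr : r ≠ ∞) (hb : b * r.toReal - a < 1) :
    MemLp (fun z : ℂ => Real.exp (b * ‖z‖ ^ 2)) r (nuWeighted s μ a) := by
  have hc : Continuous fun z : ℂ => Real.exp (b * ‖z‖ ^ 2) := by fun_prop
  rw [← integrable_norm_rpow_iff hc.aestronglyMeasurable hr0 hr, integrable_nuWeighted_iff]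
  refine (integrable_exp_nu s hμ hb).congr (Eventually.of_forall fun z => ?_)
  simp only
  rw [Real.norm_of_nonneg (Real.exp_pos _).le, ← Real.exp_mul, ← Real.exp_add]
  ring_nf

lemma exists_one_lt_cube_mul_lt {x y : ℝ} (h : x < y) : ∃ l : ℝ, 1 < l ∧ l ^ 3 * x < y := by
  have hc : Tendsto (fun l : ℝ => l ^ 3 * x) (𝓝[>] 1) (𝓝 (1 ^ 3 * x)) :=
    ((by fun_prop : Continuous fun l : ℝ => l ^ 3 * x).tendsto 1).mono_left nhdsWithin_le_nhds
  rw [one_pow, one_mul] at hc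
  obtain ⟨l, h1, h2⟩ := ((hc.eventually (gt_mem_nhds h)).and self_mem_nhdsWithin).exists
  exact ⟨l, h2, h1⟩

/-- The transform is bounded from `L^p` to the weighted space. -/
lemma exists_transform_bound (s : Parity) {μ : ℝ} (hμ : -(1 / 2) < μ) {p q : ℝ≥0∞}
    (hp : 1 < p) (hq : 1 ≤ q) (hq_top : q < ∞) {a : ℝ}
    (ha : (ENNReal.conjExponent p).toReal * q.toReal / 4 - 1 < a) :
    ∃ C : ℝ≥0∞, C ≠ ∞ ∧ ∀ f : ℂ → ℂ, MemLp f p (nu s μ) →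
      (∃ b, 0 < b ∧ Integrable (fun z => Real.exp (b * ‖z‖ ^ 2) * ‖f z‖) (nu s μ)) ∧
      eLpNorm (transform s μ f) q (nuWeighted s μ a) ≤ C * eLpNorm f p (nu s μ) := by
  set r := ENNReal.conjExponent p with hr
  have : ENNReal.HolderConjugate p r := ENNReal.HolderConjugate.conjExponent hp.le
  have : ENNReal.HolderConjugate r p := ENNReal.HolderConjugate.symm
  have hr_top : r ≠ ∞ := by
    rw [hr, ENNReal.conjExponent]
    simp [tsub_eq_zero_iff_le, hp]
  have hr1 : 1 ≤ r := ENNReal.HolderConjugate.one_le r p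
  have hr1' : 1 ≤ r.toReal := by
    rw [← ENNReal.toReal_one]
    exact (ENNReal.toReal_le_toReal ENNReal.one_ne_top hr_top).2 hr1
  obtain ⟨l, hl, hl'⟩ := exists_one_lt_cube_mul_lt (show r.toReal * q.toReal / 4 < 1 + a by linarith)
  -- Hölder in `z` needs `b p' < 1`, so `b` is just below `1/p'`. The Gaussian left in `w` has
  -- exponent `l²/(4b) = l³p'/4`, whose `q`-th power the weight absorbs if `l³p'q/4 < 1 + a`; hence
  -- the cube in the choice of `l`.
  set b : ℝ := (l * r.toReal)⁻¹ with hb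
  have hb0 : 0 < b := by positivity
  have hbr : b * r.toReal < 1 := by
    rw [hb, mul_inv, mul_assoc, inv_mul_cancel₀ (by positivity), mul_one]
    exact inv_lt_one_of_one_lt₀ hl
  obtain ⟨C, hC, h⟩ := norm_transform_le (s := s) hμ hl hb0
  set κ := l ^ 2 / (4 * b) with hκ
  have hκ' : κ * q.toReal - a < 1 := by
    have : κ * q.toReal = l ^ 3 * (r.toReal * q.toReal / 4) := by
      rw [hκ, hb]; field_simp
    linarith
  have hq0 : q ≠ 0 := (zero_lt_one.trans_le hq).ne'
  have m1 := memLp_exp_nuWeighted s hμ hq0 hq_top.ne hκ'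
  have m2 := memLp_exp_nu s hμ (ENNReal.HolderConjugate.ne_zero r p) hr_top hbr
  refine ⟨ENNReal.ofReal C * eLpNorm (fun z : ℂ => Real.exp (b * ‖z‖ ^ 2)) r (nu s μ) *
    eLpNorm (fun z : ℂ => Real.exp (κ * ‖z‖ ^ 2)) q (nuWeighted s μ a),
    ENNReal.mul_ne_top (ENNReal.mul_ne_top ENNReal.ofReal_ne_top m2.2.ne) m1.2.ne, fun f hf => ?_⟩
  obtain ⟨i1, i2⟩ := integral_exp_mul_norm_le s hμ (p := p) hr_top hbr hf
  refine ⟨⟨b, hb0, i1⟩, ?_⟩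
  refine (eLpNorm_le_mul_eLpNorm_of_ae_le_mul
    (g := fun z : ℂ => Real.exp (κ * ‖z‖ ^ 2))
    (c := C * ∫ z, Real.exp (b * ‖z‖ ^ 2) * ‖f z‖ ∂(nu s μ)) (Eventually.of_forall fun w => ?_) q).trans ?_
  · rw [Real.norm_of_nonneg (Real.exp_pos _).le]
    exact h f i1 w
  · rw [ENNReal.ofReal_mul hC.le]
    calc _ ≤ ENNReal.ofReal C * (eLpNorm (fun z : ℂ => Real.exp (b * ‖z‖ ^ 2)) r (nu s μ) *
          eLpNorm f p (nu s μ)) * eLpNorm (fun z : ℂ => Real.exp (κ * ‖z‖ ^ 2)) q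
            (nuWeighted s μ a) := by gcongr
      _ = _ := by ring

/-! ### Growth -/

lemma exists_pow_le_exp {e : ℝ} (he : 0 < e) (n : ℕ) :
    ∃ C, 0 < C ∧ ∀ x : ℝ, 0 ≤ x → x ^ n ≤ C * Real.exp (e * x ^ 2) := by
  refine ⟨1 + n.factorial / e ^ n, by positivity, fun x hx => ?_⟩
  have h1 := Real.pow_div_factorial_le_exp (e * x ^ 2) (by positivity) n
  have h2 : (x ^ n) ^ 2 ≤ n.factorial / e ^ n * Real.exp (e * x ^ 2) := by
    have hf : (0 : ℝ) < n.factorial := by exact_mod_cast n.factorial_pos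
    rw [div_le_iff₀ hf, mul_pow] at h1
    rw [div_mul_eq_mul_div, le_div_iff₀ (by positivity)]
    calc _ = e ^ n * (x ^ 2) ^ n := by ring
      _ ≤ _ := h1.trans (le_of_eq (mul_comm _ _))
  have h3 : 1 ≤ Real.exp (e * x ^ 2) := Real.one_le_exp (by positivity)
  nlinarith [sq_nonneg (x ^ n - 1)]

/-- Growth smaller than every Gaussian. -/
def SubgaussianGrowth (f : ℂ → ℂ) : Prop :=
  ∀ e : ℝ, 0 < e → ∃ C, 0 < C ∧ ∀ z, ‖f z‖ ≤ C * Real.exp (e * ‖z‖ ^ 2)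

lemma subgaussianGrowth_polynomial (n : ℕ) (c : ℕ → ℂ) :
    SubgaussianGrowth fun z => ∑ k ∈ Finset.range n, c k * z ^ k := by
  intro e he
  choose C hC h using fun k => exists_pow_le_exp he k
  refine ⟨1 + ∑ k ∈ Finset.range n, ‖c k‖ * C k, ?_, fun z => ?_⟩
  · have : 0 ≤ ∑ k ∈ Finset.range n, ‖c k‖ * C k :=
      Finset.sum_nonneg fun k _ => mul_nonneg (norm_nonneg _) (hC k).le
    linarith
  · rw [add_mul, one_mul, Finset.sum_mul]
    refine (norm_sum_le _ _).trans ?_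
    refine le_trans (Finset.sum_le_sum fun k _ => ?_) (le_add_of_nonneg_left (Real.exp_pos _).le)
    rw [norm_mul, norm_pow, mul_assoc]
    gcongr
    exact h k _ (norm_nonneg z)

lemma integrable_of_le_exp {E : Type*} [NormedAddCommGroup E] (s : Parity) {μ b C : ℝ}
    (hμ : -(1 / 2) < μ) (hb : b < 1) {f : ℂ → E} (hf : AEStronglyMeasurable f (nu s μ))
    (h : ∀ z, ‖f z‖ ≤ C * Real.exp (b * ‖z‖ ^ 2)) : Integrable f (nu s μ) :=
  ((integrable_exp_nu s hμ hb).const_mul C).mono' hf (Eventually.of_forall h)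

lemma integrable_exp_mul_norm_of_growth (s : Parity) {μ : ℝ} (hμ : -(1 / 2) < μ) {b : ℝ} (hb : b < 1)
    {f : ℂ → ℂ} (hf : AEStronglyMeasurable f (nu s μ)) (hg : SubgaussianGrowth f) :
    Integrable (fun z => Real.exp (b * ‖z‖ ^ 2) * ‖f z‖) (nu s μ) := by
  obtain ⟨C, hC, h⟩ := hg ((1 - b) / 2) (by linarith)
  refine integrable_of_le_exp s hμ (b := b + (1 - b) / 2) (C := C) (by linarith) ?_ fun z => ?_
  · have : Continuous fun z : ℂ => Real.exp (b * ‖z‖ ^ 2) := by fun_prop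
    exact this.aestronglyMeasurable.mul hf.norm
  · rw [norm_mul, norm_norm, Real.norm_of_nonneg (Real.exp_pos _).le]
    calc _ ≤ Real.exp (b * ‖z‖ ^ 2) * (C * Real.exp ((1 - b) / 2 * ‖z‖ ^ 2)) := by gcongr; exact h z
      _ = C * (Real.exp (b * ‖z‖ ^ 2) * Real.exp ((1 - b) / 2 * ‖z‖ ^ 2)) := by ring
      _ = _ := by rw [← Real.exp_add]; ring_nf

lemma SubgaussianGrowth.memLp {f : ℂ → ℂ} (hg : SubgaussianGrowth f) (s : Parity) {μ : ℝ}
    (hμ : -(1 / 2) < μ) (hf : AEStronglyMeasurable f (nu s μ)) {r : ℝ≥0∞} (hr0 : r ≠ 0)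
    (hr : r ≠ ∞) : MemLp f r (nu s μ) := by
  have hr' : 0 < r.toReal := ENNReal.toReal_pos hr0 hr
  obtain ⟨C, hC, h⟩ := hg (r.toReal⁻¹ / 2) (by positivity)
  have h1 : r.toReal⁻¹ / 2 * r.toReal < 1 := by field_simp; norm_num
  refine ((memLp_exp_nu s hμ hr0 hr h1).const_mul C).mono' hf (Eventually.of_forall h)

lemma integrable_monomial (s : Parity) {μ : ℝ} (hμ : -(1 / 2) < μ) (j k : ℕ) :
    Integrable (fun z : ℂ => star z ^ j * z ^ k) (nu s μ) := by
  obtain ⟨C, hC, h⟩ := exists_pow_le_exp (show (0 : ℝ) < 1 / 2 by norm_num) (j + k)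
  refine integrable_of_le_exp s hμ (b := 1 / 2) (C := C) (by norm_num) ?_ fun z => ?_
  · exact (by fun_prop : Continuous fun z : ℂ => star z ^ j * z ^ k).aestronglyMeasurable
  · rw [norm_mul, norm_pow, norm_pow, norm_star, ← pow_add]
    exact h _ (norm_nonneg z)

/-- The reproducing property in coordinates: monomials are orthogonal, and for parity `s` the kernel
coefficient is the reciprocal of the squared norm. -/
lemma kernelCoeff_mul_integral_monomial (s : Parity) {μ : ℝ} (hμ : -(1 / 2) < μ) (j k : ℕ) :
    (kernelCoeff s μ j : ℂ) * ∫ z : ℂ, star z ^ j * z ^ k ∂(nu s μ) =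
      if j = k ∧ (-1 : ℝ) ^ j = s.sign then 1 else 0 := by
  by_cases hjk : j = k
  · subst hjk
    by_cases hs : (-1 : ℝ) ^ j = s.sign
    · have : ∀ z : ℂ, star z ^ j * z ^ j = ((‖z‖ ^ (2 * j) : ℝ) : ℂ) := fun z => by
        rw [← mul_pow, pow_mul]
        push_cast
        congr 1
        exact Complex.conj_mul' z
      simp only [this]
      rw [integral_complex_ofReal, integral_norm_pow_nu_eq_gammaMu s hμ j hs, kernelCoeff, if_pos hs,
        if_pos (by simp [hs])]
      have := (gammaMu_pos hμ j).ne'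
      rw [← Complex.ofReal_mul, inv_mul_cancel₀ this, Complex.ofReal_one]
    · rw [kernelCoeff, if_neg hs, if_neg (fun h => hs h.2)]
      simp
  · rw [integral_monomial_nu_of_ne s μ hjk, if_neg (fun h => hjk h.1), mul_zero]

lemma transform_polynomial (s : Parity) {μ : ℝ} (hμ : -(1 / 2) < μ) (n : ℕ) (c : ℕ → ℂ)
    (hc : ∀ k, (-1 : ℝ) ^ k ≠ s.sign → c k = 0) :
    transform s μ (fun z => ∑ k ∈ Finset.range n, c k * z ^ k) =
      fun z => ∑ k ∈ Finset.range n, c k * z ^ k := by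
  ext w
  set f : ℂ → ℂ := fun z => ∑ k ∈ Finset.range n, c k * z ^ k with hf
  have hfc : Continuous f := by fun_prop
  have hsum := hasSum_transform (s := s) hμ (b := 1 / 2) (by norm_num) hfc.aestronglyMeasurable
    (integrable_exp_mul_norm_of_growth s hμ (by norm_num) hfc.aestronglyMeasurable
      (subgaussianGrowth_polynomial n c)) w
  have hcoef : ∀ k, (kernelCoeff s μ k : ℂ) * ∫ z, star z ^ k * f z ∂(nu s μ) =
      if k < n then c k else 0 := by
    intro k
    have e1 : ∫ z, star z ^ k * f z ∂(nu s μ) =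
        ∑ m ∈ Finset.range n, c m * ∫ z : ℂ, star z ^ k * z ^ m ∂(nu s μ) := by
      simp only [hf, Finset.mul_sum, mul_left_comm _ (c _)]
      rw [integral_finsetSum _ fun m _ => (integrable_monomial s hμ k m).const_mul _]
      simp only [integral_const_mul]
    rw [e1, Finset.mul_sum]
    simp only [mul_left_comm _ (c _), kernelCoeff_mul_integral_monomial s hμ]
    by_cases hs : (-1 : ℝ) ^ k = s.sign
    · simp [hs]
    · simp [hs, hc k hs]
  simp only [hcoef] at hsum
  have h2 : HasSum (fun k => (if k < n then c k else 0) * w ^ k)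
      (∑ k ∈ Finset.range n, (if k < n then c k else 0) * w ^ k) :=
    hasSum_sum_of_ne_finset_zero fun k hk => by
      rw [Finset.mem_range] at hk
      simp [hk]
  rw [hsum.unique h2]
  exact Finset.sum_congr rfl fun k hk => by rw [if_pos (Finset.mem_range.1 hk)]

/-! ### Contractivity on `L²` -/

lemma norm_toLp_sq {Ω : Type*} [MeasurableSpace Ω] {ν : Measure Ω} {f : Ω → ℂ} (hf : MemLp f 2 ν) :
    (eLpNorm f 2 ν).toReal ^ 2 = ∫ x, ‖f x‖ ^ 2 ∂ν := by
  rw [hf.eLpNorm_eq_integral_rpow_norm (by norm_num) (by norm_num)]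
  have h0 : 0 ≤ ∫ x, ‖f x‖ ^ 2 ∂ν := integral_nonneg fun x => by positivity
  simp only [ENNReal.toReal_ofNat, Real.rpow_two]
  rw [ENNReal.toReal_ofReal (by positivity), ← Real.rpow_natCast, ← Real.rpow_mul h0]
  norm_num

lemma memLp_monomial (s : Parity) {μ : ℝ} (hμ : -(1 / 2) < μ) (c : ℂ) (k : ℕ) :
    MemLp (fun z : ℂ => c * z ^ k) 2 (nu s μ) := by
  have hc : Continuous fun z : ℂ => c * z ^ k := by fun_prop
  refine SubgaussianGrowth.memLp ?_ s hμ hc.aestronglyMeasurable (by norm_num) (by norm_num)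
  intro e he
  obtain ⟨C, hC, h⟩ := subgaussianGrowth_polynomial (k + 1) (Pi.single k c) e he
  refine ⟨C, hC, fun z => ?_⟩
  have := h z
  simp only at this ⊢
  rwa [Finset.sum_eq_single k (fun j _ hj => by simp [hj]) (fun h => by simp at h),
    Pi.single_eq_same] at this

/-- Bessel's inequality for the monomials of parity `s`. -/
lemma sum_kernelCoeff_mul_norm_sq_le (s : Parity) {μ : ℝ} (hμ : -(1 / 2) < μ) {h : ℂ → ℂ}
    (hh : MemLp h 2 (nu s μ)) (u : Finset ℕ) :
    ∑ k ∈ u, kernelCoeff s μ k * ‖∫ z, star z ^ k * h z ∂(nu s μ)‖ ^ 2 ≤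
      ∫ z, ‖h z‖ ^ 2 ∂(nu s μ) := by
  classical
  set P : ℕ → Prop := fun k => (-1 : ℝ) ^ k = s.sign with hP
  set r : ℕ → ℝ := fun k => √(kernelCoeff s μ k) with hr
  have hr2 : ∀ k, (r k : ℂ) * r k = kernelCoeff s μ k := fun k => by
    rw [← Complex.ofReal_mul, Real.mul_self_sqrt (kernelCoeff_nonneg s hμ k)]
  set v : {k // P k} → Lp ℂ 2 (nu s μ) := fun k => (memLp_monomial s hμ (r k) k).toLp _ with hv
  set H := hh.toLp h with hH
  have hinner : ∀ k, ∀ g : ℂ → ℂ, ∀ hg : MemLp g 2 (nu s μ), inner ℂ (v k) (hg.toLp g) =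
      r k * ∫ z, star z ^ (k : ℕ) * g z ∂(nu s μ) := by
    intro k g hg
    rw [L2.inner_def, ← integral_const_mul]
    refine integral_congr_ae ?_
    filter_upwards [(memLp_monomial s hμ (r k) k).coeFn_toLp, hg.coeFn_toLp] with z h1 h2
    rw [h1, h2]
    simp only [RCLike.inner_apply, map_mul, map_pow, Complex.conj_ofReal]
    rw [mul_comm, mul_assoc]
    rfl
  have hon : Orthonormal ℂ v := by
    classical
    rw [orthonormal_iff_ite]
    intro j k
    have h0 := kernelCoeff_mul_integral_monomial s hμ j k
    rw [hv, hinner]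
    simp only [mul_left_comm _ (r k : ℂ), integral_const_mul]
    by_cases hjk : j = k
    · subst hjk
      rw [if_pos ⟨rfl, j.2⟩] at h0
      rw [if_pos rfl, ← mul_assoc, hr2, h0]
    · have hne : (j : ℕ) ≠ k := fun h => hjk (Subtype.ext h)
      rw [if_neg hjk, integral_monomial_nu_of_ne s μ hne]
      simp
  have key := hon.sum_inner_products_le H (s := u.subtype P)
  have hHn : ‖H‖ ^ 2 = ∫ z, ‖h z‖ ^ 2 ∂(nu s μ) := by
    rw [hH, Lp.norm_toLp, norm_toLp_sq hh]
  rw [hHn] at key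
  refine le_trans (le_of_eq ?_) key
  have e1 : ∀ k : {k // P k}, ‖inner ℂ (v k) H‖ ^ 2 =
      (fun k : ℕ => kernelCoeff s μ k * ‖∫ z, star z ^ k * h z ∂(nu s μ)‖ ^ 2) k := fun k => by
    rw [hH, hinner, norm_mul, mul_pow, Complex.norm_real, Real.norm_of_nonneg (Real.sqrt_nonneg _),
      Real.sq_sqrt (kernelCoeff_nonneg s hμ k)]
  simp only [e1]
  rw [Finset.sum_subtype_eq_sum_filter
    (f := fun k : ℕ => kernelCoeff s μ k * ‖∫ z, star z ^ k * h z ∂(nu s μ)‖ ^ 2), Finset.sum_filter]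
  refine Finset.sum_congr rfl fun k _ => ?_
  split_ifs with hk
  · rfl
  · rw [kernelCoeff, if_neg hk, zero_mul]

/-- Contractivity on `L²` in weak form. Expanding the transform of `h` in powers and integrating
against `g`, the `k`-th term is a product of normalized monomial coefficients of `h` and of the
conjugate of `g`. Cauchy-Schwarz and Bessel's inequality for both finish. -/
lemma norm_integral_transform_mul_le (s : Parity) {μ : ℝ} (hμ : -(1 / 2) < μ) {h g : ℂ → ℂ}
    (hh : MemLp h 2 (nu s μ)) (hg : MemLp g 2 (nu s μ))
    (hhb : Integrable (fun z => Real.exp (3 / 4 * ‖z‖ ^ 2) * ‖h z‖) (nu s μ))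
    (hgb : Integrable (fun z => Real.exp (3 / 4 * ‖z‖ ^ 2) * ‖g z‖) (nu s μ)) :
    ‖∫ w, transform s μ h w * g w ∂(nu s μ)‖ ≤
      √(∫ z, ‖h z‖ ^ 2 ∂(nu s μ)) * √(∫ z, ‖g z‖ ^ 2 ∂(nu s μ)) := by
  set a : ℕ → ℂ := fun k => kernelCoeff s μ k * ∫ z, star z ^ k * h z ∂(nu s μ) with ha
  -- With these values `l²/(4b) = 3/4 = b`: one exponent serves both variables.
  obtain ⟨C, hC, hle⟩ := exists_kernelCoeff_sum_le_gaussian s hμ (l := 3 / 2) (b := 3 / 4)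
    (by norm_num) (by norm_num)
  have hT := hasSum_transform hμ (by norm_num) hh.1 hhb
  set I := ∫ z, Real.exp (3 / 4 * ‖z‖ ^ 2) * ‖h z‖ ∂(nu s μ) with hI
  have hpart : ∀ (u : Finset ℕ) (w : ℂ), ∑ k ∈ u, ‖a k‖ * ‖w‖ ^ k ≤
      C * I * Real.exp (3 / 4 * ‖w‖ ^ 2) := by
    intro u w
    obtain ⟨-, hi, -⟩ := integrable_kernelCoeff_sum_mul hμ (by norm_num) hh.1 hhb w
    have e1 : ∀ k, ‖a k‖ * ‖w‖ ^ k ≤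
        ∫ z, ‖(kernelCoeff s μ k : ℂ) * (star z * w) ^ k * h z‖ ∂(nu s μ) := fun k => by
      refine le_trans (le_of_eq ?_) (norm_integral_le_integral_norm _)
      have e : ∀ z, (kernelCoeff s μ k : ℂ) * (star z * w) ^ k * h z =
        (kernelCoeff s μ k * w ^ k) * (star z ^ k * h z) := fun z => by rw [mul_pow]; ring
      simp only [e]
      rw [integral_const_mul, ha, norm_mul, norm_mul, norm_mul, norm_pow]
      ring
    refine (Finset.sum_le_sum fun k _ => e1 k).trans ?_
    rw [← integral_finsetSum _ fun k _ => (hi k).norm, hI, mul_right_comm, ← integral_const_mul]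
    refine integral_mono (integrable_finsetSum _ fun k _ => (hi k).norm) (hhb.const_mul _)
      fun z => ?_
    simp only [norm_mul (_ * _) (h z), norm_kernelCoeff_mul_pow s hμ]
    rw [← Finset.sum_mul]
    calc _ ≤ (C * (Real.exp (3 / 4 * ‖z‖ ^ 2) *
          Real.exp ((3 / 2) ^ 2 / (4 * (3 / 4)) * ‖w‖ ^ 2))) * ‖h z‖ := by
          gcongr
          refine le_trans ?_ (hle z w)
          refine (summable_kernelCoeff s hμ (by positivity)).sum_le_tsum u fun j _ => ?_
          have := kernelCoeff_nonneg s hμ j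
          positivity
      _ = _ := by norm_num; ring
  have hFi : ∀ k, Integrable (fun w => a k * w ^ k * g w) (nu s μ) := fun k => by
    refine (hgb.const_mul (C * I)).mono' ?_ (Eventually.of_forall fun w => ?_)
    · exact (by fun_prop : Continuous fun w : ℂ => a k * w ^ k).aestronglyMeasurable.mul hg.1
    · rw [norm_mul, norm_mul, norm_pow, ← mul_assoc]
      exact mul_le_mul_of_nonneg_right (by simpa using hpart {k} w) (norm_nonneg _)
  have hFs : Summable fun k => ∫ w, ‖a k * w ^ k * g w‖ ∂(nu s μ) := by
    refine summable_of_sum_le (c := ∫ w, C * I * (Real.exp (3 / 4 * ‖w‖ ^ 2) * ‖g w‖) ∂(nu s μ))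
      (fun k => integral_nonneg fun z => norm_nonneg _) fun u => ?_
    rw [← integral_finsetSum _ fun k _ => (hFi k).norm]
    refine integral_mono (integrable_finsetSum _ fun k _ => (hFi k).norm) (hgb.const_mul _)
      fun w => ?_
    simp only [norm_mul, norm_pow]
    rw [← Finset.sum_mul, ← mul_assoc]
    gcongr
    simpa only [norm_mul] using hpart u w
  have hsum := hasSum_integral_of_summable_integral_norm hFi hFs
  have e2 : ∀ w, ∑' k, a k * w ^ k * g w = transform s μ h w * g w := fun w =>
    ((hT w).mul_right (g w)).tsum_eq
  simp only [e2] at hsum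
  refine le_of_tendsto' hsum.norm fun u => ?_
  have hgs : MemLp (fun z => star (g z)) 2 (nu s μ) := hg.star
  have e3 : ∀ k, ‖∫ w, a k * w ^ k * g w ∂(nu s μ)‖ =
      (√(kernelCoeff s μ k) * ‖∫ z, star z ^ k * h z ∂(nu s μ)‖) *
      (√(kernelCoeff s μ k) * ‖∫ z, star z ^ k * star (g z) ∂(nu s μ)‖) := fun k => by
    have e4 : ∫ z, star z ^ k * star (g z) ∂(nu s μ) = star (∫ z, z ^ k * g z ∂(nu s μ)) := by
      have : ∀ z : ℂ, star z ^ k * star (g z) = (starRingEnd ℂ) (z ^ k * g z) := fun z => by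
        rw [map_mul, map_pow]; rfl
      simp only [this]
      exact integral_conj
    simp only [mul_assoc]
    rw [e4, norm_star, integral_const_mul, norm_mul, ha, norm_mul, Complex.norm_real,
      Real.norm_of_nonneg (kernelCoeff_nonneg s hμ k)]
    nth_rewrite 1 [← Real.mul_self_sqrt (kernelCoeff_nonneg s hμ k)]
    ring
  have e5 : ∀ (h : ℂ → ℂ) k, (√(kernelCoeff s μ k) * ‖∫ z, star z ^ k * h z ∂(nu s μ)‖) ^ 2 =
      kernelCoeff s μ k * ‖∫ z, star z ^ k * h z ∂(nu s μ)‖ ^ 2 := fun h k => by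
    rw [mul_pow, Real.sq_sqrt (kernelCoeff_nonneg s hμ k)]
  calc _ ≤ ∑ k ∈ u, ‖∫ w, a k * w ^ k * g w ∂(nu s μ)‖ := norm_sum_le _ _
    _ ≤ √(∑ k ∈ u, (√(kernelCoeff s μ k) * ‖∫ z, star z ^ k * h z ∂(nu s μ)‖) ^ 2) *
        √(∑ k ∈ u, (√(kernelCoeff s μ k) * ‖∫ z, star z ^ k * star (g z) ∂(nu s μ)‖) ^ 2) := by
      simp only [e3]
      exact Real.sum_mul_le_sqrt_mul_sqrt _ _ _
    _ ≤ _ := by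
      have b2 := sum_kernelCoeff_mul_norm_sq_le s hμ hgs u
      simp only [norm_star] at b2
      simp only [e5]
      gcongr
      exact sum_kernelCoeff_mul_norm_sq_le s hμ hh u

/-! ### Three lines for Laplace type integrals -/

section laplace

variable {X : Type*} [MeasurableSpace X] {m : Measure X} {G : X → ℂ} {L : X → ℝ}

lemma norm_mul_cexp (g z : ℂ) (l : ℝ) : ‖g * Complex.exp (z * l)‖ = ‖g‖ * Real.exp (z.re * l) := by
  rw [norm_mul, Complex.norm_exp]
  simp

lemma exp_mul_le_one_add {t l : ℝ} (h0 : 0 ≤ t) (h1 : t ≤ 1) :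
    Real.exp (t * l) ≤ 1 + Real.exp l := by
  rcases le_total l 0 with hl | hl
  · have : Real.exp (t * l) ≤ 1 := Real.exp_le_one_iff.2 (mul_nonpos_of_nonneg_of_nonpos h0 hl)
    have := Real.exp_pos l
    linarith
  · have : Real.exp (t * l) ≤ Real.exp l := Real.exp_le_exp.2 (by nlinarith)
    linarith

/-- The factor `|l|` produced by differentiation is paid for by the distance `d` to the right
boundary line, since `l ≤ e^{dl}/d` for `l ≥ 0`. -/
lemma abs_mul_exp_mul_le {d t l : ℝ} (hd : 0 < d) (h0 : 0 ≤ t) (h1 : t ≤ 1 - d) :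
    |l| * Real.exp (t * l) ≤ |l| + d⁻¹ * Real.exp l := by
  rcases le_total l 0 with hl | hl
  · have : Real.exp (t * l) ≤ 1 := Real.exp_le_one_iff.2 (mul_nonpos_of_nonneg_of_nonpos h0 hl)
    have := Real.exp_pos l
    have : 0 ≤ d⁻¹ * Real.exp l := by positivity
    nlinarith [abs_nonneg l]
  · rw [abs_of_nonneg hl]
    have h2 : l ≤ d⁻¹ * Real.exp (d * l) := by
      rw [← div_eq_inv_mul, le_div_iff₀ hd]
      have := Real.add_one_le_exp (d * l)
      linarith
    have h3 : Real.exp (d * l) * Real.exp (t * l) ≤ Real.exp l := by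
      rw [← Real.exp_add]
      exact Real.exp_le_exp.2 (by nlinarith)
    calc _ ≤ (d⁻¹ * Real.exp (d * l)) * Real.exp (t * l) := by gcongr
      _ = d⁻¹ * (Real.exp (d * l) * Real.exp (t * l)) := by ring
      _ ≤ d⁻¹ * Real.exp l := by gcongr
      _ ≤ _ := le_add_of_nonneg_left hl

lemma abs_exp_mul_sub_one_div_le {t l : ℝ} (h0 : 0 < t) (h1 : t ≤ 1) :
    |(Real.exp (t * l) - 1) / t| ≤ |l| + Real.exp l := by
  rw [abs_div, abs_of_pos h0, div_le_iff₀ h0]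
  rcases le_total l 0 with hl | hl
  · have h2 : Real.exp (t * l) ≤ 1 := Real.exp_le_one_iff.2 (mul_nonpos_of_nonneg_of_nonpos h0.le hl)
    rw [abs_of_nonpos (by linarith), abs_of_nonpos hl]
    have := Real.add_one_le_exp (t * l)
    have := Real.exp_pos l
    nlinarith
  · have h2 : 1 ≤ Real.exp (t * l) := Real.one_le_exp (by positivity)
    rw [abs_of_nonneg (by linarith), abs_of_nonneg hl]
    have h3 := convexOn_exp.2 (mem_univ 0) (mem_univ l) (sub_nonneg.2 h1) h0.le (by ring)
    simp only [smul_eq_mul, mul_zero, zero_add, Real.exp_zero, mul_one] at h3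
    nlinarith

lemma diffContOnCl_laplace (hG : AEStronglyMeasurable G m) (hL : AEMeasurable L m)
    (h0 : Integrable G m) (h1 : Integrable (fun x => ‖G x‖ * |L x|) m)
    (h2 : Integrable (fun x => ‖G x‖ * Real.exp (L x)) m) :
    DiffContOnCl ℂ (fun ζ : ℂ => ∫ x, G x * Complex.exp (ζ * L x) ∂m)
      (Complex.HadamardThreeLines.verticalStrip 0 1) := by
  have hLc : AEMeasurable (fun x => (L x : ℂ)) m := hL.complex_ofReal
  have hmeas : ∀ ζ : ℂ, AEStronglyMeasurable (fun x => G x * Complex.exp (ζ * L x)) m := fun ζ =>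
    hG.mul (Complex.measurable_exp.comp_aemeasurable (hLc.const_mul ζ)).aestronglyMeasurable
  have hbd : ∀ ζ : ℂ, 0 ≤ ζ.re → ζ.re ≤ 1 → ∀ x, ‖G x * Complex.exp (ζ * L x)‖ ≤
      ‖G x‖ + ‖G x‖ * Real.exp (L x) := fun ζ hζ0 hζ1 x => by
    rw [norm_mul_cexp, ← mul_one_add]
    exact mul_le_mul_of_nonneg_left (exp_mul_le_one_add hζ0 hζ1) (norm_nonneg _)
  have hcl : closure (Complex.HadamardThreeLines.verticalStrip 0 1) ⊆
      Complex.re ⁻¹' Icc 0 1 := by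
    refine closure_minimal (preimage_mono Ioo_subset_Icc_self) ?_
    exact isClosed_Icc.preimage Complex.continuous_re
  refine ⟨fun ζ hζ => ?_, fun ζ hζ => ?_⟩
  · have hζ0 : 0 < ζ.re := hζ.1
    have hζ1 : ζ.re < 1 := hζ.2
    set d := min ζ.re (1 - ζ.re) / 2 with hd
    have hdpos : 0 < d := by
      have : 0 < min ζ.re (1 - ζ.re) := lt_min hζ0 (by linarith)
      positivity
    have hre : ∀ w ∈ Metric.ball ζ d, 0 ≤ w.re ∧ w.re ≤ 1 - d := by
      intro w hw
      have h3 : |(w - ζ).re| ≤ ‖w - ζ‖ := Complex.abs_re_le_norm _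
      rw [← dist_eq_norm, Complex.sub_re, abs_le] at h3
      have h4 := Metric.mem_ball.1 hw
      have h5 := min_le_left ζ.re (1 - ζ.re)
      have h6 := min_le_right ζ.re (1 - ζ.re)
      constructor <;> linarith
    refine DifferentiableAt.differentiableWithinAt ?_
    refine (hasDerivAt_integral_of_dominated_loc_of_deriv_le
      (bound := fun x => ‖G x‖ * |L x| + d⁻¹ * (‖G x‖ * Real.exp (L x)))
      (F' := fun ζ x => G x * (Complex.exp (ζ * L x) * L x)) (Metric.ball_mem_nhds ζ hdpos)
      (Eventually.of_forall hmeas) ?_ ?_ ?_ ?_ ?_).2.differentiableAt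
    · exact (h0.norm.add h2).mono' (hmeas ζ) (Eventually.of_forall (hbd ζ hζ0.le hζ1.le))
    · simp only [← mul_assoc]
      exact (hmeas ζ).mul hLc.aestronglyMeasurable
    · refine Eventually.of_forall fun x w hw => ?_
      obtain ⟨k0, k1⟩ := hre w hw
      have := abs_mul_exp_mul_le (l := L x) hdpos k0 k1
      rw [← mul_assoc, norm_mul, norm_mul_cexp, Complex.norm_real, Real.norm_eq_abs]
      calc _ = ‖G x‖ * (|L x| * Real.exp (w.re * L x)) := by ring
        _ ≤ ‖G x‖ * (|L x| + d⁻¹ * Real.exp (L x)) := by gcongr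
        _ = _ := by ring
    · exact h1.add (h2.const_mul _)
    · refine Eventually.of_forall fun x w _ => ?_
      have e1 : HasDerivAt (fun w : ℂ => w * (L x : ℂ)) (L x) w := by
        simpa using (hasDerivAt_id w).mul_const (L x : ℂ)
      exact (e1.cexp).const_mul (G x)
  · refine ContinuousWithinAt.mono ?_ hcl
    refine continuousWithinAt_of_dominated (bound := fun x => ‖G x‖ + ‖G x‖ * Real.exp (L x))
      (Eventually.of_forall hmeas) ?_ (h0.norm.add h2) ?_
    · filter_upwards [self_mem_nhdsWithin] with w hw
      exact Eventually.of_forall (hbd w hw.1 hw.2)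
    · exact Eventually.of_forall fun x => by fun_prop

/-- The first variation of the three lines inequality at a point of equality. -/
lemma re_integral_mul_le_of_three_lines (hG : AEStronglyMeasurable G m) (hL : AEMeasurable L m)
    (h0 : Integrable G m) (h1 : Integrable (fun x => ‖G x‖ * |L x|) m)
    (h2 : Integrable (fun x => ‖G x‖ * Real.exp (L x)) m) {M₀ M₁ : ℝ} (hM₀ : 0 < M₀) (hM₁ : 0 < M₁)
    (hb0 : ∀ ζ : ℂ, ζ.re = 0 → ‖∫ x, G x * Complex.exp (ζ * L x) ∂m‖ ≤ M₀)
    (hb1 : ∀ ζ : ℂ, ζ.re = 1 → ‖∫ x, G x * Complex.exp (ζ * L x) ∂m‖ ≤ M₁)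
    (heq : ∫ x, G x ∂m = M₀) :
    (∫ x, G x * L x ∂m).re ≤ M₀ * Real.log (M₁ / M₀) := by
  set F : ℂ → ℂ := fun ζ => ∫ x, G x * Complex.exp (ζ * L x) ∂m with hF
  have hLc : AEMeasurable (fun x => (L x : ℂ)) m := hL.complex_ofReal
  have hmeas : ∀ ζ : ℂ, AEStronglyMeasurable (fun x => G x * Complex.exp (ζ * L x)) m := fun ζ =>
    hG.mul (Complex.measurable_exp.comp_aemeasurable (hLc.const_mul ζ)).aestronglyMeasurable
  have hbd : ∀ ζ : ℂ, 0 ≤ ζ.re → ζ.re ≤ 1 → ∀ x, ‖G x * Complex.exp (ζ * L x)‖ ≤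
      ‖G x‖ + ‖G x‖ * Real.exp (L x) := fun ζ hζ0 hζ1 x => by
    rw [norm_mul_cexp, ← mul_one_add]
    exact mul_le_mul_of_nonneg_left (exp_mul_le_one_add hζ0 hζ1) (norm_nonneg _)
  have hint : ∀ ζ : ℂ, 0 ≤ ζ.re → ζ.re ≤ 1 → Integrable (fun x => G x * Complex.exp (ζ * L x)) m :=
    fun ζ hζ0 hζ1 => (h0.norm.add h2).mono' (hmeas ζ) (Eventually.of_forall (hbd ζ hζ0 hζ1))
  have hlines : ∀ t : ℝ, 0 ≤ t → t ≤ 1 → ‖F t‖ ≤ M₀ ^ (1 - t) * M₁ ^ t := by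
    intro t ht0 ht1
    have := Complex.HadamardThreeLines.norm_le_interp_of_mem_verticalClosedStrip₀₁' F (z := (t : ℂ))
      (a := M₀) (b := M₁) ⟨by simpa using ht0, by simpa using ht1⟩
      (diffContOnCl_laplace hG hL h0 h1 h2) ?_ (fun z hz => hb0 z hz) (fun z hz => hb1 z hz)
    · simpa using this
    · refine ⟨∫ x, (‖G x‖ + ‖G x‖ * Real.exp (L x)) ∂m, ?_⟩
      rintro _ ⟨z, hz, rfl⟩
      exact norm_integral_le_of_norm_le (h0.norm.add h2) (Eventually.of_forall (hbd z hz.1 hz.2))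
  have hF0 : F 0 = M₀ := by simp [hF, heq]
  have hsub : ∀ t : ℝ, 0 < t → t ≤ 1 → (F t - F 0) / t =
      ∫ x, G x * (((Real.exp (t * L x) - 1) / t : ℝ) : ℂ) ∂m := by
    intro t ht0 ht1
    rw [hF, ← integral_sub (hint _ (by simpa using ht0.le) (by simpa using ht1))
      (hint _ (by simp) (by simp)), ← integral_div]
    congr 1
    ext x
    push_cast
    rw [zero_mul, Complex.exp_zero]
    ring
  have hlim1 : Tendsto (fun t : ℝ => ∫ x, G x * (((Real.exp (t * L x) - 1) / t : ℝ) : ℂ) ∂m)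
      (𝓝[>] 0) (𝓝 (∫ x, G x * L x ∂m)) := by
    refine tendsto_integral_filter_of_dominated_convergence
      (fun x => ‖G x‖ * |L x| + ‖G x‖ * Real.exp (L x)) ?_ ?_ (h1.add h2) ?_
    · refine Eventually.of_forall fun t => hG.mul ?_
      have : AEMeasurable (fun x => (Real.exp (t * L x) - 1) / t) m :=
        ((Real.measurable_exp.comp_aemeasurable (hL.const_mul t)).sub_const 1).div_const t
      exact this.complex_ofReal.aestronglyMeasurable
    · filter_upwards [Ioc_mem_nhdsGT zero_lt_one] with t ht
      refine Eventually.of_forall fun x => ?_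
      rw [norm_mul, Complex.norm_real, Real.norm_eq_abs, ← mul_add]
      exact mul_le_mul_of_nonneg_left (abs_exp_mul_sub_one_div_le ht.1 ht.2) (norm_nonneg _)
    · refine Eventually.of_forall fun x => ?_
      have hd : HasDerivAt (fun t : ℝ => Real.exp (t * L x)) (L x) 0 := by
        have e1 : HasDerivAt (fun t : ℝ => t * L x) (L x) 0 := by
          simpa using (hasDerivAt_id (0 : ℝ)).mul_const (L x)
        simpa using e1.exp
      have := hd.tendsto_slope_zero_right
      refine Tendsto.const_mul _ ((Complex.continuous_ofReal.tendsto _).comp ?_)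
      refine this.congr fun t => ?_
      simp [div_eq_inv_mul]
  have hlim2 : Tendsto (fun t : ℝ => (M₀ ^ (1 - t) * M₁ ^ t - M₀) / t) (𝓝[>] 0)
      (𝓝 (M₀ * Real.log (M₁ / M₀))) := by
    have hd : HasDerivAt (fun t : ℝ => M₀ ^ (1 - t) * M₁ ^ t) (M₀ * Real.log (M₁ / M₀)) 0 := by
      have e1 : HasDerivAt (fun t : ℝ => M₀ * Real.exp (t * Real.log (M₁ / M₀)))
          (M₀ * Real.log (M₁ / M₀)) 0 := by
        have e2 : HasDerivAt (fun t : ℝ => t * Real.log (M₁ / M₀)) (Real.log (M₁ / M₀)) 0 := by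
          simpa using (hasDerivAt_id (0 : ℝ)).mul_const (Real.log (M₁ / M₀))
        simpa using e2.exp.const_mul M₀
      refine e1.congr_of_eventuallyEq (Eventually.of_forall fun t => ?_)
      simp only
      rw [mul_comm t, ← Real.rpow_def_of_pos (by positivity), Real.div_rpow hM₁.le hM₀.le,
        Real.rpow_sub hM₀, Real.rpow_one]
      ring
    have := hd.tendsto_slope_zero_right
    refine this.congr fun t => ?_
    simp [div_eq_inv_mul]
  -- The interpolation bound and `F` agree at `t = 0`, so the inequality for `0 < t ≤ 1` passes to
  -- difference quotients and then to right derivatives.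
  refine le_of_tendsto_of_tendsto ((Complex.continuous_re.tendsto _).comp hlim1) hlim2 ?_
  filter_upwards [Ioc_mem_nhdsGT zero_lt_one] with t ht
  simp only [Function.comp]
  rw [← hsub t ht.1 ht.2, Complex.div_ofReal_re]
  have ht0 : 0 < t := ht.1
  gcongr
  rw [hF0, Complex.sub_re, Complex.ofReal_re]
  have := (Complex.re_le_norm (F t)).trans (hlines t ht.1.le ht.2)
  linarith

end laplace

/-! ### The energy-entropy inequality for fixed points of small growth -/

/-- The square leaves room for all modifications of `f` that occur: logarithmic factors and powers
`|f|^θ` with `0 ≤ θ ≤ 2`. -/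
lemma SubgaussianGrowth.of_le {f g : ℂ → ℂ} (hf : SubgaussianGrowth f) (c : ℝ)
    (h : ∀ z, ‖g z‖ ≤ c * (1 + ‖f z‖) ^ 2) : SubgaussianGrowth g := by
  intro e he
  obtain ⟨C, hC, hle⟩ := hf (e / 2) (by positivity)
  refine ⟨|c| * (1 + C) ^ 2 + 1, by positivity, fun z => (h z).trans ?_⟩
  have h1 : 1 ≤ Real.exp (e / 2 * ‖z‖ ^ 2) := Real.one_le_exp (by positivity)
  have h2 : 1 + ‖f z‖ ≤ (1 + C) * Real.exp (e / 2 * ‖z‖ ^ 2) := by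
    have := hle z
    linarith
  calc c * (1 + ‖f z‖) ^ 2 ≤ |c| * ((1 + C) * Real.exp (e / 2 * ‖z‖ ^ 2)) ^ 2 := by
        gcongr
        exact le_abs_self c
    _ = |c| * (1 + C) ^ 2 * Real.exp (e * ‖z‖ ^ 2) := by
        rw [mul_pow, ← Real.exp_nat_mul]
        push_cast
        rw [show 2 * (e / 2 * ‖z‖ ^ 2) = e * ‖z‖ ^ 2 by ring]
        ring
    _ ≤ _ := by
        gcongr
        linarith

lemma SubgaussianGrowth.add {f g : ℂ → ℂ} (hf : SubgaussianGrowth f) (hg : SubgaussianGrowth g) :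
    SubgaussianGrowth fun z => f z + g z := by
  intro e he
  obtain ⟨C, hC, h⟩ := hf e he
  obtain ⟨D, hD, h'⟩ := hg e he
  refine ⟨C + D, by positivity, fun z => ?_⟩
  have := norm_add_le (f z) (g z)
  have := h z
  have := h' z
  linarith

lemma SubgaussianGrowth.mul {f g : ℂ → ℂ} (hf : SubgaussianGrowth f) (hg : SubgaussianGrowth g) :
    SubgaussianGrowth fun z => f z * g z := by
  intro e he
  obtain ⟨C, hC, h⟩ := hf (e / 2) (by positivity)
  obtain ⟨D, hD, h'⟩ := hg (e / 2) (by positivity)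
  refine ⟨C * D, by positivity, fun z => ?_⟩
  rw [norm_mul]
  calc _ ≤ (C * Real.exp (e / 2 * ‖z‖ ^ 2)) * (D * Real.exp (e / 2 * ‖z‖ ^ 2)) := by
        gcongr
        exacts [h z, h' z]
    _ = C * D * (Real.exp (e / 2 * ‖z‖ ^ 2) * Real.exp (e / 2 * ‖z‖ ^ 2)) := by ring
    _ = _ := by rw [← Real.exp_add]; ring_nf

lemma subgaussianGrowth_const_mul_norm_sq (c : ℝ) :
    SubgaussianGrowth fun z => ((c * ‖z‖ ^ 2 : ℝ) : ℂ) := by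
  intro e he
  obtain ⟨C, hC, h⟩ := exists_pow_le_exp he 2
  refine ⟨(|c| + 1) * C, by positivity, fun z => ?_⟩
  rw [Complex.norm_real, Real.norm_eq_abs, abs_mul, abs_of_nonneg (by positivity : 0 ≤ ‖z‖ ^ 2)]
  calc _ ≤ (|c| + 1) * (C * Real.exp (e * ‖z‖ ^ 2)) := by
        gcongr
        · linarith
        · exact h _ (norm_nonneg z)
    _ = _ := by ring

lemma mul_abs_log_sq_le {x : ℝ} (hx : 0 ≤ x) : x * |Real.log (x ^ 2)| ≤ 2 * (1 + x) ^ 2 := by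
  rw [Real.log_pow]
  push_cast
  rw [abs_mul, abs_two]
  rcases hx.eq_or_lt with rfl | hx
  · norm_num
  rcases le_total x 1 with h | h
  · have := Real.abs_log_mul_self_lt x hx h
    rw [abs_mul, abs_of_pos hx] at this
    nlinarith
  · rw [abs_of_nonneg (Real.log_nonneg h)]
    have := Real.log_le_sub_one_of_pos hx
    nlinarith

lemma mul_exp_mul_log_sq {x y : ℝ} (hx : 0 < x) :
    x * Real.exp (y * Real.log (x ^ 2)) = x ^ (1 + 2 * y) := by
  rw [Real.rpow_add hx, Real.rpow_one, Real.log_pow, Real.rpow_def_of_pos hx]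
  congr 2
  push_cast
  ring

/-- Only an inequality at `x = 0`: the left side is `0`, while the right side is `0 ^ 0 = 1` for `y
= -1/2`. That exponent arises for `p = ∞` and for `q = 1`. -/
lemma mul_exp_mul_log_sq_le_rpow {x y : ℝ} (hx : 0 ≤ x) :
    x * Real.exp (y * Real.log (x ^ 2)) ≤ x ^ (1 + 2 * y) := by
  rcases hx.eq_or_lt with rfl | hx
  · rw [zero_mul]; exact Real.rpow_nonneg le_rfl _
  · exact (mul_exp_mul_log_sq hx).le

lemma mul_exp_mul_log_sq_le {x y : ℝ} (hx : 0 ≤ x) (h0 : -(1 / 2) ≤ y) (h1 : y ≤ 1 / 2) :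
    x * Real.exp (y * Real.log (x ^ 2)) ≤ (1 + x) ^ 2 := by
  refine (mul_exp_mul_log_sq_le_rpow hx).trans ?_
  calc x ^ (1 + 2 * y) ≤ (1 + x) ^ (1 + 2 * y) :=
        Real.rpow_le_rpow hx (by linarith) (by linarith)
    _ ≤ (1 + x) ^ (2 : ℝ) := Real.rpow_le_rpow_of_exponent_le (by linarith) (by linarith)
    _ = _ := Real.rpow_two _

lemma kernel_star (s : Parity) {μ : ℝ} (hμ : -(1 / 2) < μ) (z w : ℂ) :
    star (kernel s μ z w) = kernel s μ w z := by
  have h := (hasSum_kernel s hμ z w).star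
  refine h.unique ((hasSum_kernel s hμ w z).congr_fun fun k => ?_)
  rw [star_mul', star_pow, star_mul', star_star]
  simp [mul_comm]

lemma integrable_kernel_mul_mul (s : Parity) {μ : ℝ} (hμ : -(1 / 2) < μ) {h g : ℂ → ℂ} {l : ℝ}
    (hl : 1 < l) (hh : AEStronglyMeasurable h (nu s μ)) (hg : AEStronglyMeasurable g (nu s μ))
    (hhb : Integrable (fun z => Real.exp (l⁻¹ * ‖z‖ ^ 2) * ‖h z‖) (nu s μ))
    (hgb : Integrable (fun z => Real.exp (l ^ 3 / 4 * ‖z‖ ^ 2) * ‖g z‖) (nu s μ)) :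
    Integrable (fun x : ℂ × ℂ => kernel s μ x.1 x.2 * h x.1 * g x.2) ((nu s μ).prod (nu s μ)) := by
  have : Fact (-(1 / 2) < μ) := ⟨hμ⟩
  obtain ⟨C, hC, hle⟩ := exists_kernelCoeff_sum_le_gaussian s hμ hl (b := l⁻¹) (by positivity)
  refine ((hhb.mul_prod hgb).const_mul C).mono' ?_ (Eventually.of_forall fun x => ?_)
  · exact ((continuous_kernel s hμ).aestronglyMeasurable.mul hh.comp_fst).mul hg.comp_snd
  · rw [norm_mul, norm_mul]
    have e : l ^ 2 / (4 * l⁻¹) = l ^ 3 / 4 := by field_simp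
    have := (norm_kernel_le s hμ x.1 x.2).trans (hle x.1 x.2)
    rw [e] at this
    calc _ ≤ (C * (Real.exp (l⁻¹ * ‖x.1‖ ^ 2) * Real.exp (l ^ 3 / 4 * ‖x.2‖ ^ 2))) *
          ‖h x.1‖ * ‖g x.2‖ := by gcongr
      _ = _ := by ring

lemma eLpNorm_norm_rpow_le {Ω : Type*} [MeasurableSpace Ω] {ν : Measure Ω} {f : Ω → ℂ}
    (hf : MemLp f 2 ν) {r : ℝ≥0∞} (hr : 1 ≤ r) :
    eLpNorm (fun x => ‖f x‖ ^ (2 * (r⁻¹).toReal)) r ν ≤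
      ENNReal.ofReal ((∫ x, ‖f x‖ ^ 2 ∂ν) ^ (r⁻¹).toReal) := by
  have hr0 : r ≠ 0 := (zero_lt_one.trans_le hr).ne'
  by_cases hr_top : r = ∞
  · subst hr_top
    simp only [ENNReal.inv_top, ENNReal.toReal_zero, mul_zero, Real.rpow_zero, ENNReal.ofReal_one,
      eLpNorm_exponent_top]
    refine (eLpNormEssSup_le_of_ae_bound (C := 1) (Eventually.of_forall fun x => by simp)).trans ?_
    simp
  · have h1 : 0 < r.toReal := ENNReal.toReal_pos hr0 hr_top
    rw [ENNReal.toReal_inv, eLpNorm_norm_rpow _ (by positivity)]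
    have e : r * ENNReal.ofReal (2 * r.toReal⁻¹) = 2 := by
      rw [ENNReal.ofReal_mul (by norm_num), ENNReal.ofReal_inv_of_pos h1, ENNReal.ofReal_toReal hr_top]
      simp only [ENNReal.ofReal_ofNat]
      rw [mul_left_comm, ENNReal.mul_inv_cancel hr0 hr_top, mul_one]
    rw [e, ← norm_toLp_sq hf, ← Real.rpow_natCast, ← Real.rpow_mul ENNReal.toReal_nonneg,
      ← ENNReal.ofReal_rpow_of_nonneg ENNReal.toReal_nonneg (by positivity),
      ENNReal.ofReal_toReal hf.2.ne]
    rfl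

lemma eLpNorm_nuWeighted (s : Parity) (μ a : ℝ) {q : ℝ≥0∞} (hq0 : q ≠ 0) (hq : q ≠ ∞) (f : ℂ → ℂ)
    (hf : Continuous f) :
    eLpNorm f q (nuWeighted s μ a) =
      eLpNorm (fun w => Real.exp (-(a / q.toReal) * ‖w‖ ^ 2) * ‖f w‖) q (nu s μ) := by
  have hq' : 0 < q.toReal := ENNReal.toReal_pos hq0 hq
  rw [eLpNorm_eq_lintegral_rpow_enorm_toReal hq0 hq, eLpNorm_eq_lintegral_rpow_enorm_toReal hq0 hq,
    nuWeighted, lintegral_withDensity_eq_lintegral_mul _ (by fun_prop) (by fun_prop)]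
  congr 1
  refine lintegral_congr fun w => ?_
  simp only [Pi.mul_apply]
  rw [enorm_mul, ENNReal.mul_rpow_of_nonneg _ _ hq'.le, enorm_norm]
  congr 1
  rw [Real.enorm_of_nonneg (Real.exp_pos _).le,
    ENNReal.ofReal_rpow_of_nonneg (Real.exp_pos _).le hq'.le, ← Real.exp_mul]
  congr 2
  field_simp

/-- The bound on the line `Re ζ = 1`. Moving the Gaussian from `g` onto the transform turns the
`L^q` norm into the weighted one, and Hölder with `q` and its conjugate applies. The powers of `|f|`
are chosen so that their norms are powers of `‖f‖²`. -/
lemma norm_integral_transform_mul_le_weighted (s : Parity) {μ : ℝ} (hμ : -(1 / 2) < μ)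
    {p q : ℝ≥0∞} (hp : 1 < p) (hq : 1 ≤ q) (hq_top : q < ∞) {a A : ℝ} (hA0 : 0 ≤ A)
    (hA : ∀ h : ℂ → ℂ, MemLp h p (nu s μ) →
      eLpNorm (transform s μ h) q (nuWeighted s μ a) ≤ ENNReal.ofReal A * eLpNorm h p (nu s μ))
    {f h g : ℂ → ℂ} (hf : MemLp f 2 (nu s μ)) (hhm : AEStronglyMeasurable h (nu s μ))
    (hhb : Integrable (fun z => Real.exp (1 / 2 * ‖z‖ ^ 2) * ‖h z‖) (nu s μ))
    (hh : ∀ z, ‖h z‖ ≤ ‖f z‖ ^ (2 * (p⁻¹).toReal))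
    (hg : ∀ z, ‖g z‖ ≤ Real.exp (-(a / q.toReal) * ‖z‖ ^ 2) * ‖f z‖ ^ (2 * (1 - (q⁻¹).toReal))) :
    ‖∫ w, transform s μ h w * g w ∂(nu s μ)‖ ≤
      A * (∫ z, ‖f z‖ ^ 2 ∂(nu s μ)) ^ (1 + (p⁻¹).toReal - (q⁻¹).toReal) := by
  -- Without integrability the Bochner integral is `0` and the bound is trivial.
  by_cases hint : Integrable (fun w => transform s μ h w * g w) (nu s μ)
  swap
  · rw [integral_undef hint, norm_zero]
    have : 0 ≤ ∫ z, ‖f z‖ ^ 2 ∂(nu s μ) := integral_nonneg fun z => by positivity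
    positivity
  have hq0 : q ≠ 0 := (zero_lt_one.trans_le hq).ne'
  set r := ENNReal.conjExponent q with hr
  have i1 : ENNReal.HolderConjugate q r := ENNReal.HolderConjugate.conjExponent hq
  have hr1 : 1 ≤ r := by
    have : ENNReal.HolderConjugate r q := ENNReal.HolderConjugate.symm
    exact ENNReal.HolderConjugate.one_le r q
  have hQ : (r⁻¹).toReal = 1 - (q⁻¹).toReal := by
    have h1 := ENNReal.HolderConjugate.inv_add_inv_eq_one q r
    have h2 := congrArg ENNReal.toReal h1
    rw [ENNReal.toReal_add (ENNReal.inv_ne_top.2 hq0)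
      (ENNReal.inv_ne_top.2 (zero_lt_one.trans_le hr1).ne'), ENNReal.toReal_one] at h2
    linarith
  set N := ∫ z, ‖f z‖ ^ 2 ∂(nu s μ) with hN
  have hN0 : 0 ≤ N := integral_nonneg fun z => by positivity
  have hp_le : eLpNorm h p (nu s μ) ≤ ENNReal.ofReal (N ^ (p⁻¹).toReal) := by
    refine le_trans ?_ (eLpNorm_norm_rpow_le hf hp.le)
    refine eLpNorm_mono fun z => (hh z).trans (le_abs_self _)
  have hhL : MemLp h p (nu s μ) := ⟨hhm, hp_le.trans_lt ENNReal.ofReal_lt_top⟩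
  have hTd := differentiable_transform hμ (by norm_num) hhm hhb
  set u : ℂ → ℝ := fun w => Real.exp (-(a / q.toReal) * ‖w‖ ^ 2) * ‖transform s μ h w‖ with hu
  set v : ℂ → ℝ := fun w => ‖f w‖ ^ (2 * (r⁻¹).toReal) with hv
  have huc : Continuous u := by
    have := hTd.continuous
    fun_prop
  have hvm : AEStronglyMeasurable v (nu s μ) :=
    (hf.1.norm.aemeasurable.pow_const _).aestronglyMeasurable
  have hold := eLpNorm_smul_le_mul_eLpNorm (p := q) (q := r) (r := 1) (μ := nu s μ) hvm
    huc.aestronglyMeasurable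
  have hu_le : eLpNorm u q (nu s μ) ≤ ENNReal.ofReal A * ENNReal.ofReal (N ^ (p⁻¹).toReal) := by
    rw [hu, ← eLpNorm_nuWeighted s μ a hq0 hq_top.ne _ hTd.continuous]
    exact (hA h hhL).trans (by gcongr)
  have hv_le : eLpNorm v r (nu s μ) ≤ ENNReal.ofReal (N ^ (r⁻¹).toReal) :=
    eLpNorm_norm_rpow_le hf hr1
  have hmain : ENNReal.ofReal ‖∫ w, transform s μ h w * g w ∂(nu s μ)‖ ≤
      ENNReal.ofReal (A * N ^ (p⁻¹).toReal * N ^ (r⁻¹).toReal) := by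
    rw [ENNReal.ofReal_mul (by positivity), ENNReal.ofReal_mul hA0, ofReal_norm]
    calc _ ≤ ∫⁻ w, ‖transform s μ h w * g w‖ₑ ∂(nu s μ) := enorm_integral_le_lintegral_enorm _
      _ ≤ ∫⁻ w, ‖(u • v) w‖ₑ ∂(nu s μ) := by
        refine lintegral_mono fun w => ?_
        rw [enorm_le_iff_norm_le]
        rw [norm_mul, Pi.smul_apply', smul_eq_mul, norm_mul, hu, hv, hQ]
        simp only [norm_mul, Real.norm_eq_abs, Real.abs_exp, abs_norm]
        rw [abs_of_nonneg (Real.rpow_nonneg (norm_nonneg _) _)]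
        calc _ ≤ ‖transform s μ h w‖ * (Real.exp (-(a / q.toReal) * ‖w‖ ^ 2) *
              ‖f w‖ ^ (2 * (1 - (q⁻¹).toReal))) := by gcongr; exact hg w
          _ = _ := by ring
      _ = eLpNorm (u • v) 1 (nu s μ) := eLpNorm_one_eq_lintegral_enorm.symm
      _ ≤ _ := hold.trans (by gcongr)
  rw [ENNReal.ofReal_le_ofReal_iff (by positivity)] at hmain
  refine hmain.trans ?_
  rw [mul_assoc, hQ]
  refine mul_le_mul_of_nonneg_left ?_ hA0
  -- At `N = 0` the exponent law is unavailable. By `0 ^ 0 = 1` the left side is nonzero only if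
  -- both exponents vanish, and then both sides are `1`.
  rcases hN0.eq_or_lt with h0 | h0
  · rw [← h0]
    have hP : 0 ≤ (p⁻¹).toReal := ENNReal.toReal_nonneg
    have hR : 0 ≤ 1 - (q⁻¹).toReal := by rw [← hQ]; exact ENNReal.toReal_nonneg
    rcases hP.eq_or_lt with h1 | h1
    · rcases hR.eq_or_lt with h2 | h2
      · rw [show 1 + (p⁻¹).toReal - (q⁻¹).toReal = 0 by linarith, ← h1, ← h2]
        simp
      · rw [Real.zero_rpow h2.ne', mul_zero]; positivity
    · rw [Real.zero_rpow h1.ne', zero_mul]; positivity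
  · rw [← Real.rpow_add h0]
    exact le_of_eq (by ring_nf)

set_option maxHeartbeats 1000000 in
/-- The energy-entropy inequality for fixed points of the transform of small growth. -/
lemma energyEntropy_of_fixed (s : Parity) {μ : ℝ} (hμ : -(1 / 2) < μ)
    {p q : ℝ≥0∞} (hp : 1 < p) (hq : 1 ≤ q) (hq_top : q < ∞) {a A : ℝ} (hA0 : 0 < A)
    (ha : -(3 / 4) < a / q.toReal)
    (hA : ∀ h : ℂ → ℂ, MemLp h p (nu s μ) →
      eLpNorm (transform s μ h) q (nuWeighted s μ a) ≤ ENNReal.ofReal A * eLpNorm h p (nu s μ))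
    {f : ℂ → ℂ} (hfc : Continuous f) (hfg : SubgaussianGrowth f) (hT : transform s μ f = f)
    (hN : 0 < ∫ z, ‖f z‖ ^ 2 ∂(nu s μ)) :
    ((p⁻¹).toReal - (q⁻¹).toReal) * (∫ z, ‖f z‖ ^ 2 * Real.log (‖f z‖ ^ 2) ∂(nu s μ) -
        (∫ z, ‖f z‖ ^ 2 ∂(nu s μ)) * Real.log (∫ z, ‖f z‖ ^ 2 ∂(nu s μ))) ≤
      Real.log A * ∫ z, ‖f z‖ ^ 2 ∂(nu s μ) +
        a / q.toReal * ∫ z, ‖z‖ ^ 2 * ‖f z‖ ^ 2 ∂(nu s μ) := by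
  have : Fact (-(1 / 2) < μ) := ⟨hμ⟩
  set ν := nu s μ with hν
  set N := ∫ z, ‖f z‖ ^ 2 ∂ν with hNdef
  set P := (p⁻¹).toReal with hP
  set Q := (q⁻¹).toReal with hQ
  set κ := a / q.toReal with hκ
  have hP0 : 0 ≤ P := ENNReal.toReal_nonneg
  have hP1 : P ≤ 1 := by
    rw [hP, ← ENNReal.toReal_one]
    exact ENNReal.toReal_mono ENNReal.one_ne_top (ENNReal.inv_le_one.2 hp.le)
  have hQ0 : 0 ≤ Q := ENNReal.toReal_nonneg
  have hQ1 : Q ≤ 1 := by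
    rw [hQ, ← ENNReal.toReal_one]
    exact ENNReal.toReal_mono ENNReal.one_ne_top (ENNReal.inv_le_one.2 hq)
  -- Multiplying `f` by `|f|^{2x₁}` and `conj f` by `|f|^{2x₂}` gives the moduli `|f|^{2P}` and
  -- `|f|^{2(1-Q)}` to which the `L^p`-`L^q` bound applies.
  set x₁ := P - 1 / 2 with hx₁
  set x₂ := 1 / 2 - Q with hx₂
  set ℓ : ℂ → ℝ := fun z => Real.log (‖f z‖ ^ 2) with hℓ
  set L₂ : ℂ → ℝ := fun w => x₂ * ℓ w - κ * ‖w‖ ^ 2 with hL₂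
  have hℓm : Measurable ℓ := by
    have := hfc.measurable
    fun_prop
  have hL₂m : Measurable L₂ := by fun_prop
  have hfm : Measurable f := hfc.measurable
  set G : ℂ × ℂ → ℂ := fun x => kernel s μ x.1 x.2 * f x.1 * star (f x.2) with hG
  set L : ℂ × ℂ → ℝ := fun x => x₁ * ℓ x.1 + L₂ x.2 with hL
  -- With `b = 1/l` the kernel costs `e^{l³|w|²/4}` in `w`. The weight at `Re ζ = 1` changes this
  -- exponent by `-κ`, and both exponents must stay below `1`; this is where `κ > -3/4` enters.
  obtain ⟨l, hl, hl'⟩ : ∃ l : ℝ, 1 < l ∧ l ^ 3 * (1 / 4) < min 1 (1 + κ) :=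
    exists_one_lt_cube_mul_lt (lt_min (by norm_num) (by linarith))
  have hl1 : l ^ 3 / 4 < 1 := by have := min_le_left 1 (1 + κ); linarith
  have hl2 : l ^ 3 / 4 - κ < 1 := by have := min_le_right 1 (1 + κ); linarith
  have hlinv : l⁻¹ < 1 := inv_lt_one_of_one_lt₀ hl
  -- growth of the factors
  have gstar : SubgaussianGrowth fun z => star (f z) := hfg.of_le 1 fun z => by
    rw [norm_star]; nlinarith [norm_nonneg (f z)]
  have gℓ : SubgaussianGrowth fun z => f z * (ℓ z : ℂ) := hfg.of_le 2 fun z => by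
    rw [norm_mul, Complex.norm_real, Real.norm_eq_abs]
    exact mul_abs_log_sq_le (norm_nonneg _)
  have gstarℓ : SubgaussianGrowth fun z => star (f z) * (ℓ z : ℂ) := hfg.of_le 2 fun z => by
    rw [norm_mul, norm_star, Complex.norm_real, Real.norm_eq_abs]
    exact mul_abs_log_sq_le (norm_nonneg _)
  have gL₂ : SubgaussianGrowth fun z => star (f z) * (L₂ z : ℂ) := by
    have h1 := ((subgaussianGrowth_const_mul_norm_sq (-κ)).mul gstar).add
      (gstarℓ.of_le 1 (g := fun z => x₂ * (star (f z) * (ℓ z : ℂ))) fun z => by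
        rw [norm_mul, Complex.norm_real, Real.norm_eq_abs]
        have : |x₂| ≤ 1 := by rw [abs_le]; constructor <;> linarith
        nlinarith [norm_nonneg (star (f z) * (ℓ z : ℂ))])
    convert! h1 using 2 with z
    simp only [hL₂]
    push_cast
    ring
  have ge1 : ∀ ζ : ℂ, 0 ≤ ζ.re → ζ.re ≤ 1 →
      SubgaussianGrowth fun z => f z * Complex.exp (ζ * ((x₁ * ℓ z : ℝ) : ℂ)) := fun ζ h0 h1 =>
    hfg.of_le 1 fun z => by
      rw [norm_mul_cexp, one_mul, ← mul_assoc]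
      exact mul_exp_mul_log_sq_le (norm_nonneg _) (by nlinarith) (by nlinarith)
  have ge2 : SubgaussianGrowth fun z => star (f z) * Complex.exp ((x₂ * ℓ z : ℝ) : ℂ) :=
    hfg.of_le 1 fun z => by
      have := norm_mul_cexp (star (f z)) 1 (x₂ * ℓ z)
      rw [one_mul] at this
      rw [this, norm_star, one_mul, Complex.one_re, one_mul]
      exact mul_exp_mul_log_sq_le (norm_nonneg _) (by linarith) (by linarith)
  have me1 : ∀ ζ : ℂ, Measurable fun z => f z * Complex.exp (ζ * ((x₁ * ℓ z : ℝ) : ℂ)) :=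
    fun ζ => by fun_prop
  have me2 : ∀ ζ : ℂ, Measurable fun z => star (f z) * Complex.exp (ζ * (L₂ z : ℂ)) :=
    fun ζ => by fun_prop
  have bd {g : ℂ → ℂ} (hg : SubgaussianGrowth g) (hgm : Measurable g) {b : ℝ} (hb : b < 1) :
      Integrable (fun z => Real.exp (b * ‖z‖ ^ 2) * ‖g z‖) ν :=
    integrable_exp_mul_norm_of_growth s hμ hb hgm.aestronglyMeasurable hg
  -- Inside the strip `e^{tL₂} ≤ 1 + e^{L₂}` reduces integrability to the two boundary lines.
  have be2 : ∀ ζ : ℂ, 0 ≤ ζ.re → ζ.re ≤ 1 → Integrable (fun z => Real.exp (l ^ 3 / 4 * ‖z‖ ^ 2) *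
      ‖star (f z) * Complex.exp (ζ * (L₂ z : ℂ))‖) ν := fun ζ h0 h1 => by
    have b1 := bd ge2 (by fun_prop) hl2
    have b0 := bd gstar (by fun_prop) hl1
    refine (b0.add b1).mono' (by fun_prop) (Eventually.of_forall fun z => ?_)
    rw [norm_mul, norm_norm, norm_mul_cexp, Real.norm_of_nonneg (Real.exp_pos _).le]
    have := norm_mul_cexp (star (f z)) 1 (x₂ * ℓ z)
    rw [one_mul, Complex.one_re, one_mul] at this
    simp only [Pi.add_apply]
    rw [this]
    calc _ ≤ Real.exp (l ^ 3 / 4 * ‖z‖ ^ 2) * (‖star (f z)‖ * (1 + Real.exp (L₂ z))) := by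
          gcongr; exact exp_mul_le_one_add h0 h1
      _ = Real.exp (l ^ 3 / 4 * ‖z‖ ^ 2) * ‖star (f z)‖ + (Real.exp (l ^ 3 / 4 * ‖z‖ ^ 2) *
          Real.exp (L₂ z)) * ‖star (f z)‖ := by ring
      _ = Real.exp (l ^ 3 / 4 * ‖z‖ ^ 2) * ‖star (f z)‖ + (Real.exp ((l ^ 3 / 4 - κ) * ‖z‖ ^ 2) *
          Real.exp (x₂ * ℓ z)) * ‖star (f z)‖ := by
          rw [← Real.exp_add, ← Real.exp_add]
          simp only [hL₂]
          ring_nf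
      _ = _ := by ring
  -- integrability
  have iker {h g : ℂ → ℂ} (hh : SubgaussianGrowth h) (hhm : Measurable h) (hgm : Measurable g)
      (hg : Integrable (fun z => Real.exp (l ^ 3 / 4 * ‖z‖ ^ 2) * ‖g z‖) ν) :
      Integrable (fun x : ℂ × ℂ => kernel s μ x.1 x.2 * h x.1 * g x.2) (ν.prod ν) :=
    integrable_kernel_mul_mul s hμ hl hhm.aestronglyMeasurable hgm.aestronglyMeasurable
      (bd hh hhm hlinv) hg
  have iG : Integrable G (ν.prod ν) := iker hfg hfm (by fun_prop) (bd gstar (by fun_prop) hl1)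
  have iGℓ := iker gℓ (by fun_prop) (by fun_prop) (bd gstar (by fun_prop) hl1)
  have iGL₂ := iker hfg hfm (by fun_prop) (bd gL₂ (by fun_prop) hl1)
  have hGexp : ∀ ζ : ℂ, ∀ x : ℂ × ℂ, G x * Complex.exp (ζ * L x) =
      kernel s μ x.1 x.2 * (f x.1 * Complex.exp (ζ * ((x₁ * ℓ x.1 : ℝ) : ℂ))) *
        (star (f x.2) * Complex.exp (ζ * (L₂ x.2 : ℂ))) := fun ζ x => by
    simp only [hG, hL]
    rw [Complex.ofReal_add, mul_add, Complex.exp_add]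
    ring
  have iGe : ∀ ζ : ℂ, 0 ≤ ζ.re → ζ.re ≤ 1 →
      Integrable (fun x => G x * Complex.exp (ζ * L x)) (ν.prod ν) := fun ζ h0 h1 => by
    simp only [hGexp]
    exact iker (h := fun z => f z * Complex.exp (ζ * ((x₁ * ℓ z : ℝ) : ℂ)))
      (g := fun w => star (f w) * Complex.exp (ζ * (L₂ w : ℂ))) (ge1 ζ h0 h1) (me1 ζ) (me2 ζ)
      (be2 ζ h0 h1)
  have hGL : ∀ x : ℂ × ℂ, G x * L x =
      x₁ * (kernel s μ x.1 x.2 * (f x.1 * ℓ x.1) * star (f x.2)) +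
        kernel s μ x.1 x.2 * f x.1 * (star (f x.2) * L₂ x.2) := fun x => by
    simp only [hG, hL]
    push_cast
    ring
  have iGL : Integrable (fun x => G x * L x) (ν.prod ν) := by
    simp only [hGL]
    exact (iGℓ.const_mul _).add iGL₂
  have fub : ∀ h g : ℂ → ℂ,
      Integrable (fun x : ℂ × ℂ => kernel s μ x.1 x.2 * h x.1 * g x.2) (ν.prod ν) →
      ∫ x, kernel s μ x.1 x.2 * h x.1 * g x.2 ∂(ν.prod ν) = ∫ w, transform s μ h w * g w ∂ν := by
    intro h g hi
    rw [integral_prod_symm _ hi]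
    refine integral_congr_ae (Eventually.of_forall fun w => ?_)
    simp only
    rw [integral_mul_const, transform]
  have hFζ : ∀ ζ : ℂ, 0 ≤ ζ.re → ζ.re ≤ 1 → ∫ x, G x * Complex.exp (ζ * L x) ∂(ν.prod ν) =
      ∫ w, transform s μ (fun z => f z * Complex.exp (ζ * ((x₁ * ℓ z : ℝ) : ℂ))) w *
        (star (f w) * Complex.exp (ζ * (L₂ w : ℂ))) ∂ν := fun ζ h0 h1 => by
    have := iGe ζ h0 h1
    simp only [hGexp] at this ⊢
    exact fub (fun z => f z * Complex.exp (ζ * ((x₁ * ℓ z : ℝ) : ℂ)))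
      (fun w => star (f w) * Complex.exp (ζ * (L₂ w : ℂ))) this
  have hsq : ∀ z, f z * star (f z) = ((‖f z‖ ^ 2 : ℝ) : ℂ) := fun z => by
    push_cast
    exact Complex.mul_conj' (f z)
  have mf : MemLp f 2 ν := hfg.memLp s hμ hfm.aestronglyMeasurable (by norm_num) (by norm_num)
  have key := re_integral_mul_le_of_three_lines (m := ν.prod ν) (G := G) (L := L) (M₀ := N)
    (M₁ := A * N ^ (1 + P - Q)) iG.1 (by fun_prop) iG ?_ ?_ hN (by positivity) ?_ ?_ ?_
  · -- evaluation of the first variation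
    have e1 : ∫ x, G x * L x ∂(ν.prod ν) =
        x₁ * ((∫ z, ‖f z‖ ^ 2 * ℓ z ∂ν : ℝ) : ℂ) + ((∫ z, ‖f z‖ ^ 2 * L₂ z ∂ν : ℝ) : ℂ) := by
      simp only [hGL]
      rw [integral_add (iGℓ.const_mul _) iGL₂, integral_const_mul, fub f (fun z => star (f z) * (L₂ z : ℂ)) iGL₂, hT,
        integral_prod _ iGℓ]
      congr 2
      · rw [← integral_complex_ofReal]
        refine integral_congr_ae (Eventually.of_forall fun z => ?_)
        simp only
        -- The logarithm sits in the variable `z`, so `w` is integrated first. Hermitian symmetry of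
        -- the kernel turns the inner integral into the conjugate of `T f = f`.
        have e2 : ∀ w, kernel s μ z w * (f z * ℓ z) * star (f w) =
            (f z * ℓ z) * (starRingEnd ℂ) (kernel s μ w z * f w) := fun w => by
          have h3 := kernel_star s hμ w z
          rw [map_mul, ← h3]
          simp only [starRingEnd_apply]
          ring
        simp only [e2]
        rw [integral_const_mul, integral_conj]
        have h4 : ∫ w, kernel s μ w z * f w ∂ν = f z := congrFun hT z
        rw [h4]
        push_cast
        rw [← Complex.mul_conj' (f z)]
        ring
      · rw [← integral_complex_ofReal]
        refine integral_congr_ae (Eventually.of_forall fun z => ?_)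
        simp only
        rw [← mul_assoc, hsq]
        push_cast
        ring
    have i1 : Integrable (fun z => ‖f z‖ ^ 2 * ℓ z) ν := by
      have h1 := bd (hfg.mul gℓ) (by fun_prop) (b := 0) (by norm_num)
      refine h1.mono' (by fun_prop) (Eventually.of_forall fun z => le_of_eq ?_)
      simp only [norm_mul, norm_pow, norm_norm, Complex.norm_real]
      simp
      ring
    have i2 : Integrable (fun z => ‖z‖ ^ 2 * ‖f z‖ ^ 2) ν := by
      have h1 := bd ((subgaussianGrowth_const_mul_norm_sq 1).mul (hfg.mul hfg)) (by fun_prop)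
        (b := 0) (by norm_num)
      refine h1.mono' (by fun_prop) (Eventually.of_forall fun z => le_of_eq ?_)
      rw [Real.norm_of_nonneg (by positivity), norm_mul, norm_mul, Complex.norm_real,
        Real.norm_of_nonneg (by positivity), zero_mul, Real.exp_zero]
      ring
    have e3 : ∫ z, ‖f z‖ ^ 2 * L₂ z ∂ν = x₂ * ∫ z, ‖f z‖ ^ 2 * ℓ z ∂ν -
        κ * ∫ z, ‖z‖ ^ 2 * ‖f z‖ ^ 2 ∂ν := by
      rw [← integral_const_mul, ← integral_const_mul, ← integral_sub (i1.const_mul _) (i2.const_mul _)]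
      congr 1
      ext z
      simp only [hL₂]
      ring
    rw [e1, ← Complex.ofReal_mul, ← Complex.ofReal_add, Complex.ofReal_re, e3] at key
    have e4 : Real.log (A * N ^ (1 + P - Q) / N) = Real.log A + (P - Q) * Real.log N := by
      rw [Real.log_div (by positivity) hN.ne', Real.log_mul hA0.ne' (by positivity),
        Real.log_rpow hN]
      ring
    rw [e4] at key
    simp only [hx₁, hx₂] at key
    simp only [hℓ] at key
    linarith
  · refine iGL.norm.congr (Eventually.of_forall fun x => ?_)
    simp only [norm_mul, Complex.norm_real, Real.norm_eq_abs]
  · refine (iGe 1 (by simp) (by simp)).norm.congr (Eventually.of_forall fun x => ?_)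
    have := norm_mul_cexp (G x) 1 (L x)
    rwa [Complex.one_re, one_mul (L x)] at this
  · intro ζ hζ
    rw [hFζ ζ hζ.ge (by linarith)]
    have n1 : ∀ z, ‖f z * Complex.exp (ζ * ((x₁ * ℓ z : ℝ) : ℂ))‖ = ‖f z‖ := fun z => by
      rw [norm_mul_cexp, hζ, zero_mul, Real.exp_zero, mul_one]
    have n2 : ∀ z, ‖star (f z) * Complex.exp (ζ * (L₂ z : ℂ))‖ = ‖f z‖ := fun z => by
      rw [norm_mul_cexp, hζ, zero_mul, Real.exp_zero, mul_one, norm_star]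
    have := norm_integral_transform_mul_le s hμ
      (mf.of_le (me1 ζ).aestronglyMeasurable (Eventually.of_forall fun z => (n1 z).le))
      (mf.of_le (me2 ζ).aestronglyMeasurable (Eventually.of_forall fun z => (n2 z).le))
      (by simp only [n1]; exact bd hfg hfm (by norm_num))
      (by simp only [n2]; exact bd hfg hfm (by norm_num))
    simp only [n1, n2] at this
    rwa [Real.mul_self_sqrt hN.le] at this
  · intro ζ hζ
    rw [hFζ ζ (by linarith) hζ.le]
    refine norm_integral_transform_mul_le_weighted s hμ hp hq hq_top hA0.le hA mf
      (me1 ζ).aestronglyMeasurable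
      (bd (ge1 ζ (by linarith) hζ.le) (me1 ζ) (by norm_num)) (fun z => ?_) fun z => ?_
    · rw [norm_mul_cexp, hζ, one_mul]
      refine (mul_exp_mul_log_sq_le_rpow (norm_nonneg _)).trans (le_of_eq ?_)
      congr 1
      rw [hx₁]
      ring
    · rw [norm_mul_cexp, hζ, one_mul, norm_star, hL₂]
      simp only
      rw [sub_eq_add_neg, Real.exp_add, ← mul_assoc, mul_comm, neg_mul]
      gcongr
      refine (mul_exp_mul_log_sq_le_rpow (norm_nonneg _)).trans (le_of_eq ?_)
      congr 1
      rw [hx₂]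
      ring
  · have := fub f (fun z => star (f z)) iG
    rw [hT] at this
    simp only [hG]
    rw [this]
    simp only [hsq]
    rw [integral_complex_ofReal]

/-! ### Taylor coefficients of functions in the Segal-Bargmann spaces -/

noncomputable def taylorCoeff (f : ℂ → ℂ) (k : ℕ) : ℂ := (k.factorial : ℂ)⁻¹ * iteratedDeriv k f 0

lemma hasSum_taylorCoeff {f : ℂ → ℂ} (hf : Differentiable ℂ f) (z : ℂ) :
    HasSum (fun k => taylorCoeff f k * z ^ k) (f z) := by
  have := Complex.hasSum_taylorSeries_of_entire hf 0 z
  refine this.congr_fun fun k => ?_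
  rw [taylorCoeff, sub_zero, smul_eq_mul, smul_eq_mul]
  ring

lemma taylorCoeff_eq_zero (s : Parity) {f : ℂ → ℂ} (hs : ∀ z, f (-z) = (s.sign : ℂ) * f z) {k : ℕ}
    (hk : (-1 : ℝ) ^ k ≠ s.sign) : taylorCoeff f k = 0 := by
  have h1 := iteratedDeriv_comp_neg k f 0
  have h2 : (fun x => f (-x)) = fun x => (s.sign : ℂ) * f x := funext hs
  rw [h2, iteratedDeriv_const_mul_field, neg_zero, smul_eq_mul] at h1
  have h3 : ((s.sign : ℂ) - (-1) ^ k) * iteratedDeriv k f 0 = 0 := by rw [sub_mul, h1, sub_self]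
  have h4 : (s.sign : ℂ) - (-1) ^ k ≠ 0 := by
    intro h
    apply hk
    have : (((-1 : ℝ) ^ k : ℝ) : ℂ) = (s.sign : ℂ) := by
      push_cast
      exact (sub_eq_zero.mp h).symm
    exact_mod_cast this
  rw [taylorCoeff, (mul_eq_zero.mp h3).resolve_left h4, mul_zero]

/-- Cauchy's formula on the unit circle for `ζ ↦ f(zζ)`. Rotating `z`, rather than varying a radius,
lets the estimate be integrated against the rotation invariant measure. -/
lemma norm_taylorCoeff_mul_pow_le {f : ℂ → ℂ} (hf : Differentiable ℂ f) (k : ℕ) (z : ℂ) :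
    2 * Real.pi * ‖taylorCoeff f k * z ^ k‖ ≤
      ∫ θ in (0 : ℝ)..2 * Real.pi, ‖f (circleMap 0 1 θ * z)‖ := by
  have hg : Differentiable ℂ fun ζ : ℂ => f (z * ζ) := by fun_prop
  have h := hg.diffContOnCl.circleIntegral_one_div_sub_center_pow_smul (c := (0 : ℂ)) one_pos k
  have hd : iteratedDeriv k (fun ζ => f (z * ζ)) 0 = z ^ k * iteratedDeriv k f 0 := by
    rw [iteratedDeriv_comp_const_mul (hf.contDiff.of_le le_top)]
    simp
  have h2 : ‖∮ ζ in C(0, 1), (1 / (ζ - 0) ^ (k + 1)) • f (z * ζ)‖ =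
      2 * Real.pi * ‖taylorCoeff f k * z ^ k‖ := by
    rw [h, hd, taylorCoeff, smul_eq_mul]
    simp only [norm_mul, norm_div, norm_inv, Complex.norm_I, Complex.norm_ofNat,
      Complex.norm_real, Real.norm_of_nonneg Real.pi_pos.le, Complex.norm_natCast]
    ring
  rw [← h2, circleIntegral]
  refine (intervalIntegral.norm_integral_le_integral_norm Real.two_pi_pos.le).trans (le_of_eq ?_)
  refine intervalIntegral.integral_congr fun θ _ => ?_
  simp [mul_comm]

lemma sq_norm_taylorCoeff_mul_pow_le {f : ℂ → ℂ} (hf : Differentiable ℂ f) (k : ℕ) (z : ℂ) :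
    2 * Real.pi * ‖taylorCoeff f k * z ^ k‖ ^ 2 ≤
      ∫ θ in (0 : ℝ)..2 * Real.pi, ‖f (circleMap 0 1 θ * z)‖ ^ 2 := by
  set m := ‖taylorCoeff f k * z ^ k‖
  have hc : Continuous fun θ => ‖f (circleMap 0 1 θ * z)‖ := by
    have := hf.continuous
    have := continuous_circleMap 0 1
    fun_prop
  have h1 := norm_taylorCoeff_mul_pow_le hf k z
  have hc2 : Continuous fun θ => ‖f (circleMap 0 1 θ * z)‖ ^ 2 := hc.pow 2
  have h2 : ∫ θ in (0 : ℝ)..2 * Real.pi, 2 * m * ‖f (circleMap 0 1 θ * z)‖ ≤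
      ∫ θ in (0 : ℝ)..2 * Real.pi, (‖f (circleMap 0 1 θ * z)‖ ^ 2 + m ^ 2) := by
    refine intervalIntegral.integral_mono_on Real.two_pi_pos.le
      ((hc.const_mul _).intervalIntegrable _ _)
      ((hc2.add continuous_const).intervalIntegrable _ _) fun θ _ => ?_
    nlinarith [sq_nonneg (m - ‖f (circleMap 0 1 θ * z)‖)]
  rw [intervalIntegral.integral_const_mul, intervalIntegral.integral_add
    (hc2.intervalIntegrable _ _) (continuous_const.intervalIntegrable _ _),
    intervalIntegral.integral_const, smul_eq_mul, sub_zero] at h2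
  have h3 := mul_le_mul_of_nonneg_left h1 (by positivity : 0 ≤ 2 * m)
  linarith

/-- Integrate the squared Cauchy estimate over `z`: Fubini and rotation invariance produce `2π‖f‖²`
on the right, and the moment formula produces `γ_μ(k)` on the left. -/
lemma sq_norm_taylorCoeff_mul_gammaMu_le (s : Parity) {μ : ℝ} (hμ : -(1 / 2) < μ) {f : ℂ → ℂ}
    (hf : f ∈ space s μ 2) {k : ℕ} (hk : (-1) ^ k = s.sign) :
    ‖taylorCoeff f k‖ ^ 2 * gammaMu μ k ≤ ∫ z, ‖f z‖ ^ 2 ∂(nu s μ) := by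
  have : Fact (-(1 / 2) < μ) := ⟨hμ⟩
  obtain ⟨hd, -, hL⟩ := hf
  have hfc := hd.continuous
  have hi : Integrable (fun z => ‖f z‖ ^ 2) (nu s μ) := hL.integrable_norm_pow two_ne_zero
  have hrot : ∀ θ : ℝ, MeasurePreserving (fun z : ℂ => circleMap 0 1 θ * z) (nu s μ) (nu s μ) := by
    intro θ
    convert measurePreserving_mul_circle s μ (Circle.exp θ) using 2
    simp [circleMap]
  have hcont : Continuous fun x : ℂ × ℝ => ‖f (circleMap 0 1 x.2 * x.1)‖ ^ 2 := by
    have := continuous_circleMap 0 1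
    fun_prop
  have hrotE : ∀ θ : ℝ, ∫ z, ‖f (circleMap 0 1 θ * z)‖ ^ 2 ∂(nu s μ) =
      ∫ z, ‖f z‖ ^ 2 ∂(nu s μ) := fun θ => by
    have he : MeasurableEmbedding (fun z : ℂ => circleMap 0 1 θ * z) :=
      measurableEmbedding_mulLeft₀ (circleMap_ne_center one_ne_zero)
    exact (hrot θ).integral_comp he fun z => ‖f z‖ ^ 2
  have hrotI : ∀ θ : ℝ, Integrable (fun z => ‖f (circleMap 0 1 θ * z)‖ ^ 2) (nu s μ) := fun θ =>
    ((hrot θ).integrable_comp (g := fun z => ‖f z‖ ^ 2) hi.1).mpr hi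
  have hprod : Integrable (fun x : ℂ × ℝ => ‖f (circleMap 0 1 x.2 * x.1)‖ ^ 2)
      ((nu s μ).prod (volume.restrict (Ioc 0 (2 * Real.pi)))) := by
    rw [integrable_prod_iff' hcont.aestronglyMeasurable]
    constructor
    · exact Eventually.of_forall hrotI
    · simp only [norm_pow, norm_norm, hrotE]
      exact integrable_const _
  have h1 : ∫ z, 2 * Real.pi * ‖taylorCoeff f k * z ^ k‖ ^ 2 ∂(nu s μ) ≤
      ∫ z, (∫ θ in Ioc 0 (2 * Real.pi), ‖f (circleMap 0 1 θ * z)‖ ^ 2) ∂(nu s μ) := by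
    have hle : ∀ z, 2 * Real.pi * ‖taylorCoeff f k * z ^ k‖ ^ 2 ≤
        ∫ θ in Ioc 0 (2 * Real.pi), ‖f (circleMap 0 1 θ * z)‖ ^ 2 := fun z => by
      rw [← intervalIntegral.integral_of_le Real.two_pi_pos.le]
      exact sq_norm_taylorCoeff_mul_pow_le hd k z
    refine integral_mono_of_nonneg (Eventually.of_forall fun z => by positivity)
      hprod.integral_prod_left (Eventually.of_forall hle)
  rw [integral_integral_swap hprod] at h1
  simp only [hrotE, norm_mul, norm_pow, mul_pow, ← pow_mul] at h1
  simp only [mul_comm k 2] at h1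
  rw [integral_const_mul, integral_const_mul, integral_norm_pow_nu_eq_gammaMu s hμ k hk,
    integral_const] at h1
  simp only [measureReal_restrict_apply_univ, Real.volume_real_Ioc, sub_zero,
    max_eq_left Real.two_pi_pos.le, smul_eq_mul] at h1
  exact le_of_mul_le_mul_left h1 Real.two_pi_pos

/-- With `t = √r` and `1/γ_μ(k) ≤ C t^{-k}/k!`, the square of the `k`-th term is at most `N C t^{2k}
(t|z|²)^k/k! ≤ N C t^{2k} e^{t|z|²}`. The terms thus form a geometric series times a Gaussian of
exponent `t/2 < 1/2`, uniformly in `n`. -/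
lemma exists_taylorCoeff_bound (s : Parity) {μ : ℝ} (hμ : -(1 / 2) < μ) {f : ℂ → ℂ}
    (hf : f ∈ space s μ 2) {r : ℝ} (hr0 : 0 < r) (hr1 : r < 1) :
    ∃ M, 0 < M ∧ ∀ (n : ℕ) (z : ℂ),
      ‖∑ k ∈ Finset.range n, taylorCoeff f k * (r * z) ^ k‖ ≤
        M * Real.exp (Real.sqrt r / 2 * ‖z‖ ^ 2) := by
  set N := ∫ z, ‖f z‖ ^ 2 ∂(nu s μ) with hN
  have hN0 : 0 ≤ N := integral_nonneg fun z => by positivity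
  set t := Real.sqrt r with ht
  have ht0 : 0 < t := Real.sqrt_pos.mpr hr0
  have ht2 : t ^ 2 = r := Real.sq_sqrt hr0.le
  have ht1 : t < 1 := by nlinarith
  obtain ⟨C, hC, hle⟩ := exists_inv_gammaMu_le hμ (one_lt_inv_iff₀.mpr ⟨ht0, ht1⟩)
  have key : ∀ (k : ℕ) (z : ℂ), ‖taylorCoeff f k * (r * z) ^ k‖ ≤
      t ^ k * (Real.sqrt (N * C) * Real.exp (t / 2 * ‖z‖ ^ 2)) := fun k z => by
    by_cases hk : (-1 : ℝ) ^ k = s.sign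
    swap
    · rw [taylorCoeff_eq_zero s hf.2.1 hk, zero_mul, norm_zero]
      positivity
    refine abs_le_of_sq_le_sq' ?_ (by positivity) |>.2
    have h1 := sq_norm_taylorCoeff_mul_gammaMu_le s hμ hf hk
    have hγ := gammaMu_pos hμ k
    have hfk : (0 : ℝ) < k.factorial := by exact_mod_cast k.factorial_pos
    have h2 : ‖taylorCoeff f k‖ ^ 2 ≤ N * (C * (t⁻¹ ^ k / k.factorial)) := by
      rw [← le_div_iff₀ hγ, div_eq_mul_inv] at h1
      exact h1.trans (mul_le_mul_of_nonneg_left (hle k) hN0)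
    have h3 := Real.pow_div_factorial_le_exp (t * ‖z‖ ^ 2) (by positivity) k
    have h4 : (Real.exp (t / 2 * ‖z‖ ^ 2)) ^ 2 = Real.exp (t * ‖z‖ ^ 2) := by
      rw [← Real.exp_nat_mul]
      congr 1
      push_cast
      ring
    rw [norm_mul, norm_pow, norm_mul, Complex.norm_real, Real.norm_of_nonneg hr0.le, mul_pow,
      mul_pow (t ^ k), mul_pow (Real.sqrt _), h4, Real.sq_sqrt (by positivity), ← ht2]
    calc ‖taylorCoeff f k‖ ^ 2 * ((t ^ 2 * ‖z‖) ^ k) ^ 2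
        ≤ N * (C * (t⁻¹ ^ k / k.factorial)) * ((t ^ 2 * ‖z‖) ^ k) ^ 2 := by gcongr
      _ = (t ^ k) ^ 2 * (N * C * ((t * ‖z‖ ^ 2) ^ k / k.factorial)) := by
          have h5 : t⁻¹ ^ k * ((t ^ 2 * ‖z‖) ^ k) ^ 2 = (t ^ k) ^ 2 * (t * ‖z‖ ^ 2) ^ k := by
            rw [← pow_mul, mul_comm k 2, pow_mul, ← mul_pow, ← pow_mul t, mul_comm k 2, pow_mul t,
              ← mul_pow]
            congr 1
            field_simp
          calc _ = N * C / k.factorial * (t⁻¹ ^ k * ((t ^ 2 * ‖z‖) ^ k) ^ 2) := by ring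
            _ = _ := by rw [h5]; ring
      _ ≤ _ := by gcongr
  refine ⟨(1 - t)⁻¹ * Real.sqrt (N * C) + 1, ?_, fun n z => ?_⟩
  · have : 0 < 1 - t := by linarith
    positivity
  · refine (norm_sum_le _ _).trans ((Finset.sum_le_sum fun k _ => key k z).trans ?_)
    rw [← Finset.sum_mul]
    have h6 : ∑ k ∈ Finset.range n, t ^ k ≤ (1 - t)⁻¹ := by
      rw [← tsum_geometric_of_lt_one ht0.le ht1]
      exact (summable_geometric_of_lt_one ht0.le ht1).sum_le_tsum _ fun k _ => by positivity
    calc _ ≤ (1 - t)⁻¹ * (Real.sqrt (N * C) * Real.exp (t / 2 * ‖z‖ ^ 2)) := by gcongr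
      _ ≤ _ := by
        rw [add_mul, ← mul_assoc]
        have := Real.exp_pos (t / 2 * ‖z‖ ^ 2)
        linarith

/-! ### The energy-entropy inequality for dilated functions -/

/-- The inequality `c S(f) ≤ l ‖f‖² + κ E(f)`, in terms of Bochner integrals. -/
def RealEnergyEntropyIneq (ν : Measure ℂ) (c l κ : ℝ) (f : ℂ → ℂ) : Prop :=
  c * (∫ z, ‖f z‖ ^ 2 * Real.log (‖f z‖ ^ 2) ∂ν -
      (∫ z, ‖f z‖ ^ 2 ∂ν) * Real.log (∫ z, ‖f z‖ ^ 2 ∂ν)) ≤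
    l * ∫ z, ‖f z‖ ^ 2 ∂ν + κ * ∫ z, ‖z‖ ^ 2 * ‖f z‖ ^ 2 ∂ν

lemma RealEnergyEntropyIneq.of_tendsto {ν : Measure ℂ} {c l κ : ℝ} {F : ℕ → ℂ → ℂ} {f : ℂ → ℂ}
    (h : ∀ n, RealEnergyEntropyIneq ν c l κ (F n))
    (hN : Tendsto (fun n => ∫ z, ‖F n z‖ ^ 2 ∂ν) atTop (𝓝 (∫ z, ‖f z‖ ^ 2 ∂ν)))
    (hS : Tendsto (fun n => ∫ z, ‖F n z‖ ^ 2 * Real.log (‖F n z‖ ^ 2) ∂ν) atTop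
      (𝓝 (∫ z, ‖f z‖ ^ 2 * Real.log (‖f z‖ ^ 2) ∂ν)))
    (hE : Tendsto (fun n => κ * ∫ z, ‖z‖ ^ 2 * ‖F n z‖ ^ 2 ∂ν) atTop
      (𝓝 (κ * ∫ z, ‖z‖ ^ 2 * ‖f z‖ ^ 2 ∂ν))) :
    RealEnergyEntropyIneq ν c l κ f :=
  le_of_tendsto_of_tendsto'
    ((hS.sub ((Real.continuous_mul_log.tendsto _).comp hN)).const_mul c)
    ((hN.const_mul l).add hE) h

lemma realEnergyEntropyIneq_of_fixed (s : Parity) {μ : ℝ} (hμ : -(1 / 2) < μ)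
    {p q : ℝ≥0∞} (hp : 1 < p) (hq : 1 ≤ q) (hq_top : q < ∞) {a A : ℝ} (hA0 : 0 < A)
    (ha : -(3 / 4) < a / q.toReal)
    (hA : ∀ h : ℂ → ℂ, MemLp h p (nu s μ) →
      eLpNorm (transform s μ h) q (nuWeighted s μ a) ≤ ENNReal.ofReal A * eLpNorm h p (nu s μ))
    {f : ℂ → ℂ} (hfc : Continuous f) (hfg : SubgaussianGrowth f) (hT : transform s μ f = f) :
    RealEnergyEntropyIneq (nu s μ) (entropyCoeff p q) (Real.log A) (a / q.toReal) f := by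
  have : Fact (-(1 / 2) < μ) := ⟨hμ⟩
  have hN0 : 0 ≤ ∫ z, ‖f z‖ ^ 2 ∂(nu s μ) := integral_nonneg fun z => by positivity
  rcases hN0.eq_or_lt with hN | hN
  · have hL : MemLp f 2 (nu s μ) :=
      hfg.memLp s hμ hfc.aestronglyMeasurable (by norm_num) (by norm_num)
    have h0 := (integral_eq_zero_iff_of_nonneg (fun z => by positivity)
      (hL.integrable_norm_pow two_ne_zero)).mp hN.symm
    have h1 : ∫ z, ‖f z‖ ^ 2 * Real.log (‖f z‖ ^ 2) ∂(nu s μ) = 0 :=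
      integral_eq_zero_of_ae (h0.mono fun z hz => by
        simp only [Pi.zero_apply] at hz ⊢
        rw [hz, zero_mul])
    have h2 : ∫ z, ‖z‖ ^ 2 * ‖f z‖ ^ 2 ∂(nu s μ) = 0 :=
      integral_eq_zero_of_ae (h0.mono fun z hz => by
        simp only [Pi.zero_apply] at hz ⊢
        rw [hz, mul_zero])
    rw [RealEnergyEntropyIneq, ← hN, h1, h2]
    simp
  · exact energyEntropy_of_fixed s hμ hp hq hq_top hA0 ha hA hfc hfg hT hN

/-- The summand `1` covers `x ≤ 1`, where `x log x` is negative and not monotone. -/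
lemma abs_mul_log_le {x y : ℝ} (hx : 0 ≤ x) (hxy : x ≤ y) (hy : 1 ≤ y) :
    |x * Real.log x| ≤ 1 + y * Real.log y := by
  have hy0 := mul_nonneg (zero_le_one.trans hy) (Real.log_nonneg hy)
  rcases hx.eq_or_lt with rfl | hx
  · simpa using by linarith
  rcases le_total x 1 with h | h
  · have := Real.abs_log_mul_self_lt x hx h
    rw [mul_comm]
    linarith
  · have h1 := Real.log_nonneg h
    rw [abs_of_nonneg (by positivity)]
    have : x * Real.log x ≤ y * Real.log y := by gcongr
    linarith

lemma integrable_gaussian_bounds (s : Parity) {μ : ℝ} (hμ : -(1 / 2) < μ) {M b : ℝ}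
    (hb : b < 1 / 2) :
    Integrable (fun z => (M * Real.exp (b * ‖z‖ ^ 2)) ^ 2) (nu s μ) ∧
    Integrable (fun z => ‖z‖ ^ 2 * (M * Real.exp (b * ‖z‖ ^ 2)) ^ 2) (nu s μ) := by
  have h0 : ∀ z : ℂ, (M * Real.exp (b * ‖z‖ ^ 2)) ^ 2 = M ^ 2 * Real.exp (2 * b * ‖z‖ ^ 2) :=
    fun z => by
      rw [mul_pow, ← Real.exp_nat_mul]
      congr 2
      push_cast
      ring
  obtain ⟨C, hC, h⟩ := exists_pow_le_exp (e := (1 - 2 * b) / 2) (by linarith) 2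
  constructor
  · refine integrable_of_le_exp s hμ (b := 2 * b) (C := M ^ 2) (by linarith)
      (by fun_prop) fun z => ?_
    rw [Real.norm_of_nonneg (by positivity), h0]
  · refine integrable_of_le_exp s hμ (b := 2 * b + (1 - 2 * b) / 2) (C := C * M ^ 2) (by linarith)
      (by fun_prop) fun z => ?_
    rw [Real.norm_of_nonneg (by positivity), h0, add_mul, Real.exp_add]
    calc _ ≤ C * Real.exp ((1 - 2 * b) / 2 * ‖z‖ ^ 2) * (M ^ 2 * Real.exp (2 * b * ‖z‖ ^ 2)) := by
          gcongr
          exact h _ (norm_nonneg z)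
      _ = _ := by ring

section gaussianBound

variable (s : Parity) {μ M b : ℝ}

lemma integrable_gaussian_mul_log (hμ : -(1 / 2) < μ) (hM : 1 ≤ M) (hb : b < 1 / 2) :
    Integrable (fun z : ℂ => 1 + (M * Real.exp (b * ‖z‖ ^ 2)) ^ 2 *
      Real.log ((M * Real.exp (b * ‖z‖ ^ 2)) ^ 2)) (nu s μ) := by
  have : Fact (-(1 / 2) < μ) := ⟨hμ⟩
  obtain ⟨h1, h2⟩ := integrable_gaussian_bounds s hμ (M := M) hb
  refine ((integrable_const 1).add ((h1.const_mul (2 * Real.log M)).add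
    (h2.const_mul (2 * b)))).congr (Eventually.of_forall fun z => ?_)
  simp only [Pi.add_apply]
  rw [Real.log_pow, Real.log_mul (by positivity) (Real.exp_pos _).ne', Real.log_exp]
  push_cast
  ring

lemma norm_sq_mul_log_le (hM : 1 ≤ M) (hb0 : 0 ≤ b) {x : ℝ} (hx : 0 ≤ x) (z : ℂ)
    (h : x ≤ M * Real.exp (b * ‖z‖ ^ 2)) :
    ‖x ^ 2 * Real.log (x ^ 2)‖ ≤ 1 + (M * Real.exp (b * ‖z‖ ^ 2)) ^ 2 *
      Real.log ((M * Real.exp (b * ‖z‖ ^ 2)) ^ 2) := by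
  refine abs_mul_log_le (by positivity) (by gcongr) ?_
  have : 1 ≤ Real.exp (b * ‖z‖ ^ 2) := Real.one_le_exp (by positivity)
  exact one_le_pow₀ (one_le_mul_of_one_le_of_one_le hM this)

lemma integrable_of_gaussian_bound (hμ : -(1 / 2) < μ) (hM : 1 ≤ M) (hb0 : 0 ≤ b)
    (hb : b < 1 / 2) {f : ℂ → ℂ} (hf : Continuous f)
    (h : ∀ z, ‖f z‖ ≤ M * Real.exp (b * ‖z‖ ^ 2)) :
    Integrable (fun z => ‖f z‖ ^ 2 * Real.log (‖f z‖ ^ 2)) (nu s μ) ∧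
    Integrable (fun z => ‖z‖ ^ 2 * ‖f z‖ ^ 2) (nu s μ) := by
  constructor
  · refine (integrable_gaussian_mul_log s hμ hM hb).mono' ?_
      (Eventually.of_forall fun z => norm_sq_mul_log_le hM hb0 (norm_nonneg _) z (h z))
    exact (Real.continuous_mul_log.comp (hf.norm.pow 2)).aestronglyMeasurable
  · refine (integrable_gaussian_bounds s hμ (M := M) hb).2.mono' (by fun_prop)
      (Eventually.of_forall fun z => ?_)
    rw [Real.norm_of_nonneg (by positivity)]
    gcongr
    exact h z

lemma RealEnergyEntropyIneq.of_tendsto_of_gaussian_bound {c l κ : ℝ} (hμ : -(1 / 2) < μ)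
    (hM : 1 ≤ M) (hb0 : 0 ≤ b) (hb : b < 1 / 2) {F : ℕ → ℂ → ℂ} {f : ℂ → ℂ}
    (hF : ∀ n, Continuous (F n)) (hle : ∀ n z, ‖F n z‖ ≤ M * Real.exp (b * ‖z‖ ^ 2))
    (hlim : ∀ z, Tendsto (fun n => F n z) atTop (𝓝 (f z)))
    (h : ∀ n, RealEnergyEntropyIneq (nu s μ) c l κ (F n)) :
    RealEnergyEntropyIneq (nu s μ) c l κ f := by
  have hsq : ∀ z, Tendsto (fun n => ‖F n z‖ ^ 2) atTop (𝓝 (‖f z‖ ^ 2)) :=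
    fun z => (hlim z).norm.pow 2
  obtain ⟨i1, i2⟩ := integrable_gaussian_bounds s hμ (M := M) hb
  refine .of_tendsto h ?_ ?_ (Tendsto.const_mul _ ?_)
  · refine tendsto_integral_of_dominated_convergence _ (fun n => ?_) i1
      (fun n => Eventually.of_forall fun z => ?_) (Eventually.of_forall hsq)
    · have := hF n
      fun_prop
    · rw [Real.norm_of_nonneg (by positivity)]
      gcongr
      exact hle n z
  · refine tendsto_integral_of_dominated_convergence _ (fun n => ?_)
      (integrable_gaussian_mul_log s hμ hM hb)
      (fun n => Eventually.of_forall fun z =>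
        norm_sq_mul_log_le hM hb0 (norm_nonneg _) z (hle n z))
      (Eventually.of_forall fun z => (Real.continuous_mul_log.tendsto _).comp (hsq z))
    exact (Real.continuous_mul_log.comp ((hF n).norm.pow 2)).aestronglyMeasurable
  · refine tendsto_integral_of_dominated_convergence _ (fun n => ?_) i2
      (fun n => Eventually.of_forall fun z => ?_)
      (Eventually.of_forall fun z => (hsq z).const_mul _)
    · have := hF n
      fun_prop
    · rw [Real.norm_of_nonneg (by positivity)]
      gcongr
      exact hle n z

end gaussianBound

/-- Taylor polynomials of the dilate have the right parity, hence are fixed by the transform. Their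
common Gaussian bound allows dominated convergence in norm, entropy and energy. -/
lemma realEnergyEntropyIneq_dilate (s : Parity) {μ : ℝ} (hμ : -(1 / 2) < μ)
    {p q : ℝ≥0∞} (hp : 1 < p) (hq : 1 ≤ q) (hq_top : q < ∞) {a A : ℝ} (hA0 : 0 < A)
    (ha : -(3 / 4) < a / q.toReal)
    (hA : ∀ h : ℂ → ℂ, MemLp h p (nu s μ) →
      eLpNorm (transform s μ h) q (nuWeighted s μ a) ≤ ENNReal.ofReal A * eLpNorm h p (nu s μ))
    {f : ℂ → ℂ} (hf : f ∈ space s μ 2) {r : ℝ} (hr0 : 0 < r) (hr1 : r < 1) :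
    RealEnergyEntropyIneq (nu s μ) (entropyCoeff p q) (Real.log A) (a / q.toReal)
        (fun z => f (r * z)) ∧
      Integrable (fun z => ‖f (r * z)‖ ^ 2 * Real.log (‖f (r * z)‖ ^ 2)) (nu s μ) ∧
      Integrable (fun z => ‖z‖ ^ 2 * ‖f (r * z)‖ ^ 2) (nu s μ) := by
  obtain ⟨M, hM, hle⟩ := exists_taylorCoeff_bound s hμ hf hr0 hr1
  have hlt : Real.sqrt r < 1 := by rw [Real.sqrt_lt' one_pos]; simpa
  have hs0 := Real.sqrt_nonneg r
  set F : ℕ → ℂ → ℂ := fun n z => ∑ k ∈ Finset.range n, taylorCoeff f k * (r * z) ^ k with hF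
  have hlim : ∀ z, Tendsto (fun n => F n z) atTop (𝓝 (f (r * z))) := fun z =>
    (hasSum_taylorCoeff hf.1 (r * z)).tendsto_sum_nat
  have hle' : ∀ n z, ‖F n z‖ ≤ (M + 1) * Real.exp (Real.sqrt r / 2 * ‖z‖ ^ 2) := fun n z =>
    (hle n z).trans (by gcongr; linarith)
  have hfc := hf.1.continuous
  refine ⟨.of_tendsto_of_gaussian_bound s hμ (by linarith) (by positivity) (by linarith)
    (fun n => by fun_prop) hle' hlim fun n => ?_,
    integrable_of_gaussian_bound s hμ (M := M + 1) (b := Real.sqrt r / 2) (by linarith)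
      (by positivity) (by linarith) (by fun_prop)
      fun z => le_of_tendsto' (hlim z).norm fun n => hle' n z⟩
  have hFn : F n = fun z => ∑ k ∈ Finset.range n, (taylorCoeff f k * (r : ℂ) ^ k) * z ^ k := by
    ext z
    simp only [hF, mul_pow, mul_assoc]
  rw [hFn]
  refine realEnergyEntropyIneq_of_fixed s hμ hp hq hq_top hA0 ha hA (by fun_prop)
    (subgaussianGrowth_polynomial n _) (transform_polynomial s hμ n _ fun k hk => ?_)
  rw [taylorCoeff_eq_zero s hf.2.1 hk, zero_mul]

/-! ### Limits of dilations -/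

lemma continuousAt_density (s : Parity) (μ : ℝ) {z : ℂ} (hz : z ≠ 0) :
    ContinuousAt (density s μ) z := by
  have h0 : 0 < ‖z‖ ^ 2 := by positivity
  have h1 : ContinuousAt (fun z : ℂ => ‖z‖ ^ 2) z := by fun_prop
  have h2 : density s μ = fun z => densityConst μ *
      (macdonald (μ - s.sign * (1 / 2)) (‖z‖ ^ 2) * (‖z‖ ^ 2) ^ (μ + 3 / 2 - 1)) :=
    funext (density_eq s μ)
  rw [h2]
  refine continuousAt_const.mul (ContinuousAt.mul ?_ (h1.rpow_const (Or.inl h0.ne')))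
  exact ContinuousAt.comp (f := fun z : ℂ => ‖z‖ ^ 2)
    ((continuousOn_macdonald _).continuousAt (Ioi_mem_nhds h0)) h1

/-- The Macdonald function decreases, so stretching the argument can increase only the power factor.
-/
lemma density_mul_le (s : Parity) {μ : ℝ} (hμ : -(1 / 2) < μ) {t : ℝ} (h1 : 1 ≤ t) (h2 : t ≤ 2)
    {z : ℂ} (hz : z ≠ 0) :
    density s μ (t • z) ≤ 4 ^ (μ + 1 / 2) * density s μ z := by
  have h0 : 0 < ‖z‖ ^ 2 := by positivity
  have ht : 1 ≤ t ^ 2 := one_le_pow₀ h1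
  have hc := densityConst_pos hμ
  have hm := macdonald_antitoneOn (μ - s.sign * (1 / 2)) (mem_Ioi.mpr h0)
    (mem_Ioi.mpr (by positivity : 0 < t ^ 2 * ‖z‖ ^ 2)) (by nlinarith)
  have hm0 := macdonald_nonneg (μ - s.sign * (1 / 2)) (‖z‖ ^ 2)
  rw [density_eq, density_eq, norm_smul, Real.norm_of_nonneg (by linarith), mul_pow,
    Real.mul_rpow (by positivity) h0.le]
  have h3 : (t ^ 2) ^ (μ + 3 / 2 - 1) ≤ 4 ^ (μ + 1 / 2) := by
    rw [show μ + 3 / 2 - 1 = μ + 1 / 2 by ring]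
    exact Real.rpow_le_rpow (by positivity) (by nlinarith) (by linarith)
  calc _ ≤ densityConst μ * (macdonald (μ - s.sign * (1 / 2)) (‖z‖ ^ 2) *
        (4 ^ (μ + 1 / 2) * (‖z‖ ^ 2) ^ (μ + 3 / 2 - 1))) := by gcongr
    _ = _ := by ring

lemma integral_nu_comp_smul (s : Parity) {μ : ℝ} (hμ : -(1 / 2) < μ) (g : ℂ → ℝ) {r : ℝ}
    (hr : 0 < r) :
    ∫ z, g (r • z) ∂(nu s μ) = (r ^ 2)⁻¹ * ∫ z, density s μ (r⁻¹ • z) * g z := by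
  have h := Measure.integral_comp_smul volume (fun z : ℂ => density s μ (r⁻¹ • z) * g z) r
  rw [Complex.finrank_real_complex, abs_of_pos (by positivity), smul_eq_mul] at h
  rw [integral_nu s hμ, ← h]
  simp only [inv_smul_smul₀ hr.ne', smul_eq_mul]

/-- A change of variables moves the dilation from `g` to the density, where `density_mul_le`
provides a dominating function. No bound on `g` beyond integrability is needed. -/
lemma tendsto_integral_nu_comp_smul (s : Parity) {μ : ℝ} (hμ : -(1 / 2) < μ) {g : ℂ → ℝ}
    (hgm : Measurable g) (hg : Integrable g (nu s μ)) {r : ℕ → ℝ} (hr1 : ∀ n, 1 / 2 ≤ r n) (hr2 : ∀ n, r n ≤ 1)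
    (hr : Tendsto r atTop (𝓝 1)) :
    Tendsto (fun n => ∫ z, g (r n • z) ∂(nu s μ)) atTop (𝓝 (∫ z, g z ∂(nu s μ))) := by
  have hr0 : ∀ n, 0 < r n := fun n => by linarith [hr1 n]
  simp only [fun n => integral_nu_comp_smul s hμ g (hr0 n)]
  rw [integral_nu s hμ]
  have h1 : Tendsto (fun n => (r n ^ 2)⁻¹) atTop (𝓝 1) := by
    simpa using (hr.pow 2).inv₀ (by norm_num)
  have hinv : Tendsto (fun n => (r n)⁻¹) atTop (𝓝 1) := by
    simpa using hr.inv₀ one_ne_zero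
  rw [← one_mul (∫ z, density s μ z • g z)]
  refine h1.mul ?_
  rw [integrable_nu_iff s hμ] at hg
  have hne : ∀ᵐ z : ℂ, z ≠ 0 := by simp [ae_iff]
  refine tendsto_integral_of_dominated_convergence
    (fun z => 4 ^ (μ + 1 / 2) * ‖density s μ z • g z‖) (fun n => ?_) (hg.norm.const_mul _)
    (fun n => ?_) ?_
  · have := measurable_density s μ
    exact ((this.comp (measurable_const_smul _)).mul hgm).aestronglyMeasurable
  · filter_upwards [hne] with z hz
    rw [norm_mul, norm_smul, ← mul_assoc, Real.norm_of_nonneg (density_nonneg s hμ _),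
      Real.norm_of_nonneg (density_nonneg s hμ _)]
    gcongr
    refine density_mul_le s hμ (one_le_inv₀ (hr0 n) |>.mpr (hr2 n)) ?_ hz
    rw [inv_le_comm₀ (hr0 n) two_pos]
    linarith [hr1 n]
  · filter_upwards [hne] with z hz
    have h2 : Tendsto (fun n => (r n)⁻¹ • z) atTop (𝓝 z) := by
      simpa using hinv.smul_const z
    exact ((continuousAt_density s μ hz).tendsto.comp h2).mul_const _

lemma integrable_of_tendsto_of_integral_le {X : Type*} [MeasurableSpace X] {ν : Measure X}
    {F : ℕ → X → ℝ} {g : X → ℝ} {K : ℝ} (hgm : AEStronglyMeasurable g ν) (hF0 : ∀ n x, 0 ≤ F n x)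
    (hF : ∀ n, Integrable (F n) ν) (hlim : ∀ x, Tendsto (fun n => F n x) atTop (𝓝 (g x)))
    (hK : ∀ n, ∫ x, F n x ∂ν ≤ K) : Integrable g ν := by
  have hg0 : ∀ x, 0 ≤ g x := fun x => ge_of_tendsto' (hlim x) fun n => hF0 n x
  refine ⟨hgm, ?_⟩
  rw [hasFiniteIntegral_iff_ofReal (Eventually.of_forall hg0)]
  have h1 : ∫⁻ x, ENNReal.ofReal (g x) ∂ν ≤
      liminf (fun n => ∫⁻ x, ENNReal.ofReal (F n x) ∂ν) atTop := by
    refine le_trans (le_of_eq (lintegral_congr fun x => ?_))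
      (lintegral_liminf_le' fun n => (hF n).1.aemeasurable.ennreal_ofReal)
    exact ((ENNReal.continuous_ofReal.tendsto _).comp (hlim x)).liminf_eq.symm
  have h2 : ∀ n, ∫⁻ x, ENNReal.ofReal (F n x) ∂ν ≤ ENNReal.ofReal K := fun n => by
    rw [← ofReal_integral_eq_lintegral_ofReal (hF n) (Eventually.of_forall (hF0 n))]
    exact ENNReal.ofReal_le_ofReal (hK n)
  exact (h1.trans ((liminf_le_liminf (Eventually.of_forall h2)).trans
    (le_of_eq (liminf_const _)))).trans_lt (ENNReal.ofReal_lt_top (r := K))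

/-! ### The energy-entropy inequality in the Segal-Bargmann spaces -/

section space

variable {s : Parity} {μ c l κ : ℝ} {f : ℂ → ℂ}

/-- The energy-entropy inequality holds for all dilations of `f` by factors in `(0, 1)`. -/
def DilateIneq (s : Parity) (μ c l κ : ℝ) (f : ℂ → ℂ) : Prop :=
  ∀ r : ℝ, 0 < r → r < 1 → RealEnergyEntropyIneq (nu s μ) c l κ (fun z => f (r * z)) ∧
      Integrable (fun z => ‖f (r * z)‖ ^ 2 * Real.log (‖f (r * z)‖ ^ 2)) (nu s μ) ∧
      Integrable (fun z => ‖z‖ ^ 2 * ‖f (r * z)‖ ^ 2) (nu s μ)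

noncomputable def dilationFactor (n : ℕ) : ℝ := 1 - 1 / ((n : ℝ) + 2)

lemma dilationFactor_bounds (n : ℕ) : 1 / 2 ≤ dilationFactor n ∧ dilationFactor n < 1 := by
  have h : (0 : ℝ) ≤ n := n.cast_nonneg
  have h1 : 1 / ((n : ℝ) + 2) ≤ 1 / 2 := one_div_le_one_div_of_le two_pos (by linarith)
  have h2 : 0 < 1 / ((n : ℝ) + 2) := by positivity
  rw [dilationFactor]
  constructor <;> linarith

lemma tendsto_dilationFactor : Tendsto dilationFactor atTop (𝓝 1) := by
  have h : Tendsto (fun n : ℕ => 1 / ((n : ℝ) + 2)) atTop (𝓝 0) := by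
    have := (tendsto_one_div_add_atTop_nhds_zero_nat (𝕜 := ℝ)).comp (tendsto_add_atTop_nat 1)
    refine this.congr fun n => ?_
    simp only [Function.comp]
    push_cast
    ring_nf
  have h2 := h.const_sub 1
  rwa [sub_zero] at h2

lemma tendsto_dilate (hf : Continuous f) (z : ℂ) :
    Tendsto (fun n => f (dilationFactor n * z)) atTop (𝓝 (f z)) := by
  have h : Tendsto (fun n => (dilationFactor n : ℂ) * z) atTop (𝓝 z) := by
    have := ((Complex.continuous_ofReal.tendsto 1).comp tendsto_dilationFactor).mul_const z
    simpa using this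
  exact (hf.tendsto z).comp h

lemma tendsto_integral_dilate (hμ : -(1 / 2) < μ) {g : ℂ → ℝ} (hg : Continuous g)
    (hi : Integrable g (nu s μ)) :
    Tendsto (fun n => ∫ z, g (dilationFactor n * z) ∂(nu s μ)) atTop
      (𝓝 (∫ z, g z ∂(nu s μ))) := by
  have := tendsto_integral_nu_comp_smul s hμ hg.measurable hi
    (fun n => (dilationFactor_bounds n).1) (fun n => (dilationFactor_bounds n).2.le)
    tendsto_dilationFactor
  simpa only [Complex.real_smul] using this

lemma tendsto_integral_norm_sq_dilate (hμ : -(1 / 2) < μ) (hf : f ∈ space s μ 2) :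
    Tendsto (fun n => ∫ z, ‖f (dilationFactor n * z)‖ ^ 2 ∂(nu s μ)) atTop
      (𝓝 (∫ z, ‖f z‖ ^ 2 ∂(nu s μ))) :=
  tendsto_integral_dilate hμ (g := fun z => ‖f z‖ ^ 2) (by have := hf.1.continuous; fun_prop)
    (hf.2.2.integrable_norm_pow two_ne_zero)

lemma tendsto_integral_norm_sq_mul_log_dilate (hμ : -(1 / 2) < μ) (hf : Continuous f)
    (hS : Integrable (fun z => ‖f z‖ ^ 2 * Real.log (‖f z‖ ^ 2)) (nu s μ)) :
    Tendsto (fun n => ∫ z, ‖f (dilationFactor n * z)‖ ^ 2 *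
      Real.log (‖f (dilationFactor n * z)‖ ^ 2) ∂(nu s μ)) atTop
      (𝓝 (∫ z, ‖f z‖ ^ 2 * Real.log (‖f z‖ ^ 2) ∂(nu s μ))) :=
  tendsto_integral_dilate hμ (g := fun z => ‖f z‖ ^ 2 * Real.log (‖f z‖ ^ 2))
    (Real.continuous_mul_log.comp (hf.norm.pow 2)) hS

lemma tendsto_energy_dilate (hμ : -(1 / 2) < μ) (hf : Continuous f)
    (hE : Integrable (fun z => ‖z‖ ^ 2 * ‖f z‖ ^ 2) (nu s μ)) :
    Tendsto (fun n => ∫ z, ‖z‖ ^ 2 * ‖f (dilationFactor n * z)‖ ^ 2 ∂(nu s μ)) atTop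
      (𝓝 (∫ z, ‖z‖ ^ 2 * ‖f z‖ ^ 2 ∂(nu s μ))) := by
  have h1 := tendsto_integral_dilate hμ (g := fun z => ‖z‖ ^ 2 * ‖f z‖ ^ 2) (by fun_prop) hE
  have h2 : Tendsto (fun n => (dilationFactor n ^ 2)⁻¹) atTop (𝓝 1) := by
    simpa using (tendsto_dilationFactor.pow 2).inv₀ (by norm_num)
  have h3 := h2.mul h1
  rw [one_mul] at h3
  refine h3.congr fun n => ?_
  rw [← integral_const_mul]
  congr 1
  ext z
  have := (dilationFactor_bounds n).1
  have hr : dilationFactor n ≠ 0 := by linarith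
  rw [norm_mul, Complex.norm_real, Real.norm_of_nonneg (by linarith)]
  field_simp

lemma DilateIneq.of_integrable (h : DilateIneq s μ c l κ f) (hμ : -(1 / 2) < μ)
    (hf : f ∈ space s μ 2)
    (hS : Integrable (fun z => ‖f z‖ ^ 2 * Real.log (‖f z‖ ^ 2)) (nu s μ))
    (hE : κ = 0 ∨ Integrable (fun z => ‖z‖ ^ 2 * ‖f z‖ ^ 2) (nu s μ)) :
    RealEnergyEntropyIneq (nu s μ) c l κ f := by
  refine .of_tendsto (F := fun n z => f (dilationFactor n * z)) (fun n => ?_)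
    (tendsto_integral_norm_sq_dilate hμ hf)
    (tendsto_integral_norm_sq_mul_log_dilate hμ hf.1.continuous hS) ?_
  · have := dilationFactor_bounds n
    exact (h _ (by linarith) this.2).1
  · rcases hE with rfl | hE
    · simp
    · exact (tendsto_energy_dilate hμ hf.1.continuous hE).const_mul _

/-- For `κ < 0` the inequality bounds the energies of the dilates from above by convergent
quantities; Fatou's lemma transfers finiteness to `f`. -/
lemma DilateIneq.integrable_energy (h : DilateIneq s μ c l κ f) (hμ : -(1 / 2) < μ)
    (hf : f ∈ space s μ 2) (hκ : κ < 0)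
    (hS : Integrable (fun z => ‖f z‖ ^ 2 * Real.log (‖f z‖ ^ 2)) (nu s μ)) :
    Integrable (fun z => ‖z‖ ^ 2 * ‖f z‖ ^ 2) (nu s μ) := by
  have hfc := hf.1.continuous
  have hN := tendsto_integral_norm_sq_dilate hμ hf
  have hlim := (hN.const_mul l).sub (((tendsto_integral_norm_sq_mul_log_dilate hμ hfc hS).sub
    ((Real.continuous_mul_log.tendsto _).comp hN)).const_mul c)
  obtain ⟨K, hK⟩ := hlim.bddAbove_range
  refine integrable_of_tendsto_of_integral_le (K := K / -κ)
    (F := fun n z => ‖z‖ ^ 2 * ‖f (dilationFactor n * z)‖ ^ 2) (by fun_prop)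
    (fun n z => by positivity) (fun n => ?_)
    (fun z => ((tendsto_dilate hfc z).norm.pow 2).const_mul _) fun n => ?_
  · have := dilationFactor_bounds n
    exact (h _ (by linarith) this.2).2.2
  · have := dilationFactor_bounds n
    have h1 := (h _ (by linarith) this.2).1
    have h2 := hK (mem_range_self n)
    rw [RealEnergyEntropyIneq] at h1
    simp only [Function.comp] at h2
    rw [le_div_iff₀ (by linarith)]
    linarith

/-- For `c > 0` the inequality bounds the entropies of the dilates. Fatou's lemma applies after
adding `1`, because `x log x ≥ -1`. -/
lemma DilateIneq.integrable_mul_log (h : DilateIneq s μ c l κ f) (hμ : -(1 / 2) < μ)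
    (hf : f ∈ space s μ 2) (hc : 0 < c)
    (hE : Integrable (fun z => ‖z‖ ^ 2 * ‖f z‖ ^ 2) (nu s μ)) :
    Integrable (fun z => ‖f z‖ ^ 2 * Real.log (‖f z‖ ^ 2)) (nu s μ) := by
  have : Fact (-(1 / 2) < μ) := ⟨hμ⟩
  have hfc := hf.1.continuous
  have hN := tendsto_integral_norm_sq_dilate hμ hf
  have hlim := ((hN.const_mul l).add ((tendsto_energy_dilate hμ hfc hE).const_mul κ)).add
    (((Real.continuous_mul_log.tendsto _).comp hN).const_mul c)
  obtain ⟨K, hK⟩ := hlim.bddAbove_range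
  have hcl : Continuous fun z => ‖f z‖ ^ 2 * Real.log (‖f z‖ ^ 2) :=
    Real.continuous_mul_log.comp (hfc.norm.pow 2)
  have hi : Integrable (fun z => ‖f z‖ ^ 2 * Real.log (‖f z‖ ^ 2) + 1) (nu s μ) := by
    refine integrable_of_tendsto_of_integral_le (K := K / c + ∫ _z, (1 : ℝ) ∂(nu s μ))
      (F := fun n z => ‖f (dilationFactor n * z)‖ ^ 2 *
        Real.log (‖f (dilationFactor n * z)‖ ^ 2) + 1)
      (hcl.add continuous_const).aestronglyMeasurable
      (fun n z => ?_) (fun n => ?_)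
      (fun z => ((hcl.tendsto z).comp (f := fun n => dilationFactor n * z) ?_).add_const _)
      fun n => ?_
    · have := Real.self_sub_one_le_mul_log (x := ‖f (dilationFactor n * z)‖ ^ 2) (by positivity)
      have : 0 ≤ ‖f (dilationFactor n * z)‖ ^ 2 := by positivity
      linarith
    · have := dilationFactor_bounds n
      exact (h _ (by linarith) this.2).2.1.add (integrable_const 1)
    · exact tendsto_dilate continuous_id z
    · have := dilationFactor_bounds n
      obtain ⟨h1, h3, -⟩ := h _ (by linarith) this.2
      have h2 := hK (mem_range_self n)
      rw [RealEnergyEntropyIneq] at h1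
      simp only [Function.comp] at h2
      rw [integral_add h3 (integrable_const 1)]
      gcongr
      rw [le_div_iff₀ hc]
      linarith
  refine (hi.sub (integrable_const 1)).congr (Eventually.of_forall fun z => ?_)
  simp

end space

/-! ### The operator norm of the transform -/

/-- The infimum defining the norm is itself admissible. Division by `‖f‖` shows this, except for
`‖f‖ = 0`, where any finite bound suffices. -/
lemma eLpNorm_transform_le (s : Parity) {μ : ℝ} (hμ : -(1 / 2) < μ) {p q : ℝ≥0∞}
    (hp : 1 < p) (hq : 1 ≤ q) (hq_top : q < ∞) {a : ℝ}
    (ha : (ENNReal.conjExponent p).toReal * q.toReal / 4 - 1 < a) {f : ℂ → ℂ}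
    (hf : MemLp f p (nu s μ)) :
    eLpNorm (transform s μ f) q (nuWeighted s μ a) ≤
      transformNorm s μ p q a * eLpNorm f p (nu s μ) := by
  obtain ⟨C, hC, h⟩ := exists_transform_bound s hμ hp hq hq_top ha
  by_cases h0 : eLpNorm f p (nu s μ) = 0
  · have := (h f hf).2
    rw [h0, mul_zero] at this ⊢
    exact this
  · rw [← ENNReal.div_le_iff h0 hf.2.ne]
    refine le_sInf fun D hD => ?_
    rw [ENNReal.div_le_iff h0 hf.2.ne]
    exact hD f hf

lemma transformNorm_lt_top (s : Parity) {μ : ℝ} (hμ : -(1 / 2) < μ) {p q : ℝ≥0∞}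
    (hp : 1 < p) (hq : 1 ≤ q) (hq_top : q < ∞) {a : ℝ}
    (ha : (ENNReal.conjExponent p).toReal * q.toReal / 4 - 1 < a) :
    transformNorm s μ p q a < ∞ := by
  obtain ⟨C, hC, h⟩ := exists_transform_bound s hμ hp hq hq_top ha
  have hle : transformNorm s μ p q a ≤ C := sInf_le fun f hf => (h f hf).2
  exact hle.trans_lt hC.lt_top

lemma transform_mem_spaceWeighted (s : Parity) {μ : ℝ} (hμ : -(1 / 2) < μ) {p q : ℝ≥0∞}
    (hp : 1 < p) (hq : 1 ≤ q) (hq_top : q < ∞) {a : ℝ}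
    (ha : (ENNReal.conjExponent p).toReal * q.toReal / 4 - 1 < a) {f : ℂ → ℂ}
    (hf : MemLp f p (nu s μ)) :
    (∀ w, Integrable (fun z => kernel s μ z w * f z) (nu s μ)) ∧
      transform s μ f ∈ spaceWeighted s μ q a := by
  obtain ⟨C, hC, h⟩ := exists_transform_bound s hμ hp hq hq_top ha
  obtain ⟨⟨b, hb, hi⟩, hle⟩ := h f hf
  have hd := differentiable_transform hμ hb hf.1 hi
  exact ⟨fun w => (integrable_kernelCoeff_sum_mul hμ hb hf.1 hi w).1, hd, transform_neg f,
    hd.continuous.aestronglyMeasurable, hle.trans_lt (ENNReal.mul_lt_top hC.lt_top hf.2)⟩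

lemma transform_monomial (s : Parity) {μ : ℝ} (hμ : -(1 / 2) < μ) {j : ℕ}
    (hj : (-1 : ℝ) ^ j = s.sign) : transform s μ (fun z => z ^ j) = fun z => z ^ j := by
  have h := transform_polynomial s hμ (j + 1) (fun k => if k = j then 1 else 0) fun k hk =>
    if_neg fun h => hk (by rwa [h])
  simpa using h

lemma ae_nuWeighted_iff (s : Parity) {μ : ℝ} (hμ : -(1 / 2) < μ) (a : ℝ) {P : ℂ → Prop} :
    (∀ᵐ z ∂(nuWeighted s μ a), P z) ↔ ∀ᵐ z, P z := by
  have hne : ∀ᵐ z : ℂ, z ≠ 0 := by simp [ae_iff]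
  rw [nuWeighted, ae_withDensity_iff (by fun_prop), nu,
    ae_withDensity_iff (measurable_density s μ).ennreal_ofReal]
  constructor
  · intro h
    filter_upwards [h, hne] with z hz h0
    exact hz (ENNReal.ofReal_pos.mpr (density_pos s hμ h0)).ne'
      (ENNReal.ofReal_pos.mpr (Real.exp_pos _)).ne'
  · intro h
    filter_upwards [h] with z hz _ _ using hz

/-- Were the norm zero, transforms of truncated monomials would vanish almost everywhere, yet they
converge to the monomial. Truncation puts the test functions into `L^p` for `p = ∞` as well. -/
lemma transformNorm_pos (s : Parity) {μ : ℝ} (hμ : -(1 / 2) < μ) {p q : ℝ≥0∞}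
    (hp : 1 < p) (hq : 1 ≤ q) (hq_top : q < ∞) {a : ℝ}
    (ha : (ENNReal.conjExponent p).toReal * q.toReal / 4 - 1 < a) :
    0 < transformNorm s μ p q a := by
  have : Fact (-(1 / 2) < μ) := ⟨hμ⟩
  obtain ⟨j, hj⟩ : ∃ j : ℕ, (-1 : ℝ) ^ j = s.sign := by
    cases s
    · exact ⟨0, by simp [Parity.sign]⟩
    · exact ⟨1, by simp [Parity.sign]⟩
  have hq0 : q ≠ 0 := (zero_lt_one.trans_le hq).ne'
  have hne : ∀ᵐ z : ℂ, z ≠ 0 := by simp [ae_iff]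
  rw [pos_iff_ne_zero]
  intro h0
  -- truncations of the monomial `z ^ j` have transforms that vanish almost everywhere
  set F : ℕ → ℂ → ℂ := fun n => indicator (Metric.closedBall 0 n) fun z => z ^ j with hF
  have hFm : ∀ n, Measurable (F n) := fun n =>
    (by fun_prop : Measurable fun z : ℂ => z ^ j).indicator measurableSet_closedBall
  have hFle : ∀ n z, ‖F n z‖ ≤ ‖z ^ j‖ := fun n z => norm_indicator_le_norm_self _ _
  have hFp : ∀ n, MemLp (F n) p (nu s μ) := fun n => by
    refine MemLp.of_bound (hFm n).aestronglyMeasurable ((n : ℝ) ^ j)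
      (Eventually.of_forall fun z => ?_)
    simp only [hF, indicator]
    split_ifs with hz
    · rw [norm_pow]
      gcongr
      simpa using hz
    · simp
  have hF0 : ∀ n, ∀ᵐ w : ℂ, transform s μ (F n) w = 0 := fun n => by
    rw [← ae_nuWeighted_iff s hμ a]
    have h1 := eLpNorm_transform_le s hμ hp hq hq_top ha (hFp n)
    have h2 := (transform_mem_spaceWeighted s hμ hp hq hq_top ha (hFp n)).2.2.2.1
    rw [h0, zero_mul, nonpos_iff_eq_zero, eLpNorm_eq_zero_iff h2 hq0] at h1
    exact h1
  have hlim : ∀ w, Tendsto (fun n => transform s μ (F n) w) atTop (𝓝 (w ^ j)) := fun w => by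
    have hg : SubgaussianGrowth fun z : ℂ => z ^ j := by
      simpa using subgaussianGrowth_polynomial (j + 1) fun k => if k = j then 1 else 0
    have hc : Continuous fun z : ℂ => z ^ j := by fun_prop
    have hi := (integrable_kernelCoeff_sum_mul hμ one_half_pos hc.aestronglyMeasurable
      (integrable_exp_mul_norm_of_growth s hμ one_half_lt_one hc.aestronglyMeasurable hg) w).1
    have hw : w ^ j = ∫ z, kernel s μ z w * z ^ j ∂(nu s μ) :=
      (congrFun (transform_monomial s hμ hj) w).symm
    rw [hw]
    refine tendsto_integral_of_dominated_convergence (fun z => ‖kernel s μ z w * z ^ j‖)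
      (fun n => (transform_mem_spaceWeighted s hμ hp hq hq_top ha (hFp n)).1 w |>.1) hi.norm
      (fun n => Eventually.of_forall fun z => ?_) (Eventually.of_forall fun z => ?_)
    · rw [norm_mul, norm_mul]
      gcongr
      exact hFle n z
    · refine tendsto_const_nhds.congr' ?_
      filter_upwards [eventually_ge_atTop ⌈‖z‖⌉₊] with n hn
      simp only [hF]
      rw [indicator_of_mem]
      simpa using (Nat.le_ceil _).trans (Nat.cast_le.mpr hn)
  have hz : ∀ᵐ w : ℂ, False := by
    filter_upwards [ae_all_iff.mpr hF0, hne] with w hw hw0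
    have h1 : Tendsto (fun n => transform s μ (F n) w) atTop (𝓝 0) := by
      simp only [hw]
      exact tendsto_const_nhds
    exact pow_ne_zero j hw0 (tendsto_nhds_unique (hlim w) h1)
  simp [ae_iff] at hz

/-- Test on the constant `1`: it is fixed by the transform, `ν` is a probability measure, and for `a
< 0` the weight only enlarges the measure. -/
lemma one_le_transformNorm_even {μ : ℝ} (hμ : -(1 / 2) < μ) {p q : ℝ≥0∞}
    (hp : 1 < p) (hq : 1 ≤ q) (hq_top : q < ∞) {a : ℝ}
    (ha : (ENNReal.conjExponent p).toReal * q.toReal / 4 - 1 < a) (ha0 : a < 0) :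
    1 ≤ transformNorm .even μ p q a := by
  have : Fact (-(1 / 2) < μ) := ⟨hμ⟩
  have hu : nu .even μ univ = 1 := by
    have := nu_even_univ hμ
    rwa [measureReal_def, ENNReal.toReal_eq_one_iff] at this
  have : IsProbabilityMeasure (nu .even μ) := ⟨hu⟩
  have hp0 : p ≠ 0 := (zero_lt_one.trans hp).ne'
  have hq0 : q ≠ 0 := (zero_lt_one.trans_le hq).ne'
  have hone : ∀ {r : ℝ≥0∞}, r ≠ 0 → eLpNorm (fun _ : ℂ => (1 : ℂ)) r (nu .even μ) = 1 :=
    fun hr => by simp [eLpNorm_const _ hr (IsProbabilityMeasure.ne_zero _)]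
  have hT : transform .even μ (fun _ => 1) = fun _ => 1 := by
    simpa using transform_monomial .even hμ (j := 0) (by simp [Parity.sign])
  have h := eLpNorm_transform_le .even hμ hp hq hq_top ha
    (memLp_const (1 : ℂ) : MemLp (fun _ => (1 : ℂ)) p (nu .even μ))
  rw [hT, hone hp0, mul_one] at h
  refine le_trans ?_ h
  rw [← hone hq0]
  refine eLpNorm_mono_measure _ ?_
  calc nu .even μ = (nu .even μ).withDensity fun _ => 1 := by simp
    _ ≤ _ := withDensity_mono (Eventually.of_forall fun z => by
      rw [ENNReal.one_le_ofReal]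
      exact Real.one_le_exp (by nlinarith [sq_nonneg ‖z‖]))

/-! ### Exponents -/

lemma one_sub_inv_mul_conjExponent {p : ℝ≥0∞} (hp : 1 < p) :
    (1 - (p⁻¹).toReal) * (ENNReal.conjExponent p).toReal = 1 ∧ 0 ≤ (p⁻¹).toReal ∧
      (p⁻¹).toReal < 1 := by
  have h : ENNReal.HolderConjugate p p.conjExponent := ENNReal.HolderConjugate.conjExponent hp.le
  have h1 := ENNReal.HolderConjugate.inv_add_inv_eq_one p p.conjExponent
  have hp1 : p⁻¹ < 1 := ENNReal.inv_lt_one.mpr hp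
  have hr1 : p.conjExponent⁻¹ ≤ 1 := h1 ▸ le_add_self
  have h2 : (p⁻¹).toReal + (p.conjExponent⁻¹).toReal = 1 := by
    rw [← ENNReal.toReal_add hp1.ne_top (hr1.trans_lt ENNReal.one_lt_top).ne, h1,
      ENNReal.toReal_one]
  have h3 : (p⁻¹).toReal < 1 := by
    rw [← ENNReal.toReal_one]
    exact (ENNReal.toReal_lt_toReal hp1.ne_top ENNReal.one_ne_top).mpr hp1
  refine ⟨?_, ENNReal.toReal_nonneg, h3⟩
  have h4 : (p.conjExponent⁻¹).toReal = (p.conjExponent.toReal)⁻¹ := ENNReal.toReal_inv _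
  have h5 : 1 - (p⁻¹).toReal = (p.conjExponent.toReal)⁻¹ := by linarith
  rw [h5]
  refine inv_mul_cancel₀ fun h6 => ?_
  rw [h6, inv_zero] at h5
  linarith

/-! ### Entropy and energy as extended real numbers -/

section extended

variable {s : Parity} {μ : ℝ} {f : ℂ → ℂ}

lemma normSq_eq (hf : f ∈ space s μ 2) : normSq (nu s μ) f = ∫ z, ‖f z‖ ^ 2 ∂(nu s μ) :=
  norm_toLp_sq hf.2.2

lemma extendedIntegral_of_integrable {X : Type*} [MeasurableSpace X] {ν : Measure X} {g : X → ℝ}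
    (hg : Integrable g ν) : extendedIntegral ν g = ((∫ x, g x ∂ν : ℝ) : EReal) := by
  have h1 : ∫⁻ x, ENNReal.ofReal (g x) ∂ν ≠ ∞ := hg.lintegral_lt_top.ne
  have h2 : ∫⁻ x, ENNReal.ofReal (-g x) ∂ν ≠ ∞ := hg.neg.lintegral_lt_top.ne
  rw [extendedIntegral, integral_eq_lintegral_pos_part_sub_lintegral_neg_part hg, EReal.coe_sub,
    EReal.coe_ennreal_toReal h1, EReal.coe_ennreal_toReal h2]

lemma entropy_of_integrable (hf : f ∈ space s μ 2)
    (h : Integrable (fun z => ‖f z‖ ^ 2 * Real.log (‖f z‖ ^ 2)) (nu s μ)) :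
    entropy (nu s μ) f = ((∫ z, ‖f z‖ ^ 2 * Real.log (‖f z‖ ^ 2) ∂(nu s μ) -
      (∫ z, ‖f z‖ ^ 2 ∂(nu s μ)) * Real.log (∫ z, ‖f z‖ ^ 2 ∂(nu s μ)) : ℝ) : EReal) := by
  rw [entropy, extendedIntegral_of_integrable h, normSq_eq hf, EReal.coe_sub]

/-- As `x log x ≥ -1` and the measure is finite, only the positive part can diverge. -/
lemma entropy_of_not_integrable (hμ : -(1 / 2) < μ) (hf : f ∈ space s μ 2)
    (h : ¬ Integrable (fun z => ‖f z‖ ^ 2 * Real.log (‖f z‖ ^ 2)) (nu s μ)) :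
    entropy (nu s μ) f = ⊤ := by
  have : Fact (-(1 / 2) < μ) := ⟨hμ⟩
  set g : ℂ → ℝ := fun z => ‖f z‖ ^ 2 * Real.log (‖f z‖ ^ 2) with hg
  have hgc : Continuous g := Real.continuous_mul_log.comp (hf.1.continuous.norm.pow 2)
  have h1 : ∀ z, -g z ≤ 1 := fun z => by
    have := Real.self_sub_one_le_mul_log (x := ‖f z‖ ^ 2) (by positivity)
    have : 0 ≤ ‖f z‖ ^ 2 := by positivity
    simp only [hg]
    linarith
  have hneg : ∫⁻ z, ENNReal.ofReal (-g z) ∂(nu s μ) ≠ ∞ := by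
    refine ((lintegral_mono fun z => ENNReal.ofReal_le_ofReal (h1 z)).trans_lt ?_).ne
    simp
  have hpos : ∫⁻ z, ENNReal.ofReal (g z) ∂(nu s μ) = ∞ := by
    by_contra hne
    refine h ⟨hgc.aestronglyMeasurable, ?_⟩
    rw [hasFiniteIntegral_iff_norm]
    refine lt_of_le_of_lt (b := ∫⁻ z, (ENNReal.ofReal (g z) + ENNReal.ofReal (-g z)) ∂(nu s μ))
      (lintegral_mono fun z => ?_) ?_
    · rcases le_total 0 (g z) with h2 | h2
      · rw [Real.norm_of_nonneg h2]
        exact le_self_add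
      · rw [Real.norm_of_nonpos h2]
        exact le_add_self
    · rw [lintegral_add_left (by fun_prop)]
      exact ENNReal.add_lt_top.mpr ⟨lt_top_iff_ne_top.mpr hne, lt_top_iff_ne_top.mpr hneg⟩
  rw [entropy, extendedIntegral, hpos, EReal.coe_ennreal_top, ← EReal.coe_ennreal_toReal hneg,
    EReal.top_sub_coe, EReal.top_sub_coe]

lemma energy_of_integrable (h : Integrable (fun z => ‖z‖ ^ 2 * ‖f z‖ ^ 2) (nu s μ)) :
    (energy s μ f : EReal) = ((∫ z, ‖z‖ ^ 2 * ‖f z‖ ^ 2 ∂(nu s μ) : ℝ) : EReal) := by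
  rw [energy, ← ofReal_integral_eq_lintegral_ofReal h (Eventually.of_forall fun z => by positivity),
    EReal.coe_ennreal_ofReal, max_eq_left (integral_nonneg fun z => by positivity)]

lemma energy_of_not_integrable (hf : Continuous f)
    (h : ¬ Integrable (fun z => ‖z‖ ^ 2 * ‖f z‖ ^ 2) (nu s μ)) : energy s μ f = ∞ := by
  by_contra hne
  refine h ⟨by fun_prop, ?_⟩
  rw [hasFiniteIntegral_iff_ofReal (Eventually.of_forall fun z => by positivity)]
  exact lt_top_iff_ne_top.mpr hne

/-- Jensen in tangent form: `|f|² log(|f|²/N) ≥ |f|² - N`, and integration gives `S ≥ N(1 - ν(ℂ))`.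
-/
lemma entropy_nonneg (hμ : -(1 / 2) < μ) (hν : (nu s μ).real univ ≤ 1) (hf : f ∈ space s μ 2) :
    0 ≤ entropy (nu s μ) f := by
  have : Fact (-(1 / 2) < μ) := ⟨hμ⟩
  by_cases h : Integrable (fun z => ‖f z‖ ^ 2 * Real.log (‖f z‖ ^ 2)) (nu s μ)
  swap
  · rw [entropy_of_not_integrable hμ hf h]
    exact le_top
  rw [entropy_of_integrable hf h]
  have hi : Integrable (fun z => ‖f z‖ ^ 2) (nu s μ) := hf.2.2.integrable_norm_pow two_ne_zero
  set N := ∫ z, ‖f z‖ ^ 2 ∂(nu s μ) with hN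
  have hN0 : 0 ≤ N := integral_nonneg fun z => by positivity
  norm_cast
  rcases hN0.eq_or_lt with h0 | h0
  · have h1 := (integral_eq_zero_iff_of_nonneg (fun z => by positivity) hi).mp (hN.symm.trans h0.symm)
    have h2 : ∫ z, ‖f z‖ ^ 2 * Real.log (‖f z‖ ^ 2) ∂(nu s μ) = 0 :=
      integral_eq_zero_of_ae (h1.mono fun z hz => by
        simp only [Pi.zero_apply] at hz ⊢
        rw [hz, zero_mul])
    rw [h2, ← h0]
    simp
  · have h1 : ∀ z, ‖f z‖ ^ 2 * Real.log N + ‖f z‖ ^ 2 - N ≤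
        ‖f z‖ ^ 2 * Real.log (‖f z‖ ^ 2) := fun z => by
      rcases (by positivity : 0 ≤ ‖f z‖ ^ 2).eq_or_lt with h2 | h2
      · rw [← h2]
        linarith
      · have h3 := Real.one_sub_inv_le_log_of_pos (div_pos h2 h0)
        rw [Real.log_div h2.ne' h0.ne', inv_div] at h3
        have h4 := mul_le_mul_of_nonneg_left h3 h2.le
        have h5 : ‖f z‖ ^ 2 * (1 - N / ‖f z‖ ^ 2) = ‖f z‖ ^ 2 - N := by
          rw [mul_sub, mul_one, mul_div_cancel₀ _ h2.ne']
        linarith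
    have hi2 : Integrable (fun z => ‖f z‖ ^ 2 * Real.log N + ‖f z‖ ^ 2) (nu s μ) :=
      (hi.mul_const _).add hi
    have hi3 : Integrable (fun z => ‖f z‖ ^ 2 * Real.log N + ‖f z‖ ^ 2 - N) (nu s μ) :=
      hi2.sub (integrable_const N)
    have h6 := integral_mono hi3 h h1
    rw [integral_sub hi2 (integrable_const N),
      integral_add (hi.mul_const _) hi, integral_mul_const, ← hN, integral_const, smul_eq_mul] at h6
    nlinarith

lemma memLp_two_of_gt (hμ : -(1 / 2) < μ) {e : ℝ} (he : 0 < e)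
    (hf : f ∈ space s μ (ENNReal.ofReal (2 + e))) :
    f ∈ space s μ 2 ∧ Integrable (fun z => ‖f z‖ ^ 2 * Real.log (‖f z‖ ^ 2)) (nu s μ) := by
  have : Fact (-(1 / 2) < μ) := ⟨hμ⟩
  obtain ⟨hd, hs, hL⟩ := hf
  refine ⟨⟨hd, hs, hL.mono_exponent ?_⟩, ?_⟩
  · rw [← ENNReal.ofReal_ofNat]
    exact ENNReal.ofReal_le_ofReal (by linarith)
  have hi := hL.integrable_norm_rpow (by simp; linarith) ENNReal.ofReal_ne_top
  rw [ENNReal.toReal_ofReal (by linarith)] at hi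
  refine ((integrable_const 1).add (hi.const_mul (e / 2)⁻¹)).mono'
    (Real.continuous_mul_log.comp (hd.continuous.norm.pow 2)).aestronglyMeasurable
    (Eventually.of_forall fun z => ?_)
  rw [Pi.add_apply, Real.norm_eq_abs]
  set y := ‖f z‖ ^ 2 with hy
  have hy0 : 0 ≤ y := by positivity
  rcases hy0.eq_or_lt with h0 | h0
  · rw [← h0, zero_mul, abs_zero]
    positivity
  rcases le_total y 1 with h | h
  · have := Real.abs_log_mul_self_lt y h0 h
    rw [mul_comm]
    have : 0 ≤ (e / 2)⁻¹ * ‖f z‖ ^ (2 + e) := by positivity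
    linarith
  · have h1 := Real.log_nonneg h
    have h2 := Real.log_le_rpow_div hy0 (half_pos he)
    have h3 : ‖f z‖ ^ (2 + e) = y * y ^ (e / 2) := by
      rw [hy, ← Real.rpow_natCast, ← Real.rpow_mul (norm_nonneg _),
        Real.rpow_add_of_nonneg (norm_nonneg _) (by norm_num) he.le]
      congr 2
      push_cast
      ring
    rw [abs_of_nonneg (by positivity), h3]
    have h4 := mul_le_mul_of_nonneg_left h2 hy0
    have h5 : y * (y ^ (e / 2) / (e / 2)) = (e / 2)⁻¹ * (y * y ^ (e / 2)) := by ring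
    linarith

end extended

/-! ### From dilated inequalities to inequalities between extended reals -/

section extendedInequality

variable {s : Parity} {μ c l κ : ℝ} {f : ℂ → ℂ}

/-- Infinite energy is impossible for `κ < 0`, invisible for `κ = 0` by `0 · ∞ = 0`, and makes the
right side infinite for `κ > 0`. -/
lemma DilateIneq.ereal_of_integrable (h : DilateIneq s μ c l κ f) (hμ : -(1 / 2) < μ)
    (hf : f ∈ space s μ 2)
    (hS : Integrable (fun z => ‖f z‖ ^ 2 * Real.log (‖f z‖ ^ 2)) (nu s μ)) :
    (c : EReal) * entropy (nu s μ) f ≤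
      ((l * normSq (nu s μ) f : ℝ) : EReal) + (κ : EReal) * (energy s μ f : EReal) := by
  rw [entropy_of_integrable hf hS, normSq_eq hf]
  by_cases hE : Integrable (fun z => ‖z‖ ^ 2 * ‖f z‖ ^ 2) (nu s μ)
  · have := h.of_integrable hμ hf hS (Or.inr hE)
    rw [energy_of_integrable hE]
    exact_mod_cast this
  · rw [energy_of_not_integrable hf.1.continuous hE, EReal.coe_ennreal_top]
    rcases lt_trichotomy κ 0 with hκ | rfl | hκ
    · exact absurd (h.integrable_energy hμ hf hκ hS) hE
    · have := h.of_integrable hμ hf hS (Or.inl rfl)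
      rw [RealEnergyEntropyIneq, zero_mul, add_zero] at this
      rw [EReal.coe_zero, zero_mul, add_zero]
      exact_mod_cast this
    · rw [EReal.coe_mul_top_of_pos hκ, EReal.coe_add_top]
      exact le_top

lemma DilateIneq.ereal_of_pos (h : DilateIneq s μ c l κ f) (hμ : -(1 / 2) < μ)
    (hf : f ∈ space s μ 2) (hc : 0 < c) (hκ : 0 < κ) :
    (c : EReal) * entropy (nu s μ) f ≤
      ((l * normSq (nu s μ) f : ℝ) : EReal) + (κ : EReal) * (energy s μ f : EReal) := by
  by_cases hS : Integrable (fun z => ‖f z‖ ^ 2 * Real.log (‖f z‖ ^ 2)) (nu s μ)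
  · exact h.ereal_of_integrable hμ hf hS
  · rw [energy_of_not_integrable hf.1.continuous fun hE => hS (h.integrable_mul_log hμ hf hc hE),
      EReal.coe_ennreal_top, EReal.coe_mul_top_of_pos hκ, EReal.coe_add_top]
    exact le_top

lemma DilateIneq.ereal_of_neg (h : DilateIneq s μ c l κ f) (hμ : -(1 / 2) < μ)
    (hf : f ∈ space s μ 2) (hc : c < 0) :
    (c : EReal) * entropy (nu s μ) f ≤
      ((l * normSq (nu s μ) f : ℝ) : EReal) + (κ : EReal) * (energy s μ f : EReal) := by
  by_cases hS : Integrable (fun z => ‖f z‖ ^ 2 * Real.log (‖f z‖ ^ 2)) (nu s μ)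
  · exact h.ereal_of_integrable hμ hf hS
  · rw [entropy_of_not_integrable hμ hf hS, EReal.coe_mul_top_of_neg hc]
    exact bot_le

lemma DilateIneq.direct_logSobolev (h : DilateIneq s μ c l κ f) (hμ : -(1 / 2) < μ)
    (hf : f ∈ space s μ 2) (hc : 0 < c) (hκ : 0 < κ) :
    entropy (nu s μ) f ≤ ((κ / c : ℝ) : EReal) * (energy s μ f : EReal) +
      ((max l 0 / c * normSq (nu s μ) f : ℝ) : EReal) := by
  by_cases hE : Integrable (fun z => ‖z‖ ^ 2 * ‖f z‖ ^ 2) (nu s μ)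
  · have hS := h.integrable_mul_log hμ hf hc hE
    have h1 := h.of_integrable hμ hf hS (Or.inr hE)
    rw [entropy_of_integrable hf hS, energy_of_integrable hE, normSq_eq hf]
    norm_cast
    have hN0 : 0 ≤ ∫ z, ‖f z‖ ^ 2 ∂(nu s μ) := integral_nonneg fun z => by positivity
    have h2 := mul_le_mul_of_nonneg_right (le_max_left l 0) hN0
    rw [RealEnergyEntropyIneq] at h1
    rw [div_mul_eq_mul_div, div_mul_eq_mul_div, ← add_div, le_div_iff₀ hc]
    linarith
  · rw [energy_of_not_integrable hf.1.continuous hE, EReal.coe_ennreal_top,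
      EReal.coe_mul_top_of_pos (div_pos hκ hc), EReal.top_add_coe]
    exact le_top

lemma DilateIneq.reverse_logSobolev (h : DilateIneq s μ c l κ f) (hμ : -(1 / 2) < μ)
    (hf : f ∈ space s μ 2) (hc : c < 0) (hκ : κ < 0) :
    (energy s μ f : EReal) ≤ ((c / κ : ℝ) : EReal) * entropy (nu s μ) f +
      ((max l 0 / -κ * normSq (nu s μ) f : ℝ) : EReal) := by
  by_cases hS : Integrable (fun z => ‖f z‖ ^ 2 * Real.log (‖f z‖ ^ 2)) (nu s μ)
  · have hE := h.integrable_energy hμ hf hκ hS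
    have h1 := h.of_integrable hμ hf hS (Or.inr hE)
    rw [entropy_of_integrable hf hS, energy_of_integrable hE, normSq_eq hf]
    norm_cast
    have hN0 : 0 ≤ ∫ z, ‖f z‖ ^ 2 ∂(nu s μ) := integral_nonneg fun z => by positivity
    have h2 := mul_le_mul_of_nonneg_right (le_max_left l 0) hN0
    rw [RealEnergyEntropyIneq] at h1
    have hκ' : 0 < -κ := by linarith
    rw [← neg_div_neg_eq c κ, div_mul_eq_mul_div, div_mul_eq_mul_div, ← add_div, le_div_iff₀ hκ']
    linarith
  · rw [entropy_of_not_integrable hμ hf hS,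
      EReal.coe_mul_top_of_pos (div_pos_of_neg_of_neg hc hκ), EReal.top_add_coe]
    exact le_top

end extendedInequality

end SegalBargmann

/-! ### The theorem: signs of the coefficients and assembly of the cases -/

theorem theorem4p3 (s : Parity) (μ : ℝ) (hμ : -(1 / 2) < μ) (p q : ℝ≥0∞)
    (hp : 1 < p) (hq : 1 ≤ q) (hq_top : q < ∞) (a : ℝ)
    (ha : (ENNReal.conjExponent p).toReal * q.toReal / 4 - 1 < a) :
    -- the transform is a bounded operator, so that the real number `log A` is meaningful
    ((∀ f : ℂ → ℂ, MemLp f p (nu s μ) →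
        (∀ w, Integrable (fun z => kernel s μ z w * f z) (nu s μ)) ∧
          transform s μ f ∈ spaceWeighted s μ q a) ∧
      0 < transformNorm s μ p q a ∧ transformNorm s μ p q a < ∞) ∧
    -- the inequality under the first and under the second hypothesis
    (∀ f : ℂ → ℂ, (∃ ε : ℝ, 0 < ε ∧ f ∈ space s μ (ENNReal.ofReal (2 + ε))) →
      EnergyEntropyIneq s μ p q a f) ∧
    (∀ f : ℂ → ℂ, f ∈ space s μ 2 → p ≤ 2 → q ≤ 2 → entropy (nu s μ) f < ⊤ →
      EnergyEntropyIneq s μ p q a f) ∧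
    -- first case: direct log-Sobolev inequality
    ((q⁻¹).toReal < (p⁻¹).toReal →
      0 < (ENNReal.conjExponent p).toReal * q.toReal / 4 - 1 ∧ 0 < a ∧
      0 < entropyCoeff p q ∧ 0 < a / q.toReal ∧
      (∀ f ∈ space s μ 2, EnergyEntropyIneq s μ p q a f) ∧
      IsDirectLogSobolev (nu s μ) (space s μ 2) (energy s μ)
        ((a / q.toReal) / entropyCoeff p q)
        (max (Real.log (transformNorm s μ p q a).toReal) 0 / entropyCoeff p q)) ∧
    -- second case: trivial inequality
    ((p⁻¹).toReal ≤ (q⁻¹).toReal →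
      0 ≤ (ENNReal.conjExponent p).toReal * q.toReal / 4 - 1 →
      0 < a ∧ 0 < a / q.toReal ∧ entropyCoeff p q ≤ 0 ∧
      ((s = Parity.even ∨ μ ≤ 0) → ∀ f ∈ space s μ 2,
        0 ≤ entropy (nu s μ) f ∧
        ((entropyCoeff p q : ℝ) : EReal) * entropy (nu s μ) f ≤ 0 ∧
        0 ≤ ((a / q.toReal : ℝ) : EReal) * (energy s μ f : EReal) ∧
        (1 ≤ transformNorm s μ p q a → EnergyEntropyIneq s μ p q a f))) ∧
    -- third case: reverse log-Sobolev inequality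
    ((ENNReal.conjExponent p).toReal * q.toReal / 4 - 1 < 0 →
      (p⁻¹).toReal < (q⁻¹).toReal ∧ entropyCoeff p q < 0 ∧
      (a < 0 →
        a / q.toReal < 0 ∧
        (∀ f ∈ space s μ 2, EnergyEntropyIneq s μ p q a f) ∧
        IsReverseLogSobolev (nu s μ) (space s μ 2) (energy s μ)
          (entropyCoeff p q / (a / q.toReal))
          (max (Real.log (transformNorm s μ p q a).toReal) 0 / (-(a / q.toReal))) ∧
        (s = Parity.even → 1 ≤ transformNorm s μ p q a))) := by
  set A := transformNorm s μ p q a with hAdef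
  have hA0 : 0 < A := transformNorm_pos s hμ hp hq hq_top ha
  have hA1 : A < ∞ := transformNorm_lt_top s hμ hp hq hq_top ha
  have hAr : 0 < A.toReal := ENNReal.toReal_pos hA0.ne' hA1.ne
  obtain ⟨hPR, hP0, hP1⟩ := one_sub_inv_mul_conjExponent hp
  set P := (p⁻¹).toReal with hP
  set R := (ENNReal.conjExponent p).toReal with hR
  have hx1 : 1 ≤ q.toReal := by
    rw [← ENNReal.toReal_one]
    exact ENNReal.toReal_mono hq_top.ne hq
  have hQ : (q⁻¹).toReal = (q.toReal)⁻¹ := ENNReal.toReal_inv q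
  set x := q.toReal with hx
  have hx0 : 0 < x := by linarith
  have hR0 : 0 < R := by
    by_contra h
    nlinarith
  have hR1 : 1 ≤ R := by nlinarith
  -- From `p' ≥ 1` and `q ≥ 1`: `a/q > p'/4 - 1/q ≥ -3/4`.
  have hax : -(3 / 4) < a / x := by
    rw [lt_div_iff₀ hx0]
    nlinarith
  have hD : ∀ f ∈ space s μ 2, DilateIneq s μ (entropyCoeff p q) (Real.log A.toReal) (a / x) f :=
    fun f hf r h0 h1 => realEnergyEntropyIneq_dilate s hμ hp hq hq_top hAr hax
      (fun h hh => by
        rw [ENNReal.ofReal_toReal hA1.ne]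
        exact eLpNorm_transform_le s hμ hp hq hq_top ha hh) hf h0 h1
  have hc : entropyCoeff p q = P - x⁻¹ := by rw [entropyCoeff, hQ]
  rw [hQ]
  refine ⟨⟨fun f hf => transform_mem_spaceWeighted s hμ hp hq hq_top ha hf, hA0, hA1⟩, ?_, ?_,
    ?_, ?_, ?_⟩
  · rintro f ⟨e, he, hf⟩
    obtain ⟨hf2, hS⟩ := memLp_two_of_gt hμ he hf
    exact (hD f hf2).ereal_of_integrable hμ hf2 hS
  · intro f hf _ _ hlt
    refine (hD f hf).ereal_of_integrable hμ hf ?_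
    by_contra hS
    rw [entropy_of_not_integrable hμ hf hS] at hlt
    exact lt_irrefl _ hlt
  · intro hlt
    have hc0 : 0 < entropyCoeff p q := by rw [hc]; linarith
    have h1 : 1 < P * x := by rwa [inv_lt_iff_one_lt_mul₀ hx0] at hlt
    have h2 : 0 < R * x / 4 - 1 := by
      -- Together with `q > 1/P` this gives `q > 4(1-P) = 4/p'`.
      have h3 : 4 * (P * (1 - P)) ≤ 1 := by nlinarith [sq_nonneg (2 * P - 1)]
      have hP1' : 0 < 1 - P := by linarith
      have h4 : 4 * (1 - P) < x := by
        by_contra h5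
        push Not at h5
        nlinarith
      have h6 : 4 < R * x := by
        calc (4 : ℝ) = R * (4 * (1 - P)) := by linear_combination -4 * hPR
          _ < R * x := by gcongr
      linarith
    have ha0 : 0 < a := h2.trans ha
    have hκ : 0 < a / x := by positivity
    exact ⟨h2, ha0, hc0, hκ, fun f hf => (hD f hf).ereal_of_pos hμ hf hc0 hκ, div_pos hκ hc0,
      div_nonneg (le_max_right _ _) hc0.le,
      fun f hf => (hD f hf).direct_logSobolev hμ hf hc0 hκ⟩
  · intro hle h0
    have ha0 : 0 < a := h0.trans_lt ha
    have hκ : 0 < a / x := by positivity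
    have hc0 : entropyCoeff p q ≤ 0 := by rw [hc]; linarith
    refine ⟨ha0, hκ, hc0, fun hs f hf => ?_⟩
    have hν : (nu s μ).real Set.univ ≤ 1 := by
      cases s
      · exact (nu_even_univ hμ).le
      · exact nu_odd_univ_le hμ (hs.resolve_left (by simp))
    have hS := entropy_nonneg hμ hν hf
    have hcS : ((entropyCoeff p q : ℝ) : EReal) * entropy (nu s μ) f ≤ 0 :=
      EReal.mul_nonpos_iff.mpr (Or.inr ⟨by exact_mod_cast hc0, hS⟩)
    have hE : 0 ≤ ((a / x : ℝ) : EReal) * (energy s μ f : EReal) :=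
      EReal.mul_nonneg (by exact_mod_cast hκ.le) (EReal.coe_ennreal_nonneg _)
    refine ⟨hS, hcS, hE, fun h1 => hcS.trans (add_nonneg ?_ hE)⟩
    have h2 : 1 ≤ A.toReal := by
      rw [← ENNReal.toReal_one]
      exact ENNReal.toReal_mono hA1.ne h1
    exact_mod_cast mul_nonneg (Real.log_nonneg h2) (sq_nonneg _)
  · intro h0
    have h1 : P < x⁻¹ := by
      rw [← one_div, lt_div_iff₀ hx0]
      have h3 : 4 * (P * (1 - P)) ≤ 1 := by nlinarith [sq_nonneg (2 * P - 1)]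
      have h4 : x < 4 * (1 - P) := by
        have h5 : R * x < R * (4 * (1 - P)) := by
          have : R * (4 * (1 - P)) = 4 := by linear_combination 4 * hPR
          linarith
        exact lt_of_mul_lt_mul_left h5 hR0.le
      rcases hP0.eq_or_lt with h5 | h5
      · rw [← h5, zero_mul]
        exact one_pos
      · have := mul_lt_mul_of_pos_left h4 h5
        linarith
    have hc0 : entropyCoeff p q < 0 := by rw [hc]; linarith
    refine ⟨h1, hc0, fun ha0 => ?_⟩
    have hκ : a / x < 0 := div_neg_of_neg_of_pos ha0 hx0
    refine ⟨hκ, fun f hf => (hD f hf).ereal_of_neg hμ hf hc0,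
      ⟨div_pos_of_neg_of_neg hc0 hκ, div_nonneg (le_max_right _ _) (by linarith),
        fun f hf => (hD f hf).reverse_logSobolev hμ hf hc0 hκ⟩, ?_⟩
    rintro rfl
    exact one_le_transformNorm_even hμ hp hq hq_top ha ha0
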